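/- Let $N\ge 2$ be an integer, let $a<b$ be real numbers, and let $p(t;x)=\frac1{2\pi}\int_{\mathbb R}\mathrm e^{-\mathrm iux}\,\mathrm e^{-tu^{2N}}\,\mathrm du$ $(t>0,\ x\in\mathbb R)$ be the signed heat kernel of $\partial_t=(-1)^{N-1}\partial_x^{2N}$. The associated pseudo-process $X$ (pseudo-Brownian motion) started at $x$ has the signed finite-dimensional laws $$\mathbb P_x\{X_{t_1}\in\mathrm dx_1,\dots,X_{t_m}\in\mathrm dx_m\}=\prod_{k=1}^m p(t_k-t_{k-1};x_{k-1}-x_k)\,\mathrm dx_1\cdots\mathrm dx_m,\qquad 0=t_0<t_1<\dots<t_m,\ x_0=x .$$ For $n\in\mathbb N$ let $\tau_{ab,n}=2^{-n}\min\{k\ge 0: X_{k/2^n}\notin(a,b)\}$; the pseudo-distribution of the first exit time $\tau_{ab}$ of $X$ from $(a,b)$ is defined as a limit: for $x\in(a,b)$, $t\ge0$, $\lambda>0$, $$\mathbb P_x\{\tau_{ab}\le t\}:=\lim_{n\to\infty}\ \sum_{k\le 2^nt}\mathbb P_x\{\tau_{ab,n}=k/2^n\},$$ $$\mathbb E_x\big(\mathrm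 e^{-\lambda\tau_{ab}}\mathbf 1_{\{\tau_{ab}<\infty\}}\big):=\lim_{n\to\infty}\ \sum_{k\ge0}\mathrm e^{-\lambda k/2^n}\,\mathbb P_x\{\tau_{ab,n}=k/2^n\}.$$ Let $\theta_\ell=\mathrm e^{\mathrm i\pi(2\ell+N-1)/(2N)}$, $1\le\ell\le2N$, be the $2N$-th roots of $(-1)^{N-1}$ and put $e_\lambda^z=\mathrm e^{\lambda^{1/(2N)}z}$. For $\lambda>0$ let $\Delta(\lambda)$ be the $2N\times2N$ determinant whose $\ell$-th column is $$\big(e_\lambda^{\theta_\ell a},\ \theta_\ell e_\lambda^{\theta_\ell a},\dots,\theta_\ell^{N-1}e_\lambda^{\theta_\ell a},\ e_\lambda^{\theta_\ell b},\ \theta_\ell e_\lambda^{\theta_\ell b},\dots,\theta_\ell^{N-1}e_\lambda^{\theta_\ell b}\big)^{\mathsf T},$$ and let $\Delta_0^-(\lambda;x)$ (respectively $\Delta_0^+(\lambda;x)$) be obtained from $\Delta(\lambda)$ by replacing its first row (respectively its $(N+1)$-th row) by $(e_\lambda^{\theta_1x},\dots,e_\lambda^{\theta_{2N}x})$. **Theorem.**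 The densities of the laws of $(X_{1/2^n},\dots,X_{k/2^n})$ are integrable for all $n,k$ and all starting points, and $\Delta(\lambda)\neq0$ for all $\lambda>0$. There are real functions $I(t;x)$ and $J(t;x)$ such that, for every $x\in(a,b)$: 1. The series and limits above converge (the series over $k\ge0$ absolutely, for every $n$), and $I(\cdot;x)$ and $J(\cdot;x)$ are the density and the distribution function of $\tau_{ab}$ under $\mathbb P_x$: $I(\cdot;x)$ is continuous on $(0,\infty)$ and integrable on $(0,t)$ for every $t\ge0$, and $$\mathbb P_x\{\tau_{ab}\le t\}=J(t;x)=\int_0^tI(s;x)\,\mathrm ds\quad(t\ge0),\qquad \mathbb E_x\big(\mathrm e^{-\lambda\tau_{ab}}\mathbf 1_{\{\tau_{ab}<\infty\}}\big)=\int_0^\infty I(t;x)\,\mathrm e^{-\lambda t}\,\mathrm dt\quad(\lambda>0).$$ 2. For every $\lambda>0$ the following integrals converge absolutely and $$\int_0^\infty I(t;x)\,\mathrm e^{-\lambda t}\,\mathrm dt=\frac{\Delta_0^+(\lambda;x)+\Delta_0^-(\lambda;x)}{\Delta(\lambda)},\qquad \int_0^\infty J(t;x)\,\mathrm e^{-\lambda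 t}\,\mathrm dt=\frac1\lambda\,\frac{\Delta_0^+(\lambda;x)+\Delta_0^-(\lambda;x)}{\Delta(\lambda)} .$$ 3. These transforms characterize $I(\cdot;x)$ and $J(\cdot;x)$: a real function on $(0,\infty)$ whose Laplace transform converges absolutely for all $\lambda>0$ and equals the first (respectively the second) expression is almost everywhere equal to $I(\cdot;x)$ (respectively $J(\cdot;x)$). -/

import Mathlib

open Filter Topology MeasureTheory

noncomputable section

namespace PseudoBM

/-! ### The pseudo-process -/

/-- The signed heat-type kernel `p(t; x)`, elementary solution of
`∂/∂t = (-1)^(N-1) ∂^(2N)/∂x^(2N)`, i.e. the inverse Fourier transform of `u ↦ exp (-t u^(2N))`: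
`p(t; x) = (1 / 2π) ∫ exp (-i u x) exp (-t u^(2N)) du`
(the sine part of the integrand is odd and integrates to zero). -/
def heatKernel (N : ℕ) (t x : ℝ) : ℝ :=
  (2 * Real.pi)⁻¹ * ∫ u : ℝ, Real.cos (u * x) * Real.exp (-t * u ^ (2 * N))

/-- The chain rule: the density at `y = (x₁, …, x_m)` of the pseudo-law under `P_x` of
`(X_{t₁}, …, X_{t_m})`, namely `∏_{k=1}^m p(t_k - t_{k-1}; x_{k-1} - x_k)` with
`t₀ = 0` and `x₀ = x`. -/
def chainDensity (N : ℕ) (x : ℝ) {m : ℕ} (t y : Fin m → ℝ) : ℝ :=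
  ∏ k : Fin m,
    heatKernel N
      ((Fin.cons 0 t : Fin (m + 1) → ℝ) k.succ - (Fin.cons 0 t : Fin (m + 1) → ℝ) k.castSucc)
      ((Fin.cons x y : Fin (m + 1) → ℝ) k.castSucc - (Fin.cons x y : Fin (m + 1) → ℝ) k.succ)

/-- The pseudo-probability `P_x {(X_{t₁}, …, X_{t_m}) ∈ A}`. -/
def pseudoProb (N : ℕ) (x : ℝ) {m : ℕ} (t : Fin m → ℝ) (A : Set (Fin m → ℝ)) : ℝ :=
  ∫ y in A, chainDensity N x t y

/-! ### The sampled exit time `τ_{ab,n} = 2^(-n) min {k : X_{k/2^n} ∉ (a, b)}` -/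

/-- The dyadic times `1/2^n, 2/2^n, …, k/2^n`. -/
def dyadicTimes (n k : ℕ) : Fin k → ℝ := fun j => ((j : ℝ) + 1) / 2 ^ n

/-- Positions `(x₁, …, x_k)` such that, with `x₀ = x`, the points `x₀, …, x_{k-1}` lie in `(a, b)`
and `x_k` does not: the first index outside `(a, b)` is `k`. -/
def firstExitAt (a b x : ℝ) (k : ℕ) : Set (Fin k → ℝ) :=
  {y | (∀ j : Fin k, (Fin.cons x y : Fin (k + 1) → ℝ) j.castSucc ∈ Set.Ioo a b) ∧
    (Fin.cons x y : Fin (k + 1) → ℝ) (Fin.last k) ∉ Set.Ioo a b}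

/-- `P_x {τ_{ab,n} = k / 2^n}`. -/
def exitProb (N : ℕ) (a b : ℝ) (n : ℕ) (x : ℝ) (k : ℕ) : ℝ :=
  pseudoProb N x (dyadicTimes n k) (firstExitAt a b x k)

/-- `P_x {τ_{ab,n} ≤ t}` for `t ≥ 0`: the sum of `P_x {τ_{ab,n} = k / 2^n}` over `k ≤ 2^n t`. -/
def exitCdf (N : ℕ) (a b : ℝ) (n : ℕ) (x t : ℝ) : ℝ :=
  ∑ k ∈ Finset.range (⌊2 ^ n * t⌋₊ + 1), exitProb N a b n x k

/-- The terms of the series defining `E_x (exp (-lam τ_{ab,n}) 1_{τ_{ab,n} < ∞})`. -/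
def exitLaplaceTerm (N : ℕ) (a b : ℝ) (n : ℕ) (x lam : ℝ) (k : ℕ) : ℝ :=
  Real.exp (-lam * ((k : ℝ) / 2 ^ n)) * exitProb N a b n x k

/-- `E_x (exp (-lam τ_{ab,n}) 1_{τ_{ab,n} < ∞})`. -/
def exitLaplace (N : ℕ) (a b : ℝ) (n : ℕ) (x lam : ℝ) : ℝ :=
  ∑' k : ℕ, exitLaplaceTerm N a b n x lam k

/-! ### The determinants -/

/-- `θ_ℓ = exp (i π (2ℓ + N - 1) / (2N))`, the `2N`-th roots of `(-1)^(N-1)`,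
with `ℓ = j + 1`, `0 ≤ j < 2N`. -/
def theta (N : ℕ) (j : Fin (2 * N)) : ℂ :=
  Complex.exp (Complex.I * ((2 * ((j : ℕ) + 1 : ℂ) + N - 1) / (2 * N)) * Real.pi)

/-- `e_lam^z = exp (lam^(1/(2N)) z)`. -/
def expScaled (N : ℕ) (lam : ℝ) (z : ℂ) : ℂ :=
  Complex.exp (((lam ^ (1 / (2 * (N : ℝ))) : ℝ) : ℂ) * z)

/-- The matrix of `Δ(lam)`: rows `0, …, N-1` are `θ_ℓ^i e_lam^(θ_ℓ a)`,
rows `N, …, 2N-1` are `θ_ℓ^(i-N) e_lam^(θ_ℓ b)`. -/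
def deltaMatrix (N : ℕ) (a b lam : ℝ) : Matrix (Fin (2 * N)) (Fin (2 * N)) ℂ :=
  Matrix.of fun i j =>
    if (i : ℕ) < N then theta N j ^ (i : ℕ) * expScaled N lam (theta N j * a)
    else theta N j ^ ((i : ℕ) - N) * expScaled N lam (theta N j * b)

/-- The matrix of `Δ(lam)` with row number `r` (counted from `0`) replaced by `e_lam^(θ_ℓ x)`. -/
def deltaMatrixRow (N : ℕ) (a b lam x : ℝ) (r : ℕ) : Matrix (Fin (2 * N)) (Fin (2 * N)) ℂ :=
  Matrix.of fun i j =>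
    if (i : ℕ) = r then expScaled N lam (theta N j * x) else deltaMatrix N a b lam i j

/-- `Δ(lam)`. -/
def Delta (N : ℕ) (a b lam : ℝ) : ℂ := (deltaMatrix N a b lam).det

/-- `Δ_k^-(lam; x)`: the `k`-th row of the block at `a` is replaced. -/
def DeltaMinus (N : ℕ) (a b : ℝ) (k : ℕ) (lam x : ℝ) : ℂ :=
  (deltaMatrixRow N a b lam x k).det

/-- `Δ_k^+(lam; x)`: the `k`-th row of the block at `b` is replaced. -/
def DeltaPlus (N : ℕ) (a b : ℝ) (k : ℕ) (lam x : ℝ) : ℂ :=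
  (deltaMatrixRow N a b lam x (N + k)).det

/-! ### Laplace transforms -/

/-- `∫_0^∞ f(t) exp (-lam t) dt` converges absolutely and equals `F lam`, for all `lam > 0`. -/
def HasLaplaceTransform (f : ℝ → ℝ) (F : ℝ → ℂ) : Prop :=
  ∀ lam : ℝ, 0 < lam →
    IntegrableOn (fun t => f t * Real.exp (-lam * t)) (Set.Ioi 0) ∧
    ((∫ t in Set.Ioi (0 : ℝ), f t * Real.exp (-lam * t) : ℝ) : ℂ) = F lam

end PseudoBM

end

noncomputable section

namespace PseudoBM

/-! ### Derivatives of the heat kernel -/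

/-! The walk of mesh `h` killed outside `(a, b)` has the transition operator `T_h` on `L²(a, b)`:
extend by zero, apply the Fourier multiplier `exp (-h u^(2N))`, restrict. The kernel is signed, so
no positivity argument is available. But the multiplier lies in `(0, 1]`, hence `T_h` is
self-adjoint with `0 ≤ T_h ≤ 1`, and spectral theory takes over. The survival function after `k`
steps is `T_h^k 1`, and exit probabilities are its successive differences
(`exitProb_eq_survival_sub`).

Convergence. The quadratic form of `1 + h⁻¹(1 - T_h)` has the weight `genSymbol`, which increases
when `h` is halved (`genSymbol_half`). Along `h = 2^(-n)` the resolvents therefore converge strongly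
to some `R = (1 + A)⁻¹` (`exists_strong_resolvent_limit`), and powers of `T_h` converge to `exp
(-tA)` by functional calculus (`tendsto_pow_heatOp`). The limit form is `∫ (1 + u^(2N)) |f^|²` on
functions extended by zero; finiteness forces `N` vanishing traces at `a` and `b`, so `A` is `(-1)^N
d^(2N)/dx^(2N)` with Dirichlet conditions (`IsDirichlet.dirichletResolvent_apply`). Convergence in
`L²` becomes convergence at a point because powers of `T_h` have bounded energy
(`IsUnitOp.energy_pow_le`) and a Sobolev inequality holds (`integral_norm_pow_four_le`). This gives
`tendsto_survival`: the limit is `S(t) = (exp (-tA) 1)(x)`.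

Transforms. A null vector of the matrix of `Δ(lam)` would give a Dirichlet eigenfunction of `A` with
eigenvalue `-lam < 0`, which is impossible. By Cramer's rule the quotient `u = (Δ₀⁺ + Δ₀⁻)/Δ`
satisfies `Au = -lam u`, equals `1` at both ends and has vanishing derivatives of orders `1, …, N-1`
there. So `w = (1 - u)/lam` solves `(lam + A)w = 1` with Dirichlet conditions, and `w(x)` is the
Laplace transform of `S`. Finally `J = 1 - S` and `I = -S'`.

Small times. The semigroup is only known to be continuous in `L²` at time `0`, and the constant `1`
has infinite energy. At an interior point a cut-off and Duhamel's formula help: the commutator terms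
live away from `x`, where derivatives of the heat kernel are bounded uniformly in time
(`kernelDeriv_off_diagonal`). Hence `|S(t) - 1| ≤ Ct` and `S` is locally Lipschitz
(`exists_survivalLimit_lipschitz`), which makes `I` integrable near `0`. The Laplace transforms of
the sampled times converge by dominated convergence, with a majorant whose singularity is
`t^(-1/2)`. Uniqueness is Weierstrass approximation in the variable `exp (-t)`. -/

/-- Lebesgue measure divided by `2π`. -/
def freqMeasure : Measure ℝ := ENNReal.ofReal (2 * Real.pi)⁻¹ • volume

/-- The Fourier multiplier `exp (-t u^(2N))`. -/
def heatSymbol (N : ℕ) (t u : ℝ) : ℝ := Real.exp (-t * u ^ (2 * N))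

/-- The `k`-th derivative in `r` of the heat kernel `p(t; r)`, complex-valued. -/
def kernelDeriv (N k : ℕ) (t r : ℝ) : ℂ :=
  ∫ u : ℝ, (Complex.I * u) ^ k * Complex.exp (Complex.I * (u * r)) * (heatSymbol N t u : ℂ)
    ∂freqMeasure

lemma integral_freqMeasure {E : Type*} [NormedAddCommGroup E] [NormedSpace ℝ E] (f : ℝ → E) :
    ∫ u, f u ∂freqMeasure = (2 * Real.pi)⁻¹ • ∫ u, f u := by
  rw [freqMeasure, integral_smul_measure, ENNReal.toReal_ofReal (by positivity)]

lemma freqMeasure_ne_zero : ENNReal.ofReal (2 * Real.pi)⁻¹ ≠ 0 := by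
  have := Real.pi_pos
  simp only [ne_eq, ENNReal.ofReal_eq_zero, not_le]
  positivity

lemma integrable_freqMeasure {E : Type*} [NormedAddCommGroup E] {f : ℝ → E} :
    Integrable f freqMeasure ↔ Integrable f :=
  integrable_smul_measure freqMeasure_ne_zero ENNReal.ofReal_ne_top

instance : SFinite freqMeasure := by unfold freqMeasure; infer_instance

lemma heatSymbol_pos (N : ℕ) (t u : ℝ) : 0 < heatSymbol N t u := Real.exp_pos _

lemma even_pow_nonneg (N : ℕ) (u : ℝ) : 0 ≤ u ^ (2 * N) := (even_two_mul N).pow_nonneg u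

lemma heatSymbol_le_one {N : ℕ} {t : ℝ} (ht : 0 ≤ t) (u : ℝ) : heatSymbol N t u ≤ 1 := by
  rw [heatSymbol, Real.exp_le_one_iff]
  have := mul_nonneg ht (even_pow_nonneg N u)
  linarith

@[fun_prop]
lemma continuous_heatSymbol (N : ℕ) (t : ℝ) : Continuous (heatSymbol N t) := by
  unfold heatSymbol; fun_prop

lemma sq_sub_one_le_pow {N : ℕ} (hN : 1 ≤ N) (u : ℝ) : u ^ 2 - 1 ≤ u ^ (2 * N) := by
  rw [pow_mul]
  rcases le_total (u ^ 2) 1 with h | h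
  · have := pow_nonneg (sq_nonneg u) N
    linarith
  · have := le_self_pow₀ h (by omega : N ≠ 0)
    linarith

/-- Since `u^(2N) ≥ u² - 1`, the symbol is dominated by `exp t` times a Gaussian. -/
lemma integrable_pow_mul_heatSymbol {N : ℕ} (hN : 1 ≤ N) (k : ℕ) {t : ℝ} (ht : 0 < t) :
    Integrable (fun u : ℝ => u ^ k * heatSymbol N t u) := by
  have h := (integrable_rpow_mul_exp_neg_mul_sq ht (s := k)
    (by have : (0 : ℝ) ≤ k := k.cast_nonneg
        linarith)).const_mul (Real.exp t)
  refine h.mono (by fun_prop) (Eventually.of_forall fun u => ?_)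
  rw [Real.rpow_natCast, mul_left_comm, norm_mul, norm_mul (u ^ k)]
  gcongr
  rw [heatSymbol, ← Real.exp_add, Real.norm_of_nonneg (Real.exp_pos _).le,
    Real.norm_of_nonneg (Real.exp_pos _).le, Real.exp_le_exp]
  nlinarith [sq_sub_one_le_pow hN u]

lemma norm_exp_I_mul_ofReal_mul (r u : ℝ) : ‖Complex.exp (Complex.I * (u * r))‖ = 1 := by
  rw [mul_comm, ← Complex.ofReal_mul, Complex.norm_exp_ofReal_mul_I]

lemma integrable_kernelDeriv {N : ℕ} (hN : 1 ≤ N) (k : ℕ) {t : ℝ} (ht : 0 < t) (r : ℝ) :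
    Integrable (fun u : ℝ => (Complex.I * u) ^ k * Complex.exp (Complex.I * (u * r)) *
      (heatSymbol N t u : ℂ)) freqMeasure := by
  rw [integrable_freqMeasure]
  refine (integrable_pow_mul_heatSymbol hN k ht).mono (by fun_prop)
    (Eventually.of_forall fun u => ?_)
  rw [norm_mul, norm_mul, norm_exp_I_mul_ofReal_mul]
  simp

lemma integrable_polynomial_mul_heatSymbol {N : ℕ} (hN : 1 ≤ N) {t : ℝ} (ht : 0 < t)
    (q : Polynomial ℂ) : Integrable (fun u : ℝ => q.eval (u : ℂ) * (heatSymbol N t u : ℂ)) := by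
  induction q using Polynomial.induction_on' with
  | add p q hp hq =>
    simp only [Polynomial.eval_add, add_mul]
    exact hp.add hq
  | monomial k c =>
    have := ((integrable_pow_mul_heatSymbol hN k ht).ofReal (𝕜 := ℂ)).const_mul c
    simpa [mul_assoc] using this

/-- The polynomial `p` with `(q E)' = p E`, where `E u = exp (-u^(2N))`. -/
def parts (N : ℕ) (q : Polynomial ℂ) : Polynomial ℂ :=
  q.derivative - Polynomial.C (2 * N : ℂ) * Polynomial.X ^ (2 * N - 1) * q

lemma hasDerivAt_polynomial_mul_heatSymbol (N : ℕ) (q : Polynomial ℂ) (u : ℝ) :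
    HasDerivAt (fun u : ℝ => q.eval (u : ℂ) * (heatSymbol N 1 u : ℂ))
      ((parts N q).eval (u : ℂ) * (heatSymbol N 1 u : ℂ)) u := by
  have h1 : HasDerivAt (fun u : ℝ => q.eval (u : ℂ)) (q.derivative.eval (u : ℂ)) u :=
    (q.hasDerivAt (u : ℂ)).comp_ofReal
  have h2 : HasDerivAt (fun u : ℝ => heatSymbol N 1 u)
      (heatSymbol N 1 u * (-1 * ((2 * N : ℕ) * u ^ (2 * N - 1)))) u :=
    ((hasDerivAt_pow (2 * N) u).const_mul (-1)).exp
  refine (h1.mul h2.ofReal_comp).congr_deriv ?_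
  simp [parts]
  ring

lemma parts_integral {N : ℕ} (hN : 1 ≤ N) (q : Polynomial ℂ) (r : ℝ) :
    ∫ u : ℝ, Complex.exp (Complex.I * (u * r)) * ((parts N q).eval (u : ℂ) * (heatSymbol N 1 u : ℂ))
      = -(Complex.I * r) * ∫ u : ℝ, Complex.exp (Complex.I * (u * r)) *
        (q.eval (u : ℂ) * (heatSymbol N 1 u : ℂ)) := by
  have hi : ∀ q : Polynomial ℂ, Integrable (fun u : ℝ => Complex.exp (Complex.I * (u * r)) *
        (q.eval (u : ℂ) * (heatSymbol N 1 u : ℂ))) := fun q =>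
    (integrable_polynomial_mul_heatSymbol hN one_pos q).bdd_mul (c := 1) (by fun_prop)
      (Eventually.of_forall fun u => (norm_exp_I_mul_ofReal_mul r u).le)
  have hd : ∀ u : ℝ, HasDerivAt (fun u : ℝ => Complex.exp (Complex.I * (u * r)))
      (Complex.I * r * Complex.exp (Complex.I * (u * r))) u := fun u => by
    have h := (((hasDerivAt_id (u : ℂ)).mul_const (r : ℂ)).const_mul Complex.I).cexp.comp_ofReal
    simpa [mul_comm] using h
  have := integral_mul_deriv_eq_deriv_mul_of_integrable (fun u _ => hd u)
    (fun u _ => hasDerivAt_polynomial_mul_heatSymbol N q u) (hi _)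
    (by simpa [Pi.mul_def, mul_assoc] using (hi q).const_mul (Complex.I * r)) (hi q)
  rw [this, ← integral_const_mul, ← integral_neg]
  congr 1 with u
  ring

/-- Each integration by parts trades one factor `|r|` for the passage from `q` to `parts N q`, and
every polynomial times the symbol is integrable; so the Fourier integral decays faster than any
power. -/
lemma pow_mul_norm_parts_integral_le {N : ℕ} (hN : 1 ≤ N) (m : ℕ) (q : Polynomial ℂ) :
    ∃ C : ℝ, 0 ≤ C ∧ ∀ r : ℝ, |r| ^ m * ‖∫ u : ℝ, Complex.exp (Complex.I * (u * r)) *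
        (q.eval (u : ℂ) * (heatSymbol N 1 u : ℂ))‖ ≤ C := by
  induction m generalizing q with
  | zero =>
    refine ⟨∫ u : ℝ, ‖q.eval (u : ℂ) * (heatSymbol N 1 u : ℂ)‖,
      integral_nonneg fun u => norm_nonneg _, fun r => ?_⟩
    rw [pow_zero, one_mul]
    refine (norm_integral_le_integral_norm _).trans (le_of_eq ?_)
    congr 1 with u
    rw [norm_mul, norm_exp_I_mul_ofReal_mul, one_mul]
  | succ m ih =>
    obtain ⟨C, hC, h⟩ := ih (parts N q)
    refine ⟨C, hC, fun r => le_trans (le_of_eq ?_) (h r)⟩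
    rw [parts_integral hN q r]
    simp [pow_succ, mul_assoc]

lemma kernelDeriv_one_decay {N : ℕ} (hN : 1 ≤ N) (k m : ℕ) :
    ∃ C : ℝ, 0 ≤ C ∧ ∀ r : ℝ, |r| ^ m * ‖kernelDeriv N k 1 r‖ ≤ C := by
  obtain ⟨C, hC, h⟩ := pow_mul_norm_parts_integral_le hN m
    (Polynomial.C (Complex.I ^ k) * Polynomial.X ^ k)
  refine ⟨(2 * Real.pi)⁻¹ * C, by positivity, fun r => ?_⟩
  rw [kernelDeriv, integral_freqMeasure, norm_smul, Real.norm_of_nonneg (by positivity),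
    mul_left_comm]
  refine mul_le_mul_of_nonneg_left (le_trans (le_of_eq ?_) (h r)) (by positivity)
  congr 3 with u
  simp [mul_pow]
  ring

/-- Substitution `u ↦ c u`. It reduces every estimate at time `t = c^(2N)` to time `1`. -/
lemma kernelDeriv_scaling {N : ℕ} (k : ℕ) {c : ℝ} (hc : 0 < c) (r : ℝ) :
    kernelDeriv N k (c ^ (2 * N)) r = ((c⁻¹ : ℝ) : ℂ) ^ (k + 1) * kernelDeriv N k 1 (c⁻¹ * r) := by
  have hc' : (c : ℂ) ≠ 0 := by exact_mod_cast hc.ne'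
  have h := Measure.integral_comp_mul_left (fun u : ℝ => (Complex.I * u) ^ k *
    Complex.exp (Complex.I * (u * (c⁻¹ * r : ℝ))) * (heatSymbol N 1 u : ℂ)) c
  rw [abs_of_pos (inv_pos.2 hc)] at h
  rw [kernelDeriv, kernelDeriv, integral_freqMeasure, integral_freqMeasure, mul_smul_comm]
  congr 1
  rw [pow_succ, mul_assoc, ← Complex.real_smul (x := c⁻¹), ← h, ← integral_const_mul]
  congr 1 with u
  have h1 : heatSymbol N 1 (c * u) = heatSymbol N (c ^ (2 * N)) u := by
    simp [heatSymbol, mul_pow]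
  have h2 : ((c * u : ℝ) : ℂ) * ((c⁻¹ * r : ℝ) : ℂ) = u * r := by
    push_cast; field_simp
  rw [h1, h2]
  push_cast
  rw [inv_pow]
  field_simp
  simp only [mul_pow]
  ring

lemma exists_pow_eq {N : ℕ} (hN : 1 ≤ N) {t : ℝ} (ht : 0 < t) :
    ∃ c : ℝ, 0 < c ∧ c ^ (2 * N) = t :=
  ⟨t ^ ((2 * N : ℕ) : ℝ)⁻¹, by positivity, Real.rpow_inv_natCast_pow ht.le (by omega)⟩

/-- Off the diagonal, the derivatives of the heat kernel are bounded uniformly in time. -/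
lemma kernelDeriv_off_diagonal {N : ℕ} (hN : 1 ≤ N) (k : ℕ) :
    ∃ C : ℝ, 0 ≤ C ∧ ∀ t : ℝ, 0 < t → ∀ r : ℝ, |r| ^ (k + 1) * ‖kernelDeriv N k t r‖ ≤ C := by
  -- The exponent `k + 1` is the one for which the powers of `c` produced by scaling cancel exactly,
  -- so the bound does not see the time.
  obtain ⟨C, hC, h⟩ := kernelDeriv_one_decay hN k (k + 1)
  refine ⟨C, hC, fun t ht r => ?_⟩
  obtain ⟨c, hc, rfl⟩ := exists_pow_eq hN ht
  refine le_trans (le_of_eq ?_) (h (c⁻¹ * r))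
  rw [kernelDeriv_scaling k hc, norm_mul, norm_pow, Complex.norm_real, Real.norm_eq_abs, abs_mul,
    mul_pow]
  ring

/-- Off the diagonal, the heat kernel tends to zero with time. -/
lemma kernel_off_diagonal_tendsto {N : ℕ} (hN : 1 ≤ N) {δ : ℝ} (hδ : 0 < δ) {ε : ℝ} (hε : 0 < ε) :
    ∀ᶠ t in 𝓝[>] (0 : ℝ), ∀ r : ℝ, δ ≤ |r| → ‖kernelDeriv N 0 t r‖ ≤ ε := by
  obtain ⟨C, hC, h⟩ := kernelDeriv_one_decay hN 0 2
  -- Decay of order two beats the single power `c⁻¹` of the scaling: the kernel is at most `C c /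
  -- δ²`, which is below `ε` for `c < c₀`. The `+ 1` covers `C = 0`.
  set c₀ : ℝ := ε * δ ^ 2 / (C + 1)
  have hc₀ : 0 < c₀ := by positivity
  filter_upwards [Ioo_mem_nhdsGT (show (0 : ℝ) < c₀ ^ (2 * N) by positivity)] with t ht r hr
  obtain ⟨c, hc, rfl⟩ := exists_pow_eq hN ht.1
  have hcc : c < c₀ := lt_of_pow_lt_pow_left₀ _ hc₀.le ht.2
  have h1 := h (c⁻¹ * r)
  rw [kernelDeriv_scaling 0 hc, norm_mul, norm_pow, Complex.norm_real, Real.norm_eq_abs,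
    abs_of_pos (inv_pos.2 hc), zero_add, pow_one]
  rw [abs_mul, abs_of_pos (inv_pos.2 hc), mul_pow] at h1
  set K := ‖kernelDeriv N 0 1 (c⁻¹ * r)‖
  have hK : 0 ≤ K := norm_nonneg _
  have h2 : c⁻¹ * (δ ^ 2 * (c⁻¹ * K)) ≤ C := by
    refine le_trans ?_ h1
    have : δ ^ 2 ≤ |r| ^ 2 := by gcongr
    calc c⁻¹ * (δ ^ 2 * (c⁻¹ * K)) = c⁻¹ ^ 2 * δ ^ 2 * K := by ring
      _ ≤ _ := by gcongr
  rw [inv_mul_le_iff₀ hc] at h2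
  have h3 : c * (C + 1) < ε * δ ^ 2 := (lt_div_iff₀ (by positivity)).1 hcc
  nlinarith [sq_pos_of_pos hδ]

lemma kernelDeriv_zero_eq {N : ℕ} (hN : 1 ≤ N) {t : ℝ} (ht : 0 < t) (r : ℝ) :
    kernelDeriv N 0 t r = heatKernel N t r := by
  have hc : ∀ u : ℝ, (((Complex.I * u) ^ 0 * Complex.exp (Complex.I * (u * r)) *
      (heatSymbol N t u : ℂ))).re = Real.cos (u * r) * heatSymbol N t u := fun u => by
    rw [pow_zero, one_mul, mul_comm Complex.I, ← Complex.ofReal_mul, Complex.re_mul_ofReal,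
      Complex.exp_ofReal_mul_I_re]
  have hs : ∀ u : ℝ, (((Complex.I * u) ^ 0 * Complex.exp (Complex.I * (u * r)) *
      (heatSymbol N t u : ℂ))).im = Real.sin (u * r) * heatSymbol N t u := fun u => by
    rw [pow_zero, one_mul, mul_comm Complex.I, ← Complex.ofReal_mul, Complex.im_mul_ofReal,
      Complex.exp_ofReal_mul_I_im]
  have hi := integrable_kernelDeriv hN 0 ht r
  apply Complex.ext
  · rw [kernelDeriv, ← RCLike.re_eq_complex_re, ← integral_re hi, integral_freqMeasure, heatKernel]
    simp only [RCLike.re_eq_complex_re, hc, Complex.ofReal_re, smul_eq_mul]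
    rfl
  · rw [kernelDeriv, ← RCLike.im_eq_complex_im, ← integral_im hi, integral_freqMeasure]
    simp only [RCLike.im_eq_complex_im, hs, Complex.ofReal_im]
    have : ∫ u : ℝ, Real.sin (u * r) * heatSymbol N t u = 0 := by
      have h := integral_neg_eq_self (fun u : ℝ => Real.sin (u * r) * heatSymbol N t u) volume
      simp only [neg_mul, Real.sin_neg, integral_neg, heatSymbol, (even_two_mul N).neg_pow] at h ⊢
      linarith
    rw [this, smul_zero]

lemma continuous_kernelDeriv {N : ℕ} (hN : 1 ≤ N) (k : ℕ) {t : ℝ} (ht : 0 < t) :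
    Continuous (kernelDeriv N k t) := by
  refine continuous_of_dominated (bound := fun u => ‖u ^ k * heatSymbol N t u‖)
    (fun r => (integrable_kernelDeriv hN k ht r).aestronglyMeasurable)
    (fun r => Eventually.of_forall fun u => ?_)
    (integrable_freqMeasure.2 (integrable_pow_mul_heatSymbol hN k ht).norm)
    (Eventually.of_forall fun u => by fun_prop)
  rw [norm_mul, norm_mul, norm_exp_I_mul_ofReal_mul]
  simp

lemma continuous_heatKernel {N : ℕ} (hN : 1 ≤ N) {t : ℝ} (ht : 0 < t) :
    Continuous (heatKernel N t) := by
  have : heatKernel N t = fun r => (kernelDeriv N 0 t r).re := by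
    ext r; rw [kernelDeriv_zero_eq hN ht, Complex.ofReal_re]
  rw [this]
  exact Complex.continuous_re.comp (continuous_kernelDeriv hN 0 ht)

lemma integrable_kernelDeriv_one {N : ℕ} (hN : 1 ≤ N) : Integrable (kernelDeriv N 0 1) := by
  obtain ⟨C, hC, h⟩ := kernelDeriv_one_decay hN 0 2
  obtain ⟨C', hC', h'⟩ := kernelDeriv_one_decay hN 0 0
  refine (integrable_inv_one_add_sq.const_mul (C + C')).mono'
    (continuous_kernelDeriv hN 0 one_pos).aestronglyMeasurable (Eventually.of_forall fun r => ?_)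
  rw [← div_eq_mul_inv, le_div_iff₀ (by positivity)]
  have h1 := h r
  have h2 := h' r
  rw [sq_abs] at h1
  rw [pow_zero, one_mul] at h2
  linarith

lemma integrable_kernelDeriv_zero {N : ℕ} (hN : 1 ≤ N) {t : ℝ} (ht : 0 < t) :
    Integrable (kernelDeriv N 0 t) := by
  obtain ⟨c, hc, rfl⟩ := exists_pow_eq hN ht
  have : kernelDeriv N 0 (c ^ (2 * N)) =
      fun r => ((c⁻¹ : ℝ) : ℂ) ^ (0 + 1) * kernelDeriv N 0 1 (c⁻¹ * r) :=
    funext fun r => kernelDeriv_scaling 0 hc r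
  rw [this]
  exact ((integrable_kernelDeriv_one hN).comp_mul_left' (inv_ne_zero hc.ne')).const_mul _

lemma integrable_heatKernel {N : ℕ} (hN : 1 ≤ N) {t : ℝ} (ht : 0 < t) :
    Integrable (heatKernel N t) := by
  have := (integrable_kernelDeriv_zero hN ht).re
  refine this.congr (Eventually.of_forall fun r => ?_)
  simp [kernelDeriv_zero_eq hN ht]

lemma fourier_heatSymbol {N : ℕ} (t w : ℝ) :
    FourierTransform.fourier (fun u : ℝ => (heatSymbol N t u : ℂ)) w =
      (2 * Real.pi) • kernelDeriv N 0 t (-(2 * Real.pi) * w) := by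
  rw [Real.fourier_real_eq_integral_exp_smul, kernelDeriv, integral_freqMeasure,
    smul_inv_smul₀ (by positivity)]
  congr 1 with u
  rw [pow_zero, one_mul, smul_eq_mul]
  congr 2
  push_cast
  ring

/-- Fourier inversion for the symbol at the point `0`: the total mass of the kernel is the value of
the symbol there. -/
lemma integral_heatKernel {N : ℕ} (hN : 1 ≤ N) {t : ℝ} (ht : 0 < t) :
    ∫ r, heatKernel N t r = 1 := by
  have hpi : -(2 * Real.pi) ≠ 0 := by simp [Real.pi_ne_zero]
  have hc : Continuous (fun u : ℝ => (heatSymbol N t u : ℂ)) := by fun_prop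
  have hf : Integrable (fun u : ℝ => (heatSymbol N t u : ℂ)) := by
    simpa using integrable_polynomial_mul_heatSymbol hN ht 1
  have hF : FourierTransform.fourier (fun u : ℝ => (heatSymbol N t u : ℂ)) =
      fun w => (2 * Real.pi) • kernelDeriv N 0 t (-(2 * Real.pi) * w) :=
    funext fun w => fourier_heatSymbol t w
  have h := hf.fourierInv_fourier_eq (by
    rw [hF]
    exact ((integrable_kernelDeriv_zero hN ht).comp_mul_left' hpi).smul (2 * Real.pi))
    (v := 0) hc.continuousAt
  rw [Real.fourierInv_eq', hF] at h
  simp only [inner_zero_right, mul_zero, Complex.ofReal_zero, zero_mul, Complex.exp_zero,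
    one_smul] at h
  rw [integral_smul, Measure.integral_comp_mul_left, abs_inv, abs_neg,
    abs_of_pos (by positivity), smul_inv_smul₀ (by positivity)] at h
  simp only [kernelDeriv_zero_eq hN ht, integral_complex_ofReal] at h
  simpa [heatSymbol, show N ≠ 0 by omega] using h

end PseudoBM

namespace PseudoBM

/-! ### The laws of the sampled process -/

/-- The density of the first `k` steps of the process sampled with mesh `h`. -/
def stepDensity (N : ℕ) (h x : ℝ) {k : ℕ} (y : Fin k → ℝ) : ℝ :=
  ∏ j : Fin k, heatKernel N h
    ((Fin.cons x y : Fin (k + 1) → ℝ) j.castSucc - (Fin.cons x y : Fin (k + 1) → ℝ) j.succ)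

lemma chainDensity_dyadicTimes (N n k : ℕ) (x : ℝ) :
    chainDensity N x (dyadicTimes n k) = stepDensity N (1 / 2 ^ n) x := by
  ext y
  unfold chainDensity stepDensity
  refine Finset.prod_congr rfl fun j _ => ?_
  congr 1
  rcases Nat.eq_zero_or_pos k with rfl | hk
  · exact j.elim0
  obtain ⟨k, rfl⟩ := Nat.exists_eq_succ_of_ne_zero hk.ne'
  rw [Fin.cons_succ]
  refine Fin.cases ?_ (fun i => ?_) j
  · simp [dyadicTimes]
  · rw [← Fin.succ_castSucc, Fin.cons_succ]
    simp [dyadicTimes]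
    ring

lemma stepDensity_cons (N : ℕ) (h x : ℝ) {k : ℕ} (z : ℝ) (y : Fin k → ℝ) :
    stepDensity N h x (Fin.cons z y : Fin (k + 1) → ℝ) =
      heatKernel N h (x - z) * stepDensity N h z y := by
  rw [stepDensity, Fin.prod_univ_succ]
  congr 1

lemma continuous_stepDensity {N : ℕ} (hN : 1 ≤ N) {h : ℝ} (hh : 0 < h) (k : ℕ) :
    Continuous fun p : ℝ × (Fin k → ℝ) => stepDensity N h p.1 p.2 := by
  unfold stepDensity
  refine continuous_finsetProd _ fun j _ => (continuous_heatKernel hN hh).comp ?_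
  refine Continuous.sub ?_ ?_
  · refine Fin.cases ?_ (fun i => ?_) j.castSucc
    · simpa using continuous_fst
    · simp only [Fin.cons_succ]
      fun_prop
  · refine Fin.cases ?_ (fun i => ?_) j.succ
    · simpa using continuous_fst
    · simp only [Fin.cons_succ]
      fun_prop

lemma piFinSuccAbove_symm_eq_cons {k : ℕ} (p : ℝ × (Fin k → ℝ)) :
    (MeasurableEquiv.piFinSuccAbove (fun _ : Fin (k + 1) => ℝ) 0).symm p = Fin.cons p.1 p.2 := by
  change Fin.insertNth (α := fun _ => ℝ) 0 p.1 p.2 = _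
  rw [Fin.insertNth_zero]
  rfl

lemma integral_fin_succ {k : ℕ} (f : (Fin (k + 1) → ℝ) → ℝ) :
    ∫ y, f y = ∫ p : ℝ × (Fin k → ℝ), f (Fin.cons p.1 p.2) := by
  have h := (volume_preserving_piFinSuccAbove (fun _ : Fin (k + 1) => ℝ) 0).symm
  have := h.integral_comp (MeasurableEquiv.measurableEmbedding _) f
  rw [← this]
  simp only [piFinSuccAbove_symm_eq_cons]

lemma integrable_fin_succ {k : ℕ} (f : (Fin (k + 1) → ℝ) → ℝ) :
    Integrable f ↔ Integrable fun p : ℝ × (Fin k → ℝ) => f (Fin.cons p.1 p.2) := by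
  have h := (volume_preserving_piFinSuccAbove (fun _ : Fin (k + 1) => ℝ) 0).symm
  rw [← h.integrable_comp_emb (MeasurableEquiv.measurableEmbedding _) (g := f)]
  simp only [Function.comp_def, piFinSuccAbove_symm_eq_cons]

/-- Tonelli, one step at a time. The value of the norm is part of the induction because
integrability over the product requires the inner `L¹` norms. They are powers of the total variation
of the signed kernel rather than `1`. -/
lemma integrable_stepDensity {N : ℕ} (hN : 1 ≤ N) {h : ℝ} (hh : 0 < h) (k : ℕ) (x : ℝ) :
    Integrable (stepDensity N h x (k := k)) ∧
      ∫ y, ‖stepDensity N h x (k := k) y‖ = (∫ r, ‖heatKernel N h r‖) ^ k := by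
  induction k generalizing x with
  | zero => 
    have : (volume : Measure (Fin 0 → ℝ)) = Measure.dirac default := by
      simpa using Measure.volume_pi_eq_dirac (ι := Fin 0) (α := fun _ => ℝ) default
    constructor
    · rw [this]; exact integrable_dirac (by simp)
    · simp [stepDensity, this]
  | succ k ih =>
    have hint : Integrable fun p : ℝ × (Fin k → ℝ) =>
        heatKernel N h (x - p.1) * stepDensity N h p.1 p.2 := by
      refine (integrable_prod_iff ?_).2 ⟨?_, ?_⟩
      · exact (((continuous_heatKernel hN hh).comp (by fun_prop)).mul
          (continuous_stepDensity hN hh k)).aestronglyMeasurable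
      · exact Eventually.of_forall fun z => (ih z).1.const_mul (heatKernel N h (x - z))
      · simp only [norm_mul, integral_const_mul, (ih _).2]
        exact (((integrable_heatKernel hN hh).comp_sub_left x).norm).mul_const _
    constructor
    · rw [integrable_fin_succ]
      simpa only [stepDensity_cons] using hint
    · rw [integral_fin_succ (fun y => ‖stepDensity N h x y‖)]
      simp only [stepDensity_cons]
      rw [Measure.volume_eq_prod, integral_prod _ hint.norm]
      simp only [norm_mul, integral_const_mul, (ih _).2]
      rw [integral_mul_const, integral_sub_left_eq_self (fun r => ‖heatKernel N h r‖), pow_succ']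

lemma integrable_chainDensity {N : ℕ} (hN : 1 ≤ N) (x : ℝ) (n k : ℕ) :
    Integrable (chainDensity N x (dyadicTimes n k)) := by
  rw [chainDensity_dyadicTimes]
  exact (integrable_stepDensity hN (by positivity) k x).1

/-! ### First exit probabilities as differences of survival functions -/

lemma measurableSet_firstExitAt (a b x : ℝ) (k : ℕ) : MeasurableSet (firstExitAt a b x k) := by
  have hm : ∀ j : Fin (k + 1), Measurable fun y : Fin k → ℝ => (Fin.cons x y : Fin (k + 1) → ℝ) j :=
    fun j => by
      refine Fin.cases ?_ (fun i => ?_) j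
      · simp
      · simpa using measurable_pi_apply i
  have : firstExitAt a b x k =
      (⋂ j : Fin k, (fun y : Fin k → ℝ => (Fin.cons x y : Fin (k + 1) → ℝ) j.castSucc) ⁻¹'
        Set.Ioo a b) ∩
      ((fun y : Fin k → ℝ => (Fin.cons x y : Fin (k + 1) → ℝ) (Fin.last k)) ⁻¹' Set.Ioo a b)ᶜ := by
    ext y
    simp only [firstExitAt, Set.mem_ofPred_eq, Set.mem_inter_iff, Set.mem_iInter, Set.mem_preimage,
      Set.mem_compl_iff]
  rw [this]
  exact (MeasurableSet.iInter fun j => hm _ measurableSet_Ioo).inter (hm _ measurableSet_Ioo).compl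

lemma cons_mem_firstExitAt (a b x z : ℝ) {k : ℕ} (y : Fin k → ℝ) :
    (Fin.cons z y : Fin (k + 1) → ℝ) ∈ firstExitAt a b x (k + 1) ↔
      x ∈ Set.Ioo a b ∧ y ∈ firstExitAt a b z k := by
  simp only [firstExitAt, Set.mem_ofPred_eq, Fin.forall_fin_succ (n := k), and_assoc]
  rfl

lemma exitProb_eq (N : ℕ) (a b : ℝ) (n : ℕ) (x : ℝ) (k : ℕ) :
    exitProb N a b n x k =
      ∫ y, (firstExitAt a b x k).indicator (stepDensity N (1 / 2 ^ n) x) y := by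
  rw [exitProb, pseudoProb, chainDensity_dyadicTimes,
    integral_indicator (measurableSet_firstExitAt a b x k)]

lemma exitProb_zero (N : ℕ) {a b : ℝ} (n : ℕ) {x : ℝ} :
    exitProb N a b n x 0 = if x ∈ Set.Ioo a b then 0 else 1 := by
  have hv : (volume : Measure (Fin 0 → ℝ)) = Measure.dirac default := by
    simpa using Measure.volume_pi_eq_dirac (ι := Fin 0) (α := fun _ => ℝ) default
  rw [exitProb_eq, hv, integral_dirac]
  have : (default : Fin 0 → ℝ) ∈ firstExitAt a b x 0 ↔ x ∉ Set.Ioo a b := by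
    simp only [firstExitAt, Set.mem_ofPred_eq, IsEmpty.forall_iff, true_and]
    rfl
  by_cases h : x ∈ Set.Ioo a b
  · rw [if_pos h, Set.indicator_of_notMem (by rw [this]; simpa using h)]
  · rw [if_neg h, Set.indicator_of_mem (by rw [this]; simpa using h)]
    simp [stepDensity]

lemma exitProb_succ {N : ℕ} (hN : 1 ≤ N) {a b : ℝ} (n : ℕ) {x : ℝ} (hx : x ∈ Set.Ioo a b) (k : ℕ) :
    exitProb N a b n x (k + 1) =
      ∫ z, heatKernel N (1 / 2 ^ n) (x - z) * exitProb N a b n z k := by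
  have hh : (0 : ℝ) < 1 / 2 ^ n := by positivity
  rw [exitProb_eq, integral_fin_succ, Measure.volume_eq_prod, integral_prod]
  · congr 1 with z
    rw [exitProb_eq, ← integral_const_mul]
    congr 1 with y
    by_cases hy : y ∈ firstExitAt a b z k
    · rw [Set.indicator_of_mem ((cons_mem_firstExitAt a b x z y).2 ⟨hx, hy⟩),
        Set.indicator_of_mem hy, stepDensity_cons]
    · rw [Set.indicator_of_notMem (fun h => hy ((cons_mem_firstExitAt a b x z y).1 h).2),
        Set.indicator_of_notMem hy, mul_zero]
  · rw [← Measure.volume_eq_prod, ← integrable_fin_succ]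
    exact (integrable_stepDensity hN hh (k + 1) x).1.indicator (measurableSet_firstExitAt a b x _)

lemma exitProb_of_notMem {N : ℕ} {a b : ℝ} (n : ℕ) {x : ℝ} (hx : x ∉ Set.Ioo a b)
    (k : ℕ) : exitProb N a b n x (k + 1) = 0 := by
  rw [exitProb_eq]
  have : firstExitAt a b x (k + 1) = ∅ := by
    refine Set.eq_empty_of_forall_notMem fun y hy => hx ?_
    have := hy.1 0
    simpa using this
  simp [this]

/-- The probability that the process with mesh `h`, started at `x`, stays in `(a, b)` for
`k` steps. -/
def survival (N : ℕ) (a b h : ℝ) : ℕ → ℝ → ℝ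
  | 0, _ => 1
  | k + 1, x => ∫ z in Set.Ioo a b, heatKernel N h (x - z) * survival N a b h k z

lemma continuous_survival {N : ℕ} (hN : 1 ≤ N) {a b h : ℝ} (hh : 0 < h) (k : ℕ) :
    Continuous (survival N a b h k) := by
  induction k with
  | zero => exact continuous_const
  | succ k ih =>
    have h1 : survival N a b h (k + 1) = fun x => ∫ z in Set.Icc a b,
        heatKernel N h (x - z) * survival N a b h k z := by
      ext x
      rw [integral_Icc_eq_integral_Ioo]; rfl
    rw [h1]
    exact continuous_parametric_integral_of_continuous
      (((continuous_heatKernel hN hh).comp (by fun_prop)).mul (ih.comp continuous_snd))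
      isCompact_Icc

/-- First-step analysis: both sides obey the same recursion in `k`, and at `k = 0` the total mass
one of the kernel turns the mass outside `(a, b)` into one minus the mass inside. The exit sums then
telescope. -/
lemma exitProb_eq_survival_sub {N : ℕ} (hN : 1 ≤ N) {a b : ℝ} (n : ℕ) {x : ℝ}
    (hx : x ∈ Set.Ioo a b) (k : ℕ) :
    exitProb N a b n x (k + 1) =
      survival N a b (1 / 2 ^ n) k x - survival N a b (1 / 2 ^ n) (k + 1) x := by
  have hh : (0 : ℝ) < 1 / 2 ^ n := by positivity
  have hint : ∀ x, Integrable fun z => heatKernel N (1 / 2 ^ n) (x - z) := fun x =>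
    (integrable_heatKernel hN hh).comp_sub_left x
  induction k generalizing x with
  | zero =>
    rw [exitProb_succ hN n hx]
    have h1 : ∫ z, heatKernel N (1 / 2 ^ n) (x - z) = 1 := by
      rw [integral_sub_left_eq_self (heatKernel N (1 / 2 ^ n)), integral_heatKernel hN hh]
    have h2 := integral_add_compl (measurableSet_Ioo (a := a) (b := b)) (hint x)
    have h3 : ∫ z, heatKernel N (1 / 2 ^ n) (x - z) * exitProb N a b n z 0 =
        ∫ z in (Set.Ioo a b)ᶜ, heatKernel N (1 / 2 ^ n) (x - z) := by
      rw [← integral_indicator measurableSet_Ioo.compl]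
      congr 1 with z
      rw [exitProb_zero]
      by_cases hz : z ∈ Set.Ioo a b <;> simp [hz]
    rw [h3]
    simp only [survival, mul_one]
    linarith
  | succ k ih =>
    rw [exitProb_succ hN n hx]
    have h3 : ∫ z, heatKernel N (1 / 2 ^ n) (x - z) * exitProb N a b n z (k + 1) =
        ∫ z in Set.Ioo a b, heatKernel N (1 / 2 ^ n) (x - z) *
          (survival N a b (1 / 2 ^ n) k z - survival N a b (1 / 2 ^ n) (k + 1) z) := by
      rw [← integral_indicator measurableSet_Ioo]
      congr 1 with z
      by_cases hz : z ∈ Set.Ioo a b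
      · rw [Set.indicator_of_mem hz, ih hz]
      · rw [Set.indicator_of_notMem hz, exitProb_of_notMem n hz, mul_zero]
    have hi : ∀ k, IntegrableOn (fun z => heatKernel N (1 / 2 ^ n) (x - z) *
        survival N a b (1 / 2 ^ n) k z) (Set.Ioo a b) := fun k =>
      ((((continuous_heatKernel hN hh).comp (by fun_prop)).mul
        (continuous_survival hN hh k)).continuousOn.integrableOn_compact
          isCompact_Icc).mono_set Set.Ioo_subset_Icc_self
    rw [h3]
    simp only [mul_sub]
    rw [integral_sub (hi _) (hi _)]
    rfl

lemma exitCdf_eq {N : ℕ} (hN : 1 ≤ N) {a b : ℝ} (n : ℕ) {x : ℝ} (hx : x ∈ Set.Ioo a b) (t : ℝ) :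
    exitCdf N a b n x t = 1 - survival N a b (1 / 2 ^ n) ⌊2 ^ n * t⌋₊ x := by
  rw [exitCdf, Finset.sum_range_succ', exitProb_zero, if_pos hx, add_zero]
  simp only [exitProb_eq_survival_sub hN n hx]
  rw [Finset.sum_range_sub']
  rfl

end PseudoBM

namespace PseudoBM

open FourierTransform ComplexConjugate

/-! ### The Fourier transform on `L²(a, b)` -/

/-- The complex Hilbert space `L²(a, b)`. -/
abbrev L2 (a b : ℝ) := Lp ℂ 2 ((volume : Measure ℝ).restrict (Set.Ioo a b))

instance isFiniteMeasure_Ioo (a b : ℝ) :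
    IsFiniteMeasure ((volume : Measure ℝ).restrict (Set.Ioo a b)) :=
  ⟨by simp [Real.volume_Ioo]⟩

/-- The class in `L²(a, b)` of a (continuous) function on `ℝ`. -/
def toL2 (a b : ℝ) (f : ℝ → ℂ) : L2 a b := by
  classical exact
    if h : MemLp f 2 ((volume : Measure ℝ).restrict (Set.Ioo a b)) then h.toLp f else 0

variable {a b : ℝ}

lemma memLp_of_continuous (a b : ℝ) {f : ℝ → ℂ} (hf : Continuous f) (p : ENNReal) :
    MemLp f p ((volume : Measure ℝ).restrict (Set.Ioo a b)) := by
  obtain ⟨C, hC⟩ := (isCompact_Icc (a := a) (b := b)).exists_bound_of_continuousOn hf.continuousOn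
  exact MemLp.of_bound hf.aestronglyMeasurable C ((ae_restrict_mem measurableSet_Ioo).mono
    fun y hy => hC y (Set.Ioo_subset_Icc_self hy))

lemma coeFn_toL2 {f : ℝ → ℂ} (hf : Continuous f) :
    toL2 a b f =ᵐ[(volume : Measure ℝ).restrict (Set.Ioo a b)] f := by
  rw [toL2, dif_pos (memLp_of_continuous a b hf 2)]
  exact MemLp.coeFn_toLp _

lemma toL2_congr {f g : ℝ → ℂ} (hf : Continuous f) (hg : Continuous g)
    (h : ∀ y ∈ Set.Ioo a b, f y = g y) : toL2 a b f = toL2 a b g := by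
  apply Lp.ext
  filter_upwards [coeFn_toL2 hf, coeFn_toL2 hg, ae_restrict_mem measurableSet_Ioo] with y h1 h2 hy
  rw [h1, h2, h y hy]

lemma toL2_add {f g : ℝ → ℂ} (hf : Continuous f) (hg : Continuous g) :
    toL2 a b (fun y => f y + g y) = toL2 a b f + toL2 a b g := by
  apply Lp.ext
  filter_upwards [coeFn_toL2 hf, coeFn_toL2 hg, coeFn_toL2 (hf.add hg),
    Lp.coeFn_add (toL2 a b f) (toL2 a b g)] with y h1 h2 h3 h4
  rw [h4, Pi.add_apply, h1, h2]
  exact h3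

lemma toL2_const_mul {f : ℝ → ℂ} (hf : Continuous f) (c : ℂ) :
    toL2 a b (fun y => c * f y) = c • toL2 a b f := by
  apply Lp.ext
  filter_upwards [coeFn_toL2 hf, coeFn_toL2 (hf.const_mul c),
    Lp.coeFn_smul c (toL2 a b f)] with y h1 h3 h4
  rw [h4, Pi.smul_apply, h1]
  exact h3

lemma toL2_sum {ι : Type*} (s : Finset ι) {f : ι → ℝ → ℂ} (hf : ∀ i, Continuous (f i)) :
    toL2 a b (fun y => ∑ i ∈ s, f i y) = ∑ i ∈ s, toL2 a b (f i) := by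
  classical
  induction s using Finset.induction_on with
  | empty =>
    have := toL2_const_mul (a := a) (b := b) (f := fun _ => 0) continuous_const 0
    simpa using this
  | insert i s hi ih =>
    simp only [Finset.sum_insert hi]
    rw [toL2_add (hf i) (continuous_finsetSum _ fun j _ => hf j), ih]

lemma inner_L2 (f g : L2 a b) : inner ℂ f g = ∫ y in Set.Ioo a b, conj (f y) * g y := by
  rw [L2.inner_def]
  congr 1 with y
  rw [RCLike.inner_apply, mul_comm]

lemma inner_toL2 {f : ℝ → ℂ} (hf : Continuous f) (g : L2 a b) :
    inner ℂ (toL2 a b f) g = ∫ y in Set.Ioo a b, conj (f y) * g y := by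
  rw [inner_L2]
  refine integral_congr_ae ?_
  filter_upwards [coeFn_toL2 hf] with y h
  rw [h]

lemma inner_toL2_toL2 {f g : ℝ → ℂ} (hf : Continuous f) (hg : Continuous g) :
    inner ℂ (toL2 a b f) (toL2 a b g) = ∫ y in Set.Ioo a b, conj (f y) * g y := by
  rw [inner_toL2 hf]
  refine integral_congr_ae ?_
  filter_upwards [coeFn_toL2 hg] with y h
  rw [h]

lemma norm_sq_eq_integral {α : Type*} [MeasurableSpace α] {μ : Measure α} (f : Lp ℂ 2 μ) :
    ‖f‖ ^ 2 = ∫ y, ‖f y‖ ^ 2 ∂μ := by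
  have h : inner ℂ f f = ∫ y, ((‖f y‖ ^ 2 : ℝ) : ℂ) ∂μ := by
    rw [L2.inner_def]
    congr 1 with y
    rw [inner_self_eq_norm_sq_to_K]
    simp
  rw [inner_self_eq_norm_sq_to_K, integral_complex_ofReal] at h
  have h' := congrArg Complex.re h
  simpa [← Complex.ofReal_pow] using h'

/-- The norm of the embedding of bounded functions into `L²(a, b)`. -/
def boundConst (a b : ℝ) : ℝ :=
  (measureUnivNNReal ((volume : Measure ℝ).restrict (Set.Ioo a b)) : ℝ) ^ (2 : ENNReal).toReal⁻¹

lemma boundConst_nonneg : 0 ≤ boundConst a b := by unfold boundConst; positivity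

lemma norm_toL2_le {f : ℝ → ℂ} (hf : Continuous f) {C : ℝ} (hC : 0 ≤ C)
    (h : ∀ y ∈ Set.Ioo a b, ‖f y‖ ≤ C) : ‖toL2 a b f‖ ≤ boundConst a b * C := by
  refine Lp.norm_le_of_ae_bound hC ?_
  filter_upwards [coeFn_toL2 hf, ae_restrict_mem measurableSet_Ioo] with y h1 hy
  rw [h1]
  exact h y hy

/-- The exponential `y ↦ exp (iuy)` in `L²(a, b)`. -/
def expL2 (a b u : ℝ) : L2 a b := toL2 a b fun y => Complex.exp (Complex.I * (u * y))

/-- The Fourier transform `∫ exp (-iuy) f(y) dy` of `f ∈ L²(a, b)`. -/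
def ft (f : L2 a b) (u : ℝ) : ℂ := inner ℂ (expL2 a b u) f

lemma continuous_exp_I_mul (u : ℝ) : Continuous fun y : ℝ => Complex.exp (Complex.I * (u * y)) := by
  fun_prop

lemma conj_exp_I_mul (u y : ℝ) :
    conj (Complex.exp (Complex.I * (u * y))) = Complex.exp (-(Complex.I * (u * y))) := by
  rw [← Complex.exp_conj]
  simp

lemma ft_eq (f : L2 a b) (u : ℝ) :
    ft f u = ∫ y in Set.Ioo a b, Complex.exp (-(Complex.I * (u * y))) * f y := by
  rw [ft, expL2, inner_toL2 (continuous_exp_I_mul u)]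
  simp only [conj_exp_I_mul]

lemma norm_exp_I_mul (u y : ℝ) : ‖Complex.exp (Complex.I * (u * y))‖ = 1 :=
  norm_exp_I_mul_ofReal_mul y u

lemma norm_exp_neg_I_mul (u y : ℝ) : ‖Complex.exp (-(Complex.I * (u * y)))‖ = 1 := by
  rw [← conj_exp_I_mul, RCLike.norm_conj, norm_exp_I_mul]

lemma integrable_L2 (f : L2 a b) : IntegrableOn f (Set.Ioo a b) :=
  (Lp.memLp f).integrable (by norm_num)

lemma ft_add (f g : L2 a b) (u : ℝ) : ft (f + g) u = ft f u + ft g u := inner_add_right _ _ _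

lemma ft_sub (f g : L2 a b) (u : ℝ) : ft (f - g) u = ft f u - ft g u := inner_sub_right _ _ _

lemma ft_smul (c : ℂ) (f : L2 a b) (u : ℝ) : ft (c • f) u = c * ft f u := inner_smul_right _ _ _

lemma norm_ft_le (f : L2 a b) (u : ℝ) : ‖ft f u‖ ≤ boundConst a b * ‖f‖ := by
  refine (norm_inner_le_norm _ _).trans ?_
  gcongr
  have := norm_toL2_le (a := a) (b := b) (continuous_exp_I_mul u) zero_le_one
    (fun y _ => (norm_exp_I_mul u y).le)
  rwa [mul_one] at this

lemma continuous_ft (f : L2 a b) : Continuous (ft f) := by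
  have : ft f = fun u : ℝ => ∫ y in Set.Ioo a b, Complex.exp (-(Complex.I * (u * y))) * f y :=
    funext fun u => ft_eq f u
  rw [this]
  refine continuous_of_dominated (bound := fun y => ‖f y‖) (fun u => ?_)
    (fun u => Eventually.of_forall fun y => ?_) (integrable_L2 f).norm
    (Eventually.of_forall fun y => by fun_prop)
  · exact (Continuous.aestronglyMeasurable (by fun_prop)).mul (integrable_L2 f).aestronglyMeasurable
  · rw [norm_mul, norm_exp_neg_I_mul, one_mul]

/-- The `L²` Fourier transform of an integrable function is its Fourier integral. -/
lemma fourier_toLp_ae_eq {F : ℝ → ℂ} (h1 : Integrable F) (h2 : MemLp F 2) :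
    (𝓕 (h2.toLp F) : Lp ℂ 2 (volume : Measure ℝ)) =ᵐ[volume] 𝓕 F := by
  have hcont : Continuous (𝓕 F) :=
    VectorFourier.fourierIntegral_continuous Real.continuous_fourierChar (by fun_prop) h1
  refine ae_eq_of_integral_contDiff_smul_eq
    ((Lp.memLp _).locallyIntegrable (by norm_num)) hcont.locallyIntegrable fun g hg hgs => ?_
  have hg1 : HasCompactSupport (fun x => (g x : ℂ)) := hgs.comp_left (g := Complex.ofReal) rfl
  have hg2 : ContDiff ℝ (⊤ : ℕ∞) (fun x => (g x : ℂ)) := Complex.ofRealCLM.contDiff.comp hg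
  set G : SchwartzMap ℝ ℂ := hg1.toSchwartzMap hg2 with hG
  have hGx : ∀ x, G x = g x := fun x => by rw [hG]; simp
  -- Both transforms are compared as tempered distributions: testing against `G` moves the Fourier
  -- transform onto `G`, for the `L²` transform by its compatibility with distributions and for the
  -- integral one by Fubini.
  have h := congrArg (fun T => T G) (Lp.fourier_toTemperedDistribution_eq (h2.toLp F))
  simp only [TemperedDistribution.fourier_apply, Lp.toTemperedDistribution_apply] at h
  have e1 : ∫ x, g x • (𝓕 (h2.toLp F) : Lp ℂ 2 (volume : Measure ℝ)) x =
      ∫ x, G x • (𝓕 (h2.toLp F) : Lp ℂ 2 (volume : Measure ℝ)) x := by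
    congr 1 with x
  have e2 : ∫ x, g x • 𝓕 F x = ∫ x, G x • 𝓕 F x := by
    congr 1 with x
  rw [e1, e2, ← h]
  have e3 : ∫ x, (𝓕 G) x • (h2.toLp F) x = ∫ x, (𝓕 G) x • F x := by
    refine integral_congr_ae ?_
    filter_upwards [h2.coeFn_toLp] with x hx
    rw [hx]
  rw [e3]
  have := VectorFourier.integral_fourierIntegral_smul_eq_flip (L := innerₗ ℝ)
    (f := (G : ℝ → ℂ)) Real.continuous_fourierChar (by fun_prop) (G.integrable (μ := volume)) h1
  simpa [flip_innerₗ] using! this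

lemma fourier_indicator (f : L2 a b) (w : ℝ) :
    𝓕 ((Set.Ioo a b).indicator f) w = ft f (2 * Real.pi * w) := by
  rw [Real.fourier_real_eq_integral_exp_smul, ft_eq, ← integral_indicator measurableSet_Ioo]
  congr 1 with y
  by_cases hy : y ∈ Set.Ioo a b
  · simp only [Set.indicator_of_mem hy, smul_eq_mul]
    congr 2
    push_cast
    ring
  · simp [Set.indicator_of_notMem hy]

/-- The unitary Fourier transform of the extension by zero, after the rescaling `u = 2πw`; the
Jacobian is absorbed by `freqMeasure`. -/
lemma plancherel (f : L2 a b) :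
    Integrable (fun u => ‖ft f u‖ ^ 2) freqMeasure ∧
      ∫ u, ‖ft f u‖ ^ 2 ∂freqMeasure = ‖f‖ ^ 2 := by
  set F : ℝ → ℂ := (Set.Ioo a b).indicator f with hF
  have h1 : Integrable F := (integrable_indicator_iff measurableSet_Ioo).2 (integrable_L2 f)
  have h2 : MemLp F 2 := (memLp_indicator_iff_restrict measurableSet_Ioo).2 (Lp.memLp f)
  have hn : ‖h2.toLp F‖ ^ 2 = ‖f‖ ^ 2 := by
    rw [norm_sq_eq_integral, norm_sq_eq_integral, ← integral_indicator measurableSet_Ioo]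
    refine integral_congr_ae ?_
    filter_upwards [h2.coeFn_toLp] with y hy
    rw [hy, hF]
    by_cases hy : y ∈ Set.Ioo a b
    · simp [Set.indicator_of_mem hy]
    · simp [Set.indicator_of_notMem hy]
  have hae := fourier_toLp_ae_eq h1 h2
  have hpi : 2 * Real.pi ≠ 0 := by positivity
  have hint : Integrable fun w => ‖ft f (2 * Real.pi * w)‖ ^ 2 := by
    have := (Lp.memLp (𝓕 (h2.toLp F) : Lp ℂ 2 (volume : Measure ℝ))).integrable_norm_pow
      (p := 2) (by norm_num)
    refine this.congr ?_
    filter_upwards [hae] with w hw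
    rw [hw, hF, fourier_indicator]
  have hval : ∫ w, ‖ft f (2 * Real.pi * w)‖ ^ 2 = ‖f‖ ^ 2 := by
    rw [← hn, ← Lp.norm_fourier_eq (h2.toLp F), norm_sq_eq_integral]
    refine integral_congr_ae ?_
    filter_upwards [hae] with w hw
    rw [hw, hF, fourier_indicator]
  constructor
  · rw [integrable_freqMeasure]
    have := hint.comp_mul_left' (inv_ne_zero hpi)
    refine this.congr (Eventually.of_forall fun u => ?_)
    simp only [mul_inv_cancel_left₀ hpi]
  · rw [integral_freqMeasure, ← hval,
      Measure.integral_comp_mul_left (fun u => ‖ft f u‖ ^ 2) (2 * Real.pi),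
      abs_of_pos (by positivity)]

lemma memLp_ft (f : L2 a b) : MemLp (ft f) 2 freqMeasure :=
  (memLp_two_iff_integrable_sq_norm (continuous_ft f).aestronglyMeasurable).2 (plancherel f).1

/-- The Fourier transform as an isometry. -/
def ftIsometry (a b : ℝ) : L2 a b →ₗᵢ[ℂ] Lp ℂ 2 freqMeasure where
  toFun f := (memLp_ft f).toLp
  map_add' f g := by
    rw [← MemLp.toLp_add]
    congr 1
    ext u
    exact ft_add f g u
  map_smul' c f := by
    rw [RingHom.id_apply, ← MemLp.toLp_const_smul]
    congr 1
    ext u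
    exact ft_smul c f u
  norm_map' f := by
    change ‖(memLp_ft f).toLp‖ = ‖f‖
    rw [← sq_eq_sq₀ (norm_nonneg _) (norm_nonneg _), norm_sq_eq_integral, ← (plancherel f).2]
    refine integral_congr_ae ?_
    filter_upwards [(memLp_ft f).coeFn_toLp] with u hu
    rw [hu]

lemma integrable_conj_ft_mul_ft (f g : L2 a b) :
    Integrable (fun u => conj (ft f u) * ft g u) freqMeasure := by
  have := (memLp_ft g).integrable_mul (memLp_ft f).star
  refine this.congr (Eventually.of_forall fun u => ?_)
  simp [mul_comm]

lemma parseval (f g : L2 a b) :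
    ∫ u, conj (ft f u) * ft g u ∂freqMeasure = inner ℂ f g := by
  rw [← (ftIsometry a b).inner_map_map f g, L2.inner_def]
  refine integral_congr_ae ?_
  filter_upwards [(memLp_ft f).coeFn_toLp, (memLp_ft g).coeFn_toLp] with u h1 h2
  have e1 : (ftIsometry a b f : ℝ → ℂ) u = ft f u := h1
  have e2 : (ftIsometry a b g : ℝ → ℂ) u = ft g u := h2
  rw [e1, e2, RCLike.inner_apply, mul_comm]

end PseudoBM

namespace PseudoBM

open FourierTransform ComplexConjugate

variable {a b : ℝ}

/-! ### The transition operator of the sampled process killed outside `(a, b)` -/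

/-- The function `z ↦ p(h; y - z)` in `L²(a, b)`. -/
def kernelL2 (N : ℕ) (a b h y : ℝ) : L2 a b := toL2 a b fun z => (heatKernel N h (y - z) : ℂ)

/-- The function `y ↦ ∫ p(h; y - z) f(z) dz`. -/
def smoothing (N : ℕ) (h : ℝ) (f : L2 a b) (y : ℝ) : ℂ := inner ℂ (kernelL2 N a b h y) f

lemma continuous_heatKernel_sub {N : ℕ} (hN : 1 ≤ N) {h : ℝ} (hh : 0 < h) (y : ℝ) :
    Continuous fun z : ℝ => (heatKernel N h (y - z) : ℂ) :=
  Complex.continuous_ofReal.comp ((continuous_heatKernel hN hh).comp (by fun_prop))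

lemma smoothing_eq_integral {N : ℕ} (hN : 1 ≤ N) {h : ℝ} (hh : 0 < h) (f : L2 a b) (y : ℝ) :
    smoothing N h f y = ∫ z in Set.Ioo a b, (heatKernel N h (y - z) : ℂ) * f z := by
  rw [smoothing, kernelL2, inner_toL2 (continuous_heatKernel_sub hN hh y)]
  simp

lemma integrable_heatSymbol {N : ℕ} (hN : 1 ≤ N) {h : ℝ} (hh : 0 < h) :
    Integrable (fun u => (heatSymbol N h u : ℂ)) freqMeasure := by
  rw [integrable_freqMeasure]
  simpa using integrable_polynomial_mul_heatSymbol hN hh 1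

lemma smoothing_eq {N : ℕ} (hN : 1 ≤ N) {h : ℝ} (hh : 0 < h) (f : L2 a b) (y : ℝ) :
    smoothing N h f y =
      ∫ u, Complex.exp (Complex.I * (u * y)) * heatSymbol N h u * ft f u ∂freqMeasure := by
  have hker : ∀ z : ℝ, (heatKernel N h (y - z) : ℂ) =
      ∫ u, Complex.exp (Complex.I * (u * (y - z : ℝ))) * heatSymbol N h u ∂freqMeasure := by
    intro z
    rw [← kernelDeriv_zero_eq hN hh, kernelDeriv]
    simp only [pow_zero, one_mul]
  rw [smoothing_eq_integral hN hh]
  simp only [hker, ft_eq, ← integral_mul_const, ← integral_const_mul]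
  rw [integral_integral_swap]
  · congr 1 with u
    congr 1 with z
    have : Complex.exp (Complex.I * (u * (y - z : ℝ))) =
        Complex.exp (Complex.I * (u * y)) * Complex.exp (-(Complex.I * (u * z))) := by
      rw [← Complex.exp_add]
      congr 1
      push_cast
      ring
    rw [this]
    ring
  · have h1 := (integrable_L2 f).mul_prod (integrable_heatSymbol hN hh)
    have h2 := h1.bdd_mul (c := 1) (f := fun p : ℝ × ℝ =>
      Complex.exp (Complex.I * (p.2 * (y - p.1 : ℝ)))) (by fun_prop)
      (Eventually.of_forall fun p => (norm_exp_I_mul _ _).le)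
    refine h2.congr (Eventually.of_forall fun p => ?_)
    simp only [Function.uncurry]
    ring

lemma continuous_smoothing {N : ℕ} (hN : 1 ≤ N) {h : ℝ} (hh : 0 < h) (f : L2 a b) :
    Continuous (smoothing N h f) := by
  have : smoothing N h f = fun y : ℝ =>
      ∫ u, Complex.exp (Complex.I * (u * y)) * heatSymbol N h u * ft f u ∂freqMeasure :=
    funext fun y => smoothing_eq hN hh f y
  rw [this]
  have hft := continuous_ft f
  refine continuous_of_dominated
    (bound := fun u => ‖(heatSymbol N h u : ℂ)‖ * (boundConst a b * ‖f‖))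
    (fun y => by fun_prop) (fun y => Eventually.of_forall fun u => ?_)
    ((integrable_heatSymbol hN hh).norm.mul_const _)
    (Eventually.of_forall fun u => by fun_prop)
  rw [norm_mul, norm_mul, norm_exp_I_mul, one_mul]
  gcongr
  exact norm_ft_le f u

lemma norm_smoothing_le {N : ℕ} (hN : 1 ≤ N) {h : ℝ} (hh : 0 < h) (f : L2 a b) (y : ℝ) :
    ‖smoothing N h f y‖ ≤
      (∫ u, ‖(heatSymbol N h u : ℂ)‖ ∂freqMeasure) * boundConst a b * ‖f‖ := by
  rw [smoothing_eq hN hh, mul_assoc, ← integral_mul_const]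
  refine norm_integral_le_of_norm_le ((integrable_heatSymbol hN hh).norm.mul_const _)
    (Eventually.of_forall fun u => ?_)
  rw [norm_mul, norm_mul, norm_exp_I_mul, one_mul]
  gcongr
  exact norm_ft_le f u

/-- The transition operator `f ↦ ∫_a^b p(h; · - z) f(z) dz` on `L²(a, b)`. -/
def stepOp (a b : ℝ) {N : ℕ} (hN : 1 ≤ N) {h : ℝ} (hh : 0 < h) : L2 a b →L[ℂ] L2 a b :=
  LinearMap.mkContinuous
    { toFun := fun f => toL2 a b (smoothing N h f)
      map_add' := fun f g => by
        rw [← toL2_add (continuous_smoothing hN hh f) (continuous_smoothing hN hh g)]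
        congr 1
        ext y
        exact inner_add_right _ _ _
      map_smul' := fun c f => by
        rw [RingHom.id_apply, ← toL2_const_mul (continuous_smoothing hN hh f)]
        congr 1
        ext y
        exact inner_smul_right _ _ _ }
    (boundConst a b * ((∫ u, ‖(heatSymbol N h u : ℂ)‖ ∂freqMeasure) * boundConst a b))
    fun f => by
      rw [mul_assoc]
      exact norm_toL2_le (continuous_smoothing hN hh f)
        (by have := boundConst_nonneg (a := a) (b := b); positivity)
        fun y _ => norm_smoothing_le hN hh f y

lemma stepOp_apply {N : ℕ} (hN : 1 ≤ N) {h : ℝ} (hh : 0 < h) (f : L2 a b) :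
    stepOp a b hN hh f = toL2 a b (smoothing N h f) := rfl

lemma inner_L2_toL2 {g : ℝ → ℂ} (f : L2 a b) (hg : Continuous g) :
    inner ℂ f (toL2 a b g) = ∫ y in Set.Ioo a b, conj (f y) * g y := by
  rw [inner_L2]
  refine integral_congr_ae ?_
  filter_upwards [coeFn_toL2 hg] with y h
  rw [h]

lemma conj_ft (f : L2 a b) (u : ℝ) :
    conj (ft f u) = ∫ y in Set.Ioo a b, conj (f y) * Complex.exp (Complex.I * (u * y)) := by
  rw [ft_eq, ← integral_conj]
  congr 1 with y
  rw [map_mul, ← conj_exp_I_mul, Complex.conj_conj, mul_comm]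

/-- The operator is the compression of a Fourier multiplier to `L²(a, b)`. Self-adjointness and the
bounds `0 ≤ T ≤ 1` are read off from this formula, since the symbol is real with values in `(0, 1]`.
-/
lemma inner_stepOp {N : ℕ} (hN : 1 ≤ N) {h : ℝ} (hh : 0 < h) (f g : L2 a b) :
    inner ℂ f (stepOp a b hN hh g) =
      ∫ u, conj (ft f u) * heatSymbol N h u * ft g u ∂freqMeasure := by
  rw [stepOp_apply, inner_L2_toL2 f (continuous_smoothing hN hh g)]
  simp only [smoothing_eq hN hh, conj_ft, ← integral_mul_const, ← integral_const_mul]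
  rw [integral_integral_swap]
  · congr 1 with u
    congr 1 with y
    ring
  · have hft := continuous_ft g
    have h0 : Integrable (fun u => (heatSymbol N h u : ℂ) * ft g u) freqMeasure :=
      (integrable_heatSymbol hN hh).mul_bdd (c := boundConst a b * ‖g‖)
        hft.aestronglyMeasurable (Eventually.of_forall fun u => norm_ft_le g u)
    have h3 : Integrable (fun y => conj (f y)) ((volume : Measure ℝ).restrict (Set.Ioo a b)) :=
      (Lp.memLp f).star.integrable (by norm_num)
    have h1 := h3.mul_prod h0
    have h2 := h1.bdd_mul (c := 1) (f := fun p : ℝ × ℝ =>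
      Complex.exp (Complex.I * (p.2 * p.1))) (by fun_prop)
      (Eventually.of_forall fun p => (norm_exp_I_mul _ _).le)
    refine h2.congr (Eventually.of_forall fun p => ?_)
    simp only [Function.uncurry]
    ring

lemma integrable_mul_sq_ft (f : L2 a b) {w : ℝ → ℝ} (hw : Continuous w) {C : ℝ}
    (h : ∀ u, ‖w u‖ ≤ C) : Integrable (fun u => w u * ‖ft f u‖ ^ 2) freqMeasure :=
  (plancherel f).1.bdd_mul hw.aestronglyMeasurable (Eventually.of_forall h)

lemma norm_heatSymbol_le_one {N : ℕ} {t : ℝ} (ht : 0 ≤ t) (u : ℝ) : ‖heatSymbol N t u‖ ≤ 1 := by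
  rw [Real.norm_of_nonneg (heatSymbol_pos N t u).le]
  exact heatSymbol_le_one ht u

lemma inner_stepOp_self {N : ℕ} (hN : 1 ≤ N) {h : ℝ} (hh : 0 < h) (f : L2 a b) :
    inner ℂ f (stepOp a b hN hh f) =
      ((∫ u, heatSymbol N h u * ‖ft f u‖ ^ 2 ∂freqMeasure : ℝ) : ℂ) := by
  rw [inner_stepOp, ← integral_complex_ofReal]
  congr 1 with u
  push_cast
  rw [← Complex.conj_mul']
  ring

lemma isSelfAdjoint_stepOp {N : ℕ} (hN : 1 ≤ N) {h : ℝ} (hh : 0 < h) :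
    IsSelfAdjoint (stepOp a b hN hh) := by
  rw [ContinuousLinearMap.isSelfAdjoint_iff_isSymmetric]
  intro f g
  change inner ℂ (stepOp a b hN hh f) g = inner ℂ f (stepOp a b hN hh g)
  rw [← inner_conj_symm, inner_stepOp, inner_stepOp, ← integral_conj]
  congr 1 with u
  simp only [map_mul, Complex.conj_conj, Complex.conj_ofReal]
  ring

lemma inner_stepOp_self_nonneg {N : ℕ} (hN : 1 ≤ N) {h : ℝ} (hh : 0 < h) (f : L2 a b) :
    0 ≤ (inner ℂ f (stepOp a b hN hh f)).re := by
  rw [inner_stepOp_self, Complex.ofReal_re]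
  exact integral_nonneg fun u => mul_nonneg (heatSymbol_pos _ _ _).le (sq_nonneg _)

lemma inner_stepOp_self_le {N : ℕ} (hN : 1 ≤ N) {h : ℝ} (hh : 0 < h) (f : L2 a b) :
    (inner ℂ f (stepOp a b hN hh f)).re ≤ ‖f‖ ^ 2 := by
  rw [inner_stepOp_self, Complex.ofReal_re, ← (plancherel f).2]
  refine integral_mono (integrable_mul_sq_ft f (continuous_heatSymbol N h)
    (norm_heatSymbol_le_one hh.le)) (plancherel f).1 fun u => ?_
  exact mul_le_of_le_one_left (sq_nonneg _) (heatSymbol_le_one hh.le u)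

/-- The survival functions are the iterates of the transition operator. -/
lemma survival_eq_smoothing {N : ℕ} (hN : 1 ≤ N) {h : ℝ} (hh : 0 < h) (k : ℕ) :
    (toL2 a b fun y => (survival N a b h k y : ℂ)) =
        (stepOp a b hN hh ^ k) (toL2 a b fun _ => 1) ∧
      ∀ x, (survival N a b h (k + 1) x : ℂ) =
        smoothing N h ((stepOp a b hN hh ^ k) (toL2 a b fun _ => 1)) x := by
  have hs : ∀ k, Continuous fun y => (survival N a b h k y : ℂ) := fun k =>
    Complex.continuous_ofReal.comp (continuous_survival hN hh k)
  -- Elements of `L²` have no point values; a value at `x` is recovered by spending the last step as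
  -- a smoothing.
  have key : ∀ k x, (survival N a b h (k + 1) x : ℂ) =
      smoothing N h (toL2 a b fun y => (survival N a b h k y : ℂ)) x := by
    intro k x
    rw [smoothing, kernelL2,
      inner_toL2_toL2 (continuous_heatKernel_sub hN hh x) (hs k)]
    rw [survival, ← integral_complex_ofReal]
    simp
  have h1 : (toL2 a b fun y => (survival N a b h k y : ℂ)) =
        (stepOp a b hN hh ^ k) (toL2 a b fun _ => 1) := by
    induction k with
    | zero => simp [survival]
    | succ k ih =>
      rw [pow_succ', mul_apply_eq_comp, ← ih, stepOp_apply]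
      congr 1
      ext y
      exact key k y
  exact ⟨h1, fun x => by rw [key, h1]⟩

end PseudoBM

namespace PseudoBM

/-! ### Heat functions -/

/-- The function `r ↦ r^(-k) exp (-t (1/r - 1))`, extended by zero to `r ≤ 0`. If `R = (1 + A)⁻¹`,
it represents `(1 + A)^k exp (-t A)`. -/
def heatFun (k : ℕ) (t r : ℝ) : ℝ := if r ≤ 0 then 0 else r⁻¹ ^ k * Real.exp (-t * (r⁻¹ - 1))

lemma heatFun_of_pos (k : ℕ) (t : ℝ) {r : ℝ} (hr : 0 < r) :
    heatFun k t r = r⁻¹ ^ k * Real.exp (-t * (r⁻¹ - 1)) := by rw [heatFun, if_neg hr.not_ge]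

lemma heatFun_of_nonpos (k : ℕ) (t : ℝ) {r : ℝ} (hr : r ≤ 0) : heatFun k t r = 0 := by
  rw [heatFun, if_pos hr]

lemma heatFun_nonneg (k : ℕ) (t r : ℝ) : 0 ≤ heatFun k t r := by
  rcases le_or_gt r 0 with h | h
  · rw [heatFun_of_nonpos k t h]
  · rw [heatFun_of_pos k t h]; positivity

/-- With `y = 1/r`, a single term `(ty)^k / k!` of the exponential series is at most `exp (ty)`. -/
lemma heatFun_le (k : ℕ) {t : ℝ} (ht : 0 < t) (r : ℝ) :
    heatFun k t r ≤ Real.exp t * k.factorial / t ^ k := by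
  rcases le_or_gt r 0 with h | h
  · rw [heatFun_of_nonpos k t h]; positivity
  · rw [heatFun_of_pos k t h, le_div_iff₀ (by positivity)]
    have h1 := Real.pow_div_factorial_le_exp (t * r⁻¹) (by positivity) k
    rw [div_le_iff₀ (by positivity), mul_pow] at h1
    have h2 : Real.exp (-t * (r⁻¹ - 1)) = Real.exp t * Real.exp (-(t * r⁻¹)) := by
      rw [← Real.exp_add]; ring_nf
    rw [h2]
    calc r⁻¹ ^ k * (Real.exp t * Real.exp (-(t * r⁻¹))) * t ^ k
        = (t ^ k * r⁻¹ ^ k) * (Real.exp t * Real.exp (-(t * r⁻¹))) := by ring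
      _ ≤ (Real.exp (t * r⁻¹) * k.factorial) * (Real.exp t * Real.exp (-(t * r⁻¹))) := by gcongr
      _ = Real.exp t * k.factorial * (Real.exp (t * r⁻¹) * Real.exp (-(t * r⁻¹))) := by ring
      _ = _ := by rw [← Real.exp_add, add_neg_cancel, Real.exp_zero, mul_one]

lemma mul_heatFun_succ (k : ℕ) (t r : ℝ) : r * heatFun (k + 1) t r = heatFun k t r := by
  rcases le_or_gt r 0 with h | h
  · simp [heatFun_of_nonpos _ t h]
  · rw [heatFun_of_pos _ t h, heatFun_of_pos _ t h, pow_succ]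
    field_simp

/-- The only doubtful point is `r = 0`, where `heatFun k` equals `r` times the bounded function
`heatFun (k + 1)`. -/
lemma continuous_heatFun (k : ℕ) {t : ℝ} (ht : 0 < t) : Continuous (heatFun k t) := by
  rw [continuous_iff_continuousAt]
  intro r
  rcases lt_trichotomy r 0 with h | rfl | h
  · refine (continuousAt_const (y := (0 : ℝ))).congr ?_
    filter_upwards [Iio_mem_nhds h] with s hs
    rw [heatFun_of_nonpos k t (le_of_lt hs)]
  · rw [ContinuousAt, heatFun_of_nonpos k t le_rfl]
    refine squeeze_zero_norm (a := fun s : ℝ =>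
      |s| * (Real.exp t * (k + 1).factorial / t ^ (k + 1))) (fun s => ?_) ?_
    · rw [← mul_heatFun_succ, norm_mul, Real.norm_eq_abs, Real.norm_of_nonneg (heatFun_nonneg _ _ _)]
      gcongr
      exact heatFun_le _ ht s
    · have : Continuous fun s : ℝ => |s| * (Real.exp t * (k + 1).factorial / t ^ (k + 1)) := by
        fun_prop
      simpa using this.tendsto 0
  · have hc : ContinuousAt (fun s : ℝ => s⁻¹ ^ k * Real.exp (-t * (s⁻¹ - 1))) r := by
      have : ContinuousAt (fun s : ℝ => s⁻¹) r := continuousAt_inv₀ h.ne'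
      fun_prop
    refine hc.congr ?_
    filter_upwards [Ioi_mem_nhds h] with s hs
    rw [heatFun_of_pos k t hs]

lemma heatFun_zero_le_one {t : ℝ} (ht : 0 ≤ t) {r : ℝ} (hr : r ≤ 1) : heatFun 0 t r ≤ 1 := by
  rcases le_or_gt r 0 with h0 | h0
  · simp [heatFun_of_nonpos _ _ h0]
  · rw [heatFun_of_pos _ _ h0, pow_zero, one_mul, Real.exp_le_one_iff]
    have : 1 ≤ r⁻¹ := (one_le_inv₀ h0).2 hr
    nlinarith

lemma abs_exp_sub_one_sub_le (x : ℝ) : |Real.exp x - 1 - x| ≤ x ^ 2 * Real.exp |x| := by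
  have h := Complex.norm_exp_sub_sum_le_norm_mul_exp (x : ℂ) 2
  have e : Complex.exp x - ∑ m ∈ Finset.range 2, (x : ℂ) ^ m / (m.factorial : ℂ) =
      ((Real.exp x - 1 - x : ℝ) : ℂ) := by
    simp [Finset.sum_range_succ, sub_sub]
  rw [e, Complex.norm_real, Complex.norm_real, Real.norm_eq_abs, Real.norm_eq_abs, sq_abs] at h
  exact h

/-- Differentiating in `t` multiplies by `1 - 1/r`, which is `heatFun k - heatFun (k + 1)`. In the
second-order remainder half of the decay `exp (-t(1/r - 1))` pays for `exp (|δ|(1/r - 1))`, and the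
other half for the power `(1/r)^(k + 2)`; so the bound is uniform in `r`. -/
lemma heatFun_taylor (k : ℕ) {t δ : ℝ} (ht : 0 < t) (hδ : |δ| ≤ t / 2) {r : ℝ} (hr : r ≤ 1) :
    |heatFun k (t + δ) r - heatFun k t r - δ * (heatFun k t r - heatFun (k + 1) t r)| ≤
      δ ^ 2 * (Real.exp (t / 2) * (k + 2).factorial / (t / 2) ^ (k + 2)) := by
  rcases le_or_gt r 0 with h0 | h0
  · simp only [heatFun_of_nonpos _ _ h0]
    simp only [sub_self, mul_zero, abs_zero]
    positivity
  · refine le_trans ?_ (mul_le_mul_of_nonneg_left (heatFun_le (k + 2) (half_pos ht) r) (sq_nonneg δ))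
    simp only [heatFun_of_pos _ _ h0]
    have h1 : 1 ≤ r⁻¹ := (one_le_inv₀ h0).2 hr
    set y := r⁻¹
    have hw : 0 ≤ y - 1 := by linarith
    have h2 := abs_exp_sub_one_sub_le (-δ * (y - 1))
    have e : y ^ k * Real.exp (-(t + δ) * (y - 1)) - y ^ k * Real.exp (-t * (y - 1)) -
        δ * (y ^ k * Real.exp (-t * (y - 1)) - y ^ (k + 1) * Real.exp (-t * (y - 1))) =
        y ^ k * Real.exp (-t * (y - 1)) * (Real.exp (-δ * (y - 1)) - 1 - (-δ * (y - 1))) := by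
      have : Real.exp (-(t + δ) * (y - 1)) =
          Real.exp (-t * (y - 1)) * Real.exp (-δ * (y - 1)) := by
        rw [← Real.exp_add]; ring_nf
      rw [this]; ring
    rw [e, abs_mul, abs_of_nonneg (by positivity)]
    have h3 : Real.exp |-δ * (y - 1)| ≤ Real.exp (t / 2 * (y - 1)) := by
      rw [Real.exp_le_exp, abs_mul, abs_neg, abs_of_nonneg hw]
      gcongr
    calc y ^ k * Real.exp (-t * (y - 1)) * |Real.exp (-δ * (y - 1)) - 1 - -δ * (y - 1)|
        ≤ y ^ k * Real.exp (-t * (y - 1)) * ((-δ * (y - 1)) ^ 2 * Real.exp (t / 2 * (y - 1))) := by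
          gcongr
          exact h2.trans (by gcongr)
      _ = δ ^ 2 * (y ^ k * (y - 1) ^ 2 *
          (Real.exp (-t * (y - 1)) * Real.exp (t / 2 * (y - 1)))) := by ring
      _ = δ ^ 2 * (y ^ k * (y - 1) ^ 2 * Real.exp (-(t / 2) * (y - 1))) := by
          rw [← Real.exp_add]; ring_nf
      _ ≤ δ ^ 2 * (y ^ k * y ^ 2 * Real.exp (-(t / 2) * (y - 1))) := by
          gcongr
          linarith
      _ = _ := by ring

/-- `(1 - s)(1 + s + ⋯ + s^j) ≤ 1`, and each of the `j + 1` terms of the sum is at least `s^j`. This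
is the scalar form of the smoothing effect of the powers of `T`. -/
lemma one_sub_mul_pow_le {s : ℝ} (h0 : 0 ≤ s) (h1 : s ≤ 1) (j : ℕ) :
    (1 - s) * s ^ j ≤ 1 / (j + 1) := by
  rw [le_div_iff₀ (by positivity)]
  have h := mul_neg_geom_sum s (j + 1)
  have h2 : ∑ i ∈ Finset.range (j + 1), s ^ j ≤ ∑ i ∈ Finset.range (j + 1), s ^ i :=
    Finset.sum_le_sum fun i hi => pow_le_pow_of_le_one h0 h1 (by
      have := Finset.mem_range.1 hi; omega)
  rw [Finset.sum_const, Finset.card_range, nsmul_eq_mul] at h2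
  push_cast at h2
  have h3 : 0 ≤ s ^ (j + 1) := by positivity
  nlinarith [mul_le_mul_of_nonneg_left h2 (sub_nonneg.2 h1)]

lemma sq_mul_exp_neg_le {x : ℝ} (hx : 0 ≤ x) : x ^ 2 * Real.exp (-x) ≤ 2 := by
  have := Real.quadratic_le_exp_of_nonneg hx
  rw [Real.exp_neg, ← div_eq_mul_inv, div_le_iff₀ (Real.exp_pos x)]
  linarith

/-- With `σ = 1 - s` one has `1 - σ² ≤ s exp σ ≤ 1`, so Bernoulli's inequality bounds the gap by
`mσ² exp (-mσ)`. The maximum of `x² exp (-x)` makes this `O(1/m)` uniformly in `s`. -/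
lemma abs_pow_sub_exp_le {s : ℝ} (h0 : 0 ≤ s) (h1 : s ≤ 1) {m : ℕ} (hm : 0 < m) :
    |s ^ m - Real.exp (-(m * (1 - s)))| ≤ 2 / m := by
  have hm' : (0 : ℝ) < m := by exact_mod_cast hm
  set σ := 1 - s with hσ
  have hs : s = 1 - σ := by rw [hσ]; ring
  have hσ0 : 0 ≤ σ := by linarith
  have h2 : s ≤ Real.exp (-σ) := by have := Real.add_one_le_exp (-σ); linarith
  have e : Real.exp (-(m * σ)) = Real.exp (-σ) ^ m := by rw [← Real.exp_nat_mul]; ring_nf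
  have h3 : s ^ m ≤ Real.exp (-(m * σ)) := by rw [e]; gcongr
  rw [abs_sub_comm, abs_of_nonneg (by linarith)]
  have h4 : 1 - σ ^ 2 ≤ s * Real.exp σ := by
    have := Real.add_one_le_exp σ
    nlinarith
  have h5 := one_add_mul_le_pow (a := s * Real.exp σ - 1)
    (by have : 0 ≤ s * Real.exp σ := by positivity
        linarith) m
  rw [add_sub_cancel, mul_pow, ← Real.exp_nat_mul] at h5
  have h6 : s ^ m = s ^ m * Real.exp (m * σ) * Real.exp (-(m * σ)) := by
    rw [mul_assoc, ← Real.exp_add, add_neg_cancel, Real.exp_zero, mul_one]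
  have h7 : Real.exp (-(m * σ)) - s ^ m ≤ m * σ ^ 2 * Real.exp (-(m * σ)) := by
    rw [h6]
    have : 1 - m * σ ^ 2 ≤ s ^ m * Real.exp (m * σ) := by nlinarith
    nlinarith [Real.exp_pos (-(m * σ))]
  refine h7.trans ?_
  rw [le_div_iff₀ hm']
  have := sq_mul_exp_neg_le (x := m * σ) (by positivity)
  calc m * σ ^ 2 * Real.exp (-(m * σ)) * m = (m * σ) ^ 2 * Real.exp (-(m * σ)) := by ring
    _ ≤ 2 := this

/-- After factoring out `exp (-pσ)`, the difference is at most `(q - p)σ exp (-pσ)`, and `pσ exp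
(-pσ) ≤ 1` removes the dependence on `σ`. -/
lemma exp_neg_sub_exp_neg_le {p q σ : ℝ} (hp : 0 < p) (hpq : p ≤ q) (hσ : 0 ≤ σ) :
    |Real.exp (-(p * σ)) - Real.exp (-(q * σ))| ≤ (q - p) / p := by
  have h1 : Real.exp (-(q * σ)) ≤ Real.exp (-(p * σ)) := by gcongr
  rw [abs_of_nonneg (by linarith), le_div_iff₀ hp]
  have e : Real.exp (-(q * σ)) = Real.exp (-(p * σ)) * Real.exp (-((q - p) * σ)) := by
    rw [← Real.exp_add]; ring_nf
  have h2 := Real.add_one_le_exp (-((q - p) * σ))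
  have h3 : p * σ * Real.exp (-(p * σ)) ≤ 1 := by
    have := Real.add_one_le_exp (p * σ)
    rw [Real.exp_neg, ← div_eq_mul_inv, div_le_one (Real.exp_pos _)]
    linarith
  calc (Real.exp (-(p * σ)) - Real.exp (-(q * σ))) * p
      = Real.exp (-(p * σ)) * (1 - Real.exp (-((q - p) * σ))) * p := by rw [e]; ring
    _ ≤ Real.exp (-(p * σ)) * ((q - p) * σ) * p := by gcongr; linarith
    _ = (q - p) * (p * σ * Real.exp (-(p * σ))) := by ring
    _ ≤ (q - p) * 1 := by gcongr
    _ = q - p := mul_one _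

lemma abs_exp_neg_sub_le {p q σ : ℝ} (hp : 0 < p) (hq : 0 < q) (hσ : 0 ≤ σ) :
    |Real.exp (-(p * σ)) - Real.exp (-(q * σ))| ≤ |q - p| / min p q := by
  rcases le_total p q with h | h
  · rw [min_eq_left h, abs_of_nonneg (sub_nonneg.2 h)]
    exact exp_neg_sub_exp_neg_le hp h hσ
  · rw [min_eq_right h, abs_sub_comm, abs_sub_comm q, abs_of_nonneg (sub_nonneg.2 h)]
    exact exp_neg_sub_exp_neg_le hq h hσ

end PseudoBM

set_option linter.unusedSectionVars false

namespace PseudoBM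

/-! ### Functional calculus of self-adjoint contractions -/

section Hilbert

variable {H : Type*} [NormedAddCommGroup H] [InnerProductSpace ℂ H] [CompleteSpace H]

/-- Self-adjoint operators between `0` and `1`. -/
structure IsUnitOp (T : H →L[ℂ] H) : Prop where
  isSelfAdjoint : IsSelfAdjoint T
  nonneg : ∀ f, 0 ≤ (inner ℂ f (T f)).re
  le_one : ∀ f, (inner ℂ f (T f)).re ≤ ‖f‖ ^ 2

lemma inner_self_re (f : H) : (inner ℂ f f).re = ‖f‖ ^ 2 := by
  rw [inner_self_eq_norm_sq_to_K, ← RCLike.ofReal_pow, RCLike.ofReal_eq_complex_ofReal,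
    Complex.ofReal_re]

lemma inner_re_comm (f g : H) : (inner ℂ f g).re = (inner ℂ g f).re := by
  rw [← inner_conj_symm, Complex.conj_re]

lemma IsSelfAdjoint.inner_apply {T : H →L[ℂ] H} (hT : IsSelfAdjoint T) (f g : H) :
    inner ℂ (T f) g = inner ℂ f (T g) :=
  (ContinuousLinearMap.isSelfAdjoint_iff_isSymmetric.1 hT) f g

namespace IsUnitOp

variable {T : H →L[ℂ] H}

lemma inner_apply (hT : IsUnitOp T) (f g : H) : inner ℂ (T f) g = inner ℂ f (T g) :=
  IsSelfAdjoint.inner_apply hT.isSelfAdjoint f g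

lemma im_inner (hT : IsUnitOp T) (f : H) : (inner ℂ f (T f)).im = 0 := by
  have h := hT.inner_apply f f
  rw [← inner_conj_symm] at h
  exact Complex.conj_eq_iff_im.1 h

lemma zero_le (hT : IsUnitOp T) : 0 ≤ T := by
  rw [ContinuousLinearMap.nonneg_iff_isPositive, ContinuousLinearMap.isPositive_iff_complex]
  intro f
  rw [hT.inner_apply]
  refine ⟨Complex.ext ?_ ?_, hT.nonneg f⟩
  · rw [RCLike.re_eq_complex_re, Complex.ofReal_re]
  · rw [Complex.ofReal_im, hT.im_inner]

lemma le_one' (hT : IsUnitOp T) : T ≤ 1 := by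
  rw [ContinuousLinearMap.le_def, ContinuousLinearMap.isPositive_iff_complex]
  intro f
  rw [sub_apply, one_apply_eq_self, inner_sub_left, hT.inner_apply]
  have h1 : (inner ℂ f f : ℂ).im = 0 := by
    rw [inner_self_eq_norm_sq_to_K, ← RCLike.ofReal_pow, RCLike.ofReal_eq_complex_ofReal,
      Complex.ofReal_im]
  refine ⟨Complex.ext ?_ ?_, ?_⟩
  · rw [RCLike.re_eq_complex_re, Complex.ofReal_re]
  · rw [Complex.ofReal_im, Complex.sub_im, hT.im_inner, h1, sub_zero]
  · rw [RCLike.re_eq_complex_re, Complex.sub_re, inner_self_re]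
    linarith [hT.le_one f]

lemma spectrum_subset (hT : IsUnitOp T) : spectrum ℝ T ⊆ Set.Icc 0 1 := by
  have := hT.isSelfAdjoint
  intro s hs
  exact ⟨spectrum_nonneg_of_nonneg hT.zero_le hs,
    (cfc_le_one_iff (fun x : ℝ => x) T).1 (by rw [cfc_id' ℝ T]; exact hT.le_one') s hs⟩

/-- Through this bound every operator estimate below becomes a scalar inequality on `[0, 1]`. -/
lemma norm_cfc_le (hT : IsUnitOp T) {F : ℝ → ℝ} {C : ℝ} (hC : 0 ≤ C)
    (h : ∀ s ∈ Set.Icc (0 : ℝ) 1, |F s| ≤ C) : ‖cfc F T‖ ≤ C :=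
  _root_.norm_cfc_le hC fun s hs => h s (hT.spectrum_subset hs)

lemma norm_le_one (hT : IsUnitOp T) : ‖T‖ ≤ 1 := by
  have h := hT.norm_cfc_le (F := fun s => s) zero_le_one
    fun s hs => by rw [abs_of_nonneg hs.1]; exact hs.2
  have := hT.isSelfAdjoint
  rwa [cfc_id' ℝ T] at h

lemma norm_apply_le (hT : IsUnitOp T) (f : H) : ‖T f‖ ≤ ‖f‖ := by
  simpa using T.le_of_opNorm_le hT.norm_le_one f

lemma norm_pow_apply_le (hT : IsUnitOp T) (k : ℕ) (f : H) : ‖(T ^ k) f‖ ≤ ‖f‖ := by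
  induction k with
  | zero => simp
  | succ k ih =>
    rw [pow_succ', mul_apply_eq_comp]
    exact (hT.norm_apply_le _).trans ih

lemma inner_pow_apply (hT : IsUnitOp T) (k : ℕ) (f g : H) :
    inner ℂ ((T ^ k) f) g = inner ℂ f ((T ^ k) g) :=
  IsSelfAdjoint.inner_apply (hT.isSelfAdjoint.pow k) f g

end IsUnitOp

/-- The resolvent `(1 + h⁻¹(1 - T))⁻¹`. -/
def resolvent (T : H →L[ℂ] H) (h : ℝ) : H →L[ℂ] H := cfc (fun s => h / (h + 1 - s)) T

/-- The operator `1 + h⁻¹(1 - T)`. -/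
def genOp (T : H →L[ℂ] H) (h : ℝ) : H →L[ℂ] H := 1 + ((h⁻¹ : ℝ) : ℂ) • (1 - T)

lemma genOp_apply (T : H →L[ℂ] H) (h : ℝ) (f : H) :
    genOp T h f = f + ((h⁻¹ : ℝ) : ℂ) • (f - T f) := by
  simp [genOp]

lemma continuousOn_resolventFun {h : ℝ} (hh : 0 < h) :
    ContinuousOn (fun s => h / (h + 1 - s)) (Set.Icc 0 1) := by
  refine continuousOn_const.div (by fun_prop) fun s hs => ?_
  have := hs.2
  have : 0 < h + 1 - s := by linarith
  exact this.ne'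

lemma resolventFun_mem {h : ℝ} (hh : 0 < h) {s : ℝ} (hs : s ∈ Set.Icc (0 : ℝ) 1) :
    0 < h / (h + 1 - s) ∧ h / (h + 1 - s) ≤ 1 := by
  have := hs.2
  have h1 : 0 < h + 1 - s := by linarith
  exact ⟨by positivity, (div_le_one h1).2 (by linarith)⟩

namespace IsUnitOp

variable {T : H →L[ℂ] H}

lemma genOp_inner (hT : IsUnitOp T) (h : ℝ) (f g : H) :
    inner ℂ (genOp T h f) g = inner ℂ f (genOp T h g) := by
  simp only [genOp_apply, inner_add_left, inner_add_right, inner_smul_left, inner_smul_right,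
    inner_sub_left, inner_sub_right, hT.inner_apply, Complex.conj_ofReal]

lemma re_inner_genOp (h : ℝ) (f : H) :
    (inner ℂ f (genOp T h f)).re = ‖f‖ ^ 2 + h⁻¹ * (‖f‖ ^ 2 - (inner ℂ f (T f)).re) := by
  rw [genOp_apply, inner_add_right, inner_smul_right, inner_sub_right, Complex.add_re,
    Complex.re_ofReal_mul, Complex.sub_re, inner_self_re]

lemma norm_sq_le_genOp (hT : IsUnitOp T) {h : ℝ} (hh : 0 < h) (f : H) :
    ‖f‖ ^ 2 ≤ (inner ℂ f (genOp T h f)).re := by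
  rw [re_inner_genOp]
  have := mul_nonneg (inv_pos.2 hh).le (sub_nonneg.2 (hT.le_one f))
  linarith

lemma genOp_resolvent (hT : IsUnitOp T) {h : ℝ} (hh : 0 < h) (f : H) :
    genOp T h (resolvent T h f) = f := by
  have hsa := hT.isSelfAdjoint
  have hc := (continuousOn_resolventFun hh).mono hT.spectrum_subset
  have hh' : (h : ℂ) ≠ 0 := by exact_mod_cast hh.ne'
  have h1 : T * resolvent T h = (h + 1) • resolvent T h - h • (1 : H →L[ℂ] H) := by
    have e1 : T * resolvent T h = cfc (fun s => s * (h / (h + 1 - s))) T := by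
      rw [resolvent, cfc_mul (fun s : ℝ => s) _ T (by fun_prop) hc, cfc_id' ℝ T]
    have e2 : (h + 1) • resolvent T h - h • (1 : H →L[ℂ] H) =
        cfc (fun s => (h + 1) * (h / (h + 1 - s)) - h) T := by
      rw [cfc_sub _ _ T (by fun_prop) (by fun_prop), cfc_const_mul _ _ T hc, cfc_const h T,
        Algebra.algebraMap_eq_smul_one]
      rfl
    rw [e1, e2]
    refine cfc_congr fun s hs => ?_
    have := (hT.spectrum_subset hs).2
    have : h + 1 - s ≠ 0 := by
      have : 0 < h + 1 - s := by linarith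
      exact this.ne'
    field_simp
    ring
  have h2 : T (resolvent T h f) = (h + 1) • resolvent T h f - h • f := by
    have := congrArg (fun S : H →L[ℂ] H => S f) h1
    simpa using this
  rw [genOp_apply, h2]
  have e : resolvent T h f - ((h + 1) • resolvent T h f - h • f) =
      (h : ℂ) • (f - resolvent T h f) := by
    rw [Complex.coe_smul]
    module
  rw [e, smul_smul, Complex.ofReal_inv, inv_mul_cancel₀ hh', one_smul]
  abel

lemma isSelfAdjoint_resolvent (h : ℝ) : IsSelfAdjoint (resolvent T h) := cfc_predicate _ _

lemma norm_resolvent_le (hT : IsUnitOp T) {h : ℝ} (hh : 0 < h) : ‖resolvent T h‖ ≤ 1 :=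
  hT.norm_cfc_le zero_le_one fun s hs => by
    have := resolventFun_mem hh hs
    rw [abs_of_pos this.1]
    exact this.2

lemma isUnitOp_resolvent (hT : IsUnitOp T) {h : ℝ} (hh : 0 < h) : IsUnitOp (resolvent T h) where
  isSelfAdjoint := isSelfAdjoint_resolvent h
  nonneg f := by
    have h1 := hT.norm_sq_le_genOp hh (resolvent T h f)
    rw [hT.genOp_resolvent hh, inner_re_comm] at h1
    exact (sq_nonneg _).trans h1
  le_one f := by
    have h1 : ‖resolvent T h f‖ ≤ ‖f‖ := by
      simpa using (resolvent T h).le_of_opNorm_le (hT.norm_resolvent_le hh) f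
    calc (inner ℂ f (resolvent T h f)).re ≤ ‖inner ℂ f (resolvent T h f)‖ := Complex.re_le_norm _
      _ ≤ ‖f‖ * ‖resolvent T h f‖ := norm_inner_le_norm _ _
      _ ≤ ‖f‖ ^ 2 := by rw [sq]; gcongr

/-- Smoothing effect of the powers of `T`. -/
lemma energy_pow_le (hT : IsUnitOp T) {h : ℝ} (hh : 0 < h) (m : ℕ) (f : H) :
    (inner ℂ ((T ^ m) f) (genOp T h ((T ^ m) f))).re ≤ ‖f‖ ^ 2 * (1 + 1 / (h * (m + 1))) := by
  have hsa := hT.isSelfAdjoint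
  -- The form of `1 - T` at `T^m f` is the form of `(1 - T)T^(2m)` at `f`, and the latter operator
  -- is small by `one_sub_mul_pow_le`.
  have h1 : ‖(1 - T) * T ^ (2 * m)‖ ≤ 1 / (m + 1) := by
    have : (1 - T) * T ^ (2 * m) = cfc (fun s : ℝ => (1 - s) * s ^ (2 * m)) T := by
      rw [cfc_mul (fun s : ℝ => 1 - s) _ T (by fun_prop) (by fun_prop),
        cfc_sub (fun _ : ℝ => (1 : ℝ)) (fun s : ℝ => s) T, cfc_const_one ℝ T, cfc_id' ℝ T,
        cfc_pow_id T]
    rw [this]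
    refine hT.norm_cfc_le (by positivity) fun s hs => ?_
    rw [abs_of_nonneg (mul_nonneg (by linarith [hs.2]) (pow_nonneg hs.1 _))]
    refine (one_sub_mul_pow_le hs.1 hs.2 (2 * m)).trans ?_
    gcongr
    have : (0 : ℝ) ≤ m := m.cast_nonneg
    linarith
  have h2 : ‖(T ^ m) f‖ ^ 2 - (inner ℂ ((T ^ m) f) (T ((T ^ m) f))).re =
      (inner ℂ f (((1 - T) * T ^ (2 * m)) f)).re := by
    have e : ((1 - T) * T ^ (2 * m)) f = (T ^ m) ((T ^ m) f) - (T ^ m) (T ((T ^ m) f)) := by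
      rw [← mul_apply_eq_comp, ← mul_apply_eq_comp, ← mul_apply_eq_comp, ← sub_apply]
      congr 1
      rw [sub_mul, one_mul, two_mul, pow_add, ← mul_assoc, ← pow_succ', ← pow_succ]
    rw [e, inner_sub_right, ← hT.inner_pow_apply m f ((T ^ m) f),
      ← hT.inner_pow_apply m f (T ((T ^ m) f)), Complex.sub_re, inner_self_re]
  rw [re_inner_genOp, h2]
  have h3 : (inner ℂ f (((1 - T) * T ^ (2 * m)) f)).re ≤ ‖f‖ ^ 2 * (1 / (m + 1)) := by
    refine (Complex.re_le_norm _).trans ((norm_inner_le_norm _ _).trans ?_)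
    have := ((1 - T) * T ^ (2 * m)).le_of_opNorm_le h1 f
    calc ‖f‖ * ‖((1 - T) * T ^ (2 * m)) f‖ ≤ ‖f‖ * (1 / (m + 1) * ‖f‖) := by gcongr
      _ = _ := by ring
  have h4 : ‖(T ^ m) f‖ ^ 2 ≤ ‖f‖ ^ 2 := by
    gcongr
    exact hT.norm_pow_apply_le m f
  calc ‖(T ^ m) f‖ ^ 2 + h⁻¹ * (inner ℂ f (((1 - T) * T ^ (2 * m)) f)).re
      ≤ ‖f‖ ^ 2 + h⁻¹ * (‖f‖ ^ 2 * (1 / (m + 1))) := by gcongr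
    _ = _ := by field_simp

end IsUnitOp

/-! ### Strong limits -/

lemma tendsto_apply_of_strong {A : ℕ → H →L[ℂ] H} {B : H →L[ℂ] H} {C : ℝ} (hA : ∀ n, ‖A n‖ ≤ C)
    (h : ∀ f, Tendsto (fun n => A n f) atTop (𝓝 (B f))) {f : ℕ → H} {g : H}
    (hf : Tendsto f atTop (𝓝 g)) : Tendsto (fun n => A n (f n)) atTop (𝓝 (B g)) := by
  have h1 : Tendsto (fun n => A n (f n - g)) atTop (𝓝 0) := by
    refine squeeze_zero_norm (a := fun n => C * ‖f n - g‖) (fun n => ?_) ?_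
    · exact (A n).le_of_opNorm_le (hA n) _
    · have := (hf.sub_const g).norm.const_mul C
      simpa using this
  have h2 := h1.add (h g)
  simpa using h2

lemma tendsto_pow_apply {A : ℕ → H →L[ℂ] H} {B : H →L[ℂ] H} (hA : ∀ n, ‖A n‖ ≤ 1)
    (h : ∀ f, Tendsto (fun n => A n f) atTop (𝓝 (B f))) (k : ℕ) (f : H) :
    Tendsto (fun n => (A n ^ k) f) atTop (𝓝 ((B ^ k) f)) := by
  induction k with
  | zero => simp
  | succ k ih =>
    simp only [pow_succ', mul_apply_eq_comp]
    exact tendsto_apply_of_strong hA h ih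

lemma tendsto_aeval_apply {A : ℕ → H →L[ℂ] H} {B : H →L[ℂ] H} (hA : ∀ n, ‖A n‖ ≤ 1)
    (h : ∀ f, Tendsto (fun n => A n f) atTop (𝓝 (B f))) (p : Polynomial ℝ) (f : H) :
    Tendsto (fun n => Polynomial.aeval (A n) p f) atTop (𝓝 (Polynomial.aeval B p f)) := by
  induction p using Polynomial.induction_on' with
  | add p q hp hq =>
    simp only [map_add, add_apply]
    exact hp.add hq
  | monomial k c =>
    simp only [Polynomial.aeval_monomial, mul_apply_eq_comp, Algebra.algebraMap_eq_smul_one,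
      smul_apply, one_apply_eq_self]
    exact (tendsto_pow_apply hA h k f).const_smul c

/-- Continuous functions of self-adjoint contractions are strongly continuous. -/
lemma tendsto_cfc_apply {A : ℕ → H →L[ℂ] H} {B : H →L[ℂ] H} (hA : ∀ n, IsUnitOp (A n))
    (hB : IsUnitOp B) (h : ∀ f, Tendsto (fun n => A n f) atTop (𝓝 (B f))) {F : ℝ → ℝ}
    (hF : ContinuousOn F (Set.Icc 0 1)) (f : H) :
    Tendsto (fun n => cfc F (A n) f) atTop (𝓝 (cfc F B f)) := by
  rw [Metric.tendsto_atTop]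
  intro ε hε
  set δ := ε / (3 * (‖f‖ + 1)) with hδ
  have hδ0 : 0 < δ := by positivity
  -- Weierstrass approximation on an interval containing all the spectra: the error is uniform in
  -- `n`, and for polynomials strong convergence is algebraic.
  obtain ⟨p, hp⟩ := exists_polynomial_near_of_continuousOn 0 1 F hF δ hδ0
  have hclose : ∀ X : H →L[ℂ] H, IsUnitOp X → ‖cfc F X f - Polynomial.aeval X p f‖ < ε / 3 := by
    intro X hX
    have hsa := hX.isSelfAdjoint
    have h1 : ‖cfc F X - Polynomial.aeval X p‖ ≤ δ := by
      rw [← cfc_polynomial p X, ← cfc_sub _ _ X (hF.mono hX.spectrum_subset) (by fun_prop)]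
      refine hX.norm_cfc_le hδ0.le fun s hs => ?_
      rw [abs_sub_comm]
      exact (hp s hs).le
    have h2 := (cfc F X - Polynomial.aeval X p).le_of_opNorm_le h1 f
    rw [sub_apply] at h2
    refine h2.trans_lt ?_
    rw [hδ, div_mul_eq_mul_div, div_lt_div_iff₀ (by positivity) (by positivity)]
    nlinarith [norm_nonneg f]
  obtain ⟨n₀, hn₀⟩ := (Metric.tendsto_atTop.1
    (tendsto_aeval_apply (fun n => (hA n).norm_le_one) h p f)) (ε / 3) (by positivity)
  refine ⟨n₀, fun n hn => ?_⟩
  have h1 := hclose (A n) (hA n)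
  have h2 := hn₀ n hn
  have h3 := hclose B hB
  rw [dist_eq_norm] at h2 ⊢
  have e : cfc F (A n) f - cfc F B f = (cfc F (A n) f - Polynomial.aeval (A n) p f) +
      (Polynomial.aeval (A n) p f - Polynomial.aeval B p f) -
      (cfc F B f - Polynomial.aeval B p f) := by abel
  rw [e]
  refine (norm_sub_le _ _).trans_lt ?_
  have := norm_add_le (cfc F (A n) f - Polynomial.aeval (A n) p f)
    (Polynomial.aeval (A n) p f - Polynomial.aeval B p f)
  linarith

/-- A sequence of generators `h_n⁻¹ (1 - T_n)` with increasing quadratic forms has a limit in the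
strong resolvent sense. -/
lemma exists_strong_resolvent_limit {T : ℕ → H →L[ℂ] H} {h : ℕ → ℝ} (hT : ∀ n, IsUnitOp (T n))
    (hh : ∀ n, 0 < h n)
    (hmono : ∀ n m, n ≤ m → ∀ f,
      (inner ℂ f (genOp (T n) (h n) f)).re ≤ (inner ℂ f (genOp (T m) (h m) f)).re) :
    ∃ R : H →L[ℂ] H, IsUnitOp R ∧
      (∀ f, Tendsto (fun n => resolvent (T n) (h n) f) atTop (𝓝 (R f))) ∧
      ∀ n f, (inner ℂ (R f) (genOp (T n) (h n) (R f))).re ≤ (inner ℂ f (R f)).re := by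
  set F : ℕ → H →L[ℂ] H := fun n => resolvent (T n) (h n) with hF
  have hB : ∀ n f, genOp (T n) (h n) (F n f) = f := fun n f => (hT n).genOp_resolvent (hh n) f
  have hU : ∀ n, IsUnitOp (F n) := fun n => (hT n).isUnitOp_resolvent (hh n)
  -- With `B_n = genOp (T n) (h n) ≥ 1`, expand the form of `B_n` at `F n f - F m f`. The terms with
  -- `F n f` simplify by `B_n (F n f) = f`, and the form of `B_n` at `F m f` is at most that of
  -- `B_m`, which is `⟨f, F m f⟩`.
  have key : ∀ n m, n ≤ m → ∀ f, ‖F n f - F m f‖ ^ 2 ≤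
      (inner ℂ f (F n f)).re - (inner ℂ f (F m f)).re := by
    intro n m hnm f
    have h1 := (hT n).norm_sq_le_genOp (hh n) (F n f - F m f)
    have h2 := hmono n m hnm (F m f)
    rw [hB m] at h2
    have h3 : inner ℂ (F n f) (genOp (T n) (h n) (F m f)) = inner ℂ f (F m f) := by
      rw [← (hT n).genOp_inner, hB n]
    rw [map_sub, inner_sub_left, inner_sub_right, inner_sub_right, hB n, h3] at h1
    simp only [Complex.sub_re] at h1
    rw [inner_re_comm (F n f) f, inner_re_comm (F m f) f] at h1
    rw [inner_re_comm (F m f) f] at h2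
    linarith
  have hconv : ∀ f, ∃ g, Tendsto (fun n => F n f) atTop (𝓝 g) := by
    intro f
    refine cauchySeq_tendsto_of_complete ?_
    -- These numbers decrease and are nonnegative, so they converge; `key` then makes `F n f` a
    -- Cauchy sequence.
    set r : ℕ → ℝ := fun n => (inner ℂ f (F n f)).re
    have hr : Antitone r := fun n m hnm => by
      have := key n m hnm f
      have h0 := sq_nonneg ‖F n f - F m f‖
      linarith
    have hr0 : BddBelow (Set.range r) := ⟨0, by rintro _ ⟨n, rfl⟩; exact (hU n).nonneg f⟩
    have hlim := tendsto_atTop_ciInf hr hr0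
    rw [Metric.cauchySeq_iff']
    intro ε hε
    obtain ⟨n₀, hn₀⟩ := (Metric.tendsto_atTop.1 hlim) (ε ^ 2) (by positivity)
    refine ⟨n₀, fun n hn => ?_⟩
    have h1 := hn₀ n₀ le_rfl
    have h2 := ciInf_le hr0 n
    rw [Real.dist_eq] at h1
    have h3 := (abs_lt.1 h1).2
    have h4 := key n₀ n hn f
    rw [dist_comm, dist_eq_norm]
    refine lt_of_pow_lt_pow_left₀ 2 hε.le ?_
    change r n₀ - _ < _ at h3
    change _ ≤ r n at h2
    change _ ≤ r n₀ - r n at h4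
    linarith
  choose G hG using hconv
  have hG' : Tendsto (fun n f => F n f) atTop (𝓝 G) := tendsto_pi_nhds.2 hG
  set R : H →L[ℂ] H := continuousLinearMapOfTendsto F hG'
  have hR : ∀ f, Tendsto (fun n => F n f) atTop (𝓝 (R f)) := hG
  have hre : ∀ f, Tendsto (fun n => (inner ℂ f (F n f)).re) atTop (𝓝 (inner ℂ f (R f)).re) :=
    fun f => (Complex.continuous_re.tendsto _).comp (tendsto_const_nhds.inner (hR f))
  refine ⟨R, ⟨?_, fun f => ?_, fun f => ?_⟩, hR, fun n f => ?_⟩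
  · rw [ContinuousLinearMap.isSelfAdjoint_iff_isSymmetric]
    intro f g
    change inner ℂ (R f) g = inner ℂ f (R g)
    refine tendsto_nhds_unique ((hR f).inner tendsto_const_nhds) ?_
    refine (tendsto_const_nhds.inner (hR g)).congr fun n => ?_
    exact ((hU n).inner_apply f g).symm
  · exact ge_of_tendsto' (hre f) fun n => (hU n).nonneg f
  · exact le_of_tendsto' (hre f) fun n => (hU n).le_one f
  -- For fixed `n` let `m → ∞` in: the `n`-th form at `F m f` is at most the `m`-th form there,
  -- which equals `⟨f, F m f⟩`.
  · have h1 : Tendsto (fun m => (inner ℂ (F m f) (genOp (T n) (h n) (F m f))).re) atTop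
        (𝓝 (inner ℂ (R f) (genOp (T n) (h n) (R f))).re) :=
      (Complex.continuous_re.tendsto _).comp ((hR f).inner
        (((genOp (T n) (h n)).continuous.tendsto _).comp (hR f)))
    refine le_of_tendsto_of_tendsto h1 (hre f) ?_
    filter_upwards [eventually_ge_atTop n] with m hm
    have h2 := hmono n m hm (F m f)
    rwa [hB m, inner_re_comm (F m f) f] at h2

/-! ### The semigroup generated by a resolvent -/

/-- The operator `(1 + A)^k exp (-tA)`, where `R = (1 + A)⁻¹`. -/
def heatOp (R : H →L[ℂ] H) (k : ℕ) (t : ℝ) : H →L[ℂ] H := cfc (heatFun k t) R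

namespace IsUnitOp

variable {R : H →L[ℂ] H}

/-- For `t > 0` the semigroup maps into the range of `R`, which is what gives its values finite
energy and hence point evaluations. -/
lemma apply_heatOp_succ (hR : IsUnitOp R) (k : ℕ) {t : ℝ} (ht : 0 < t) (f : H) :
    R (heatOp R (k + 1) t f) = heatOp R k t f := by
  have hsa := hR.isSelfAdjoint
  have : R * heatOp R (k + 1) t = heatOp R k t := by
    have e : heatOp R k t = cfc (fun r => r * heatFun (k + 1) t r) R :=
      cfc_congr fun r _ => (mul_heatFun_succ k t r).symm
    rw [e, cfc_mul (fun r : ℝ => r) _ R (by fun_prop) (continuous_heatFun _ ht).continuousOn,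
      cfc_id' ℝ R]
    rfl
  rw [← this, mul_apply_eq_comp]

lemma heatOp_apply_comm (hR : IsUnitOp R) (k : ℕ) (t : ℝ) (f : H) :
    heatOp R k t (R f) = R (heatOp R k t f) := by
  have hsa := hR.isSelfAdjoint
  have := cfc_commute_cfc (heatFun k t) (fun r : ℝ => r) R
  rw [cfc_id' ℝ R] at this
  have h := congrArg (fun S : H →L[ℂ] H => S f) this
  simpa [heatOp] using h

lemma norm_heatOp_zero_le (hR : IsUnitOp R) {t : ℝ} (ht : 0 ≤ t) : ‖heatOp R 0 t‖ ≤ 1 :=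
  hR.norm_cfc_le zero_le_one fun r hr => by
    rw [abs_of_nonneg (heatFun_nonneg _ _ _)]
    exact heatFun_zero_le_one ht hr.2

/-- The scalar Taylor estimate is uniform on the spectrum, so the derivative exists even in operator
norm away from `t = 0`. -/
lemma hasDerivAt_heatOp (hR : IsUnitOp R) (k : ℕ) {t : ℝ} (ht : 0 < t) :
    HasDerivAt (heatOp R k) (heatOp R k t - heatOp R (k + 1) t) t := by
  have hsa := hR.isSelfAdjoint
  rw [hasDerivAt_iff_isLittleO_nhds_zero]
  set C := Real.exp (t / 2) * (k + 2).factorial / (t / 2) ^ (k + 2)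
  have h1 : (fun δ : ℝ => heatOp R k (t + δ) - heatOp R k t -
      δ • (heatOp R k t - heatOp R (k + 1) t)) =O[𝓝 0] fun δ : ℝ => δ ^ 2 := by
    refine Asymptotics.IsBigO.of_bound C ?_
    have : Set.Ioo (-(t / 2)) (t / 2) ∈ 𝓝 (0 : ℝ) := Ioo_mem_nhds (by linarith) (by linarith)
    filter_upwards [this] with δ hδ
    have hδ' : |δ| ≤ t / 2 := abs_le.2 ⟨hδ.1.le, hδ.2.le⟩
    have hcont : ∀ j, ∀ s : ℝ, 0 < s → ContinuousOn (heatFun j s) (spectrum ℝ R) := fun j s hs =>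
      (continuous_heatFun j hs).continuousOn
    have hts : 0 < t + δ := by linarith [hδ.1]
    have e : heatOp R k (t + δ) - heatOp R k t - δ • (heatOp R k t - heatOp R (k + 1) t) =
        cfc (fun r => heatFun k (t + δ) r - heatFun k t r -
          δ * (heatFun k t r - heatFun (k + 1) t r)) R := by
      have c1 := hcont k t ht
      have c2 := hcont (k + 1) t ht
      have c3 := hcont k (t + δ) hts
      rw [cfc_sub (fun r => heatFun k (t + δ) r - heatFun k t r)
          (fun r => δ * (heatFun k t r - heatFun (k + 1) t r)) R (c3.sub c1)
          ((c1.sub c2).const_mul δ), cfc_sub _ _ R c3 c1,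
        cfc_const_mul δ (fun r => heatFun k t r - heatFun (k + 1) t r) R (c1.sub c2),
        cfc_sub _ _ R c1 c2]
      rfl
    rw [e, Real.norm_of_nonneg (sq_nonneg δ), mul_comm]
    exact hR.norm_cfc_le (by positivity) fun r hr => heatFun_taylor k ht hδ' hr.2
  exact h1.trans_isLittleO (Asymptotics.isLittleO_pow_id one_lt_two)

lemma hasDerivAt_heatOp_apply (hR : IsUnitOp R) (k : ℕ) {t : ℝ} (ht : 0 < t) (f : H) :
    HasDerivAt (fun t => heatOp R k t f) (heatOp R k t f - heatOp R (k + 1) t f) t := by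
  exact ((ContinuousLinearMap.apply ℂ H f).restrictScalars ℝ).hasFDerivAt.comp_hasDerivAt t
    (hR.hasDerivAt_heatOp k ht)

/-- Strong continuity of the semigroup at time zero. -/
lemma tendsto_heatOp_zero (hR : IsUnitOp R) (hdense : DenseRange R) (f : H) :
    Tendsto (fun t => heatOp R 0 t f) (𝓝[>] 0) (𝓝 f) := by
  have hsa := hR.isSelfAdjoint
  -- On the range of `R` the convergence has a rate: `r(1 - exp (-t(1/r - 1))) ≤ t(1 - r) ≤ t`.
  -- Density of the range and contractivity extend it to all vectors, without a rate.
  have h1 : ∀ t : ℝ, 0 < t → ‖heatOp R 0 t * R - R‖ ≤ t := by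
    intro t ht
    have e : heatOp R 0 t * R - R = cfc (fun r => heatFun 0 t r * r - r) R := by
      have c := (continuous_heatFun 0 ht).continuousOn (s := spectrum ℝ R)
      rw [cfc_sub _ (fun r : ℝ => r) R (by fun_prop) (by fun_prop),
        cfc_mul _ (fun r : ℝ => r) R c (by fun_prop), cfc_id' ℝ R]
      rfl
    rw [e]
    refine hR.norm_cfc_le ht.le fun r hr => ?_
    rcases hr.1.eq_or_lt with rfl | h0
    · simpa using ht.le
    · have h2 := heatFun_zero_le_one ht.le hr.2
      have h3 : 1 - t * (r⁻¹ - 1) ≤ heatFun 0 t r := by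
        rw [heatFun_of_pos 0 t h0, pow_zero, one_mul]
        have := Real.add_one_le_exp (-t * (r⁻¹ - 1))
        linarith
      have h4 : r * r⁻¹ = 1 := mul_inv_cancel₀ h0.ne'
      rw [abs_le]
      constructor <;> nlinarith [hr.2]
  rw [Metric.tendsto_nhds]
  intro ε hε
  obtain ⟨g, hg⟩ := (Metric.denseRange_iff.1 hdense) f (ε / 3) (by positivity)
  rw [dist_eq_norm] at hg
  have hδ : 0 < ε / (3 * (‖g‖ + 1)) := by positivity
  filter_upwards [Ioo_mem_nhdsGT hδ] with t ht
  have h2 := (heatOp R 0 t * R - R).le_of_opNorm_le (h1 t ht.1) g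
  have h3 := (heatOp R 0 t).le_of_opNorm_le (hR.norm_heatOp_zero_le ht.1.le) (f - R g)
  rw [one_mul, map_sub] at h3
  rw [sub_apply, mul_apply_eq_comp] at h2
  have h4 : t * ‖g‖ < ε / 3 := by
    have := (lt_div_iff₀ (by positivity)).1 ht.2
    nlinarith [norm_nonneg g, ht.1]
  have e : heatOp R 0 t f - f = (heatOp R 0 t f - heatOp R 0 t (R g)) +
      (heatOp R 0 t (R g) - R g) - (f - R g) := by abel
  rw [dist_eq_norm, e]
  refine (norm_sub_le _ _).trans_lt ?_
  have := norm_add_le (heatOp R 0 t f - heatOp R 0 t (R g)) (heatOp R 0 t (R g) - R g)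
  linarith

end IsUnitOp

/-- Powers of the transition operators converge to the semigroup. -/
lemma tendsto_pow_heatOp {T : ℕ → H →L[ℂ] H} {h : ℕ → ℝ} (hT : ∀ n, IsUnitOp (T n))
    (hh : ∀ n, 0 < h n) (hh0 : Tendsto h atTop (𝓝 0)) {R : H →L[ℂ] H} (hR : IsUnitOp R)
    (hlim : ∀ f, Tendsto (fun n => resolvent (T n) (h n) f) atTop (𝓝 (R f)))
    {t : ℝ} (ht : 0 < t) {m : ℕ → ℕ} (hm : Tendsto (fun n => m n * h n) atTop (𝓝 t)) (f : H) :
    Tendsto (fun n => (T n ^ m n) f) atTop (𝓝 (heatOp R 0 t f)) := by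
  have h1 : Tendsto (fun n => heatOp (resolvent (T n) (h n)) 0 t f) atTop
      (𝓝 (heatOp R 0 t f)) :=
    tendsto_cfc_apply (fun n => (hT n).isUnitOp_resolvent (hh n)) hR hlim
      (continuous_heatFun 0 ht).continuousOn f
  -- A bound uniform in `s ∈ [0, 1]`: the first summand is `2/m`, the cost of replacing `s^m` by
  -- `exp (-m(1 - s))`; the second is the cost of replacing the exponent `m` by `t/h`.
  set e : ℕ → ℝ := fun n => 2 * h n / (m n * h n) + |t - m n * h n| / min (m n * h n) t with he
  have he0 : Tendsto e atTop (𝓝 0) := by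
    have a1 : Tendsto (fun n => 2 * h n / (m n * h n)) atTop (𝓝 (2 * 0 / t)) :=
      (hh0.const_mul 2).div hm ht.ne'
    have a2 : Tendsto (fun n => |t - m n * h n| / min (m n * h n) t) atTop
        (𝓝 (|t - t| / min t t)) :=
      (hm.const_sub t).abs.div (hm.min tendsto_const_nhds) (by simpa using ht.ne')
    simpa using a1.add a2
  have h2 : Tendsto (fun n => (T n ^ m n) f - heatOp (resolvent (T n) (h n)) 0 t f) atTop
      (𝓝 0) := by
    refine squeeze_zero_norm' (a := fun n => e n * ‖f‖) ?_ (by simpa using he0.mul_const ‖f‖)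
    filter_upwards [hm.eventually (lt_mem_nhds ht)] with n hn
    have hmn : 0 < m n := by
      rcases Nat.eq_zero_or_pos (m n) with h0 | h0
      · simp [h0] at hn
      · exact h0
    have hmn' : (0 : ℝ) < m n := by exact_mod_cast hmn
    have hhn := hh n
    have hsa := (hT n).isSelfAdjoint
    -- Both operators are functions of the same `T n`; the heat function composed with the resolvent
    -- function is `exp (-(t/h)(1 - s))`.
    have e1 : T n ^ m n - heatOp (resolvent (T n) (h n)) 0 t =
        cfc (fun s => s ^ m n - heatFun 0 t (h n / (h n + 1 - s))) (T n) := by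
      have c1 := (continuousOn_resolventFun hhn).mono (hT n).spectrum_subset
      have c2 : ContinuousOn (fun s => heatFun 0 t (h n / (h n + 1 - s))) (spectrum ℝ (T n)) :=
        (continuous_heatFun 0 ht).comp_continuousOn c1
      rw [cfc_sub _ _ (T n) (by fun_prop) c2, cfc_pow_id (T n)]
      congr 1
      exact (cfc_comp (heatFun 0 t) _ (T n) hsa (continuous_heatFun 0 ht).continuousOn c1).symm
    rw [← sub_apply, e1]
    refine ContinuousLinearMap.le_of_opNorm_le _ ((hT n).norm_cfc_le ?_ fun s hs => ?_) f
    · have : 0 < min (m n * h n) t := lt_min hn ht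
      positivity
    · have hs1 : 0 ≤ 1 - s := by linarith [hs.2]
      have e2 : heatFun 0 t (h n / (h n + 1 - s)) = Real.exp (-(t / h n * (1 - s))) := by
        rw [heatFun_of_pos 0 t (resolventFun_mem hhn hs).1, pow_zero, one_mul, inv_div]
        congr 1
        field_simp
        ring
      rw [e2]
      have b1 := abs_pow_sub_exp_le hs.1 hs.2 hmn
      have b2 := abs_exp_neg_sub_le hmn' (div_pos ht hhn) hs1
      have e3 : (2 : ℝ) / m n = 2 * h n / (m n * h n) := by field_simp
      have e4 : |t / h n - m n| / min (m n : ℝ) (t / h n) =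
          |t - m n * h n| / min (m n * h n) t := by
        have a1 : t - m n * h n = (t / h n - m n) * h n := by field_simp
        have a2 : min (m n * h n) t = min (m n : ℝ) (t / h n) * h n := by
          rw [min_mul_of_nonneg _ _ hhn.le, div_mul_cancel₀ _ hhn.ne']
        rw [a1, a2, abs_mul, abs_of_pos hhn, mul_div_mul_right _ _ hhn.ne']
      rw [e3] at b1
      rw [e4] at b2
      exact (abs_sub_le _ _ _).trans (add_le_add b1 b2)
  have h3 := h2.add h1
  simpa using h3

end Hilbert

end PseudoBM

namespace PseudoBM

open ComplexConjugate

variable {a b : ℝ}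

/-! ### The energy space -/

lemma integral_mul_sq_le {F G : ℝ → ℝ} {μ : Measure ℝ} (hF : AEStronglyMeasurable F μ)
    (hG : AEStronglyMeasurable G μ) (hF2 : Integrable (fun u => F u ^ 2) μ)
    (hG2 : Integrable (fun u => G u ^ 2) μ) :
    Integrable (fun u => F u * G u) μ ∧
      (∫ u, F u * G u ∂μ) ^ 2 ≤ (∫ u, F u ^ 2 ∂μ) * ∫ u, G u ^ 2 ∂μ := by
  have hint : Integrable (fun u => F u * G u) μ :=
    ((memLp_two_iff_integrable_sq hF).2 hF2).integrable_mul ((memLp_two_iff_integrable_sq hG).2 hG2)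
  refine ⟨hint, ?_⟩
  have h := discrim_le_zero (a := ∫ u, G u ^ 2 ∂μ) (b := -2 * ∫ u, F u * G u ∂μ)
    (c := ∫ u, F u ^ 2 ∂μ) fun s => by
      have e : (∫ u, G u ^ 2 ∂μ) * (s * s) + (-2 * ∫ u, F u * G u ∂μ) * s + ∫ u, F u ^ 2 ∂μ =
          ∫ u, (F u - s * G u) ^ 2 ∂μ := by
        have : ∀ u, (F u - s * G u) ^ 2 = (s * s) * G u ^ 2 + (-2 * s) * (F u * G u) + F u ^ 2 :=
          fun u => by ring
        simp only [this]
        rw [integral_add ((hG2.const_mul _).fun_add (hint.const_mul _)) hF2,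
          integral_add (hG2.const_mul _) (hint.const_mul _), integral_const_mul,
          integral_const_mul]
        ring
      rw [e]
      exact integral_nonneg fun u => sq_nonneg _
  rw [discrim] at h
  nlinarith

/-- The constant in the one-dimensional Sobolev inequality. -/
def sobolevConst : ℝ := 4 * (∫ u : ℝ, (1 + u ^ 2)⁻¹ ∂freqMeasure) ^ 2

lemma sobolevConst_nonneg : 0 ≤ sobolevConst := by unfold sobolevConst; positivity

/-- Cauchy–Schwarz twice: the weight `(1 + u²)^(-1/2)` bounds `∫ |D|` by `∫ (1 + u²)|D|²`, which is
split as `|D|` times `(1 + u²)|D|`; and `(1 + u²)² ≤ 4(1 + u^(2N))` because `N ≥ 2`. The `L²` norm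
stays as a separate factor, so that convergence in `L²` with bounded energy implies convergence of
the Fourier integrals. -/
lemma integral_norm_pow_four_le {N : ℕ} (hN : 2 ≤ N) {D : ℝ → ℂ}
    (hD : AEStronglyMeasurable D freqMeasure)
    (hE : Integrable (fun u => (1 + u ^ (2 * N)) * ‖D u‖ ^ 2) freqMeasure) :
    Integrable D freqMeasure ∧ (∫ u, ‖D u‖ ∂freqMeasure) ^ 4 ≤
      sobolevConst * ((∫ u, ‖D u‖ ^ 2 ∂freqMeasure) *
        ∫ u, (1 + u ^ (2 * N)) * ‖D u‖ ^ 2 ∂freqMeasure) := by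
  have hpoly : ∀ u : ℝ, (1 + u ^ 2) ^ 2 ≤ 4 * (1 + u ^ (2 * N)) := fun u => by
    have h1 : (u ^ 2) ^ 2 - 1 ≤ u ^ (2 * N) := by
      rw [pow_mul]
      rcases le_total (u ^ 2) 1 with h | h
      · have h2 := pow_nonneg (sq_nonneg u) N
        have h3 : (u ^ 2) ^ 2 ≤ 1 := pow_le_one₀ (sq_nonneg u) h
        linarith
      · have := pow_le_pow_right₀ h hN
        linarith
    have := even_pow_nonneg N u
    nlinarith [sq_nonneg (u ^ 2 - 1)]
  have hpoly1 : ∀ u : ℝ, 1 ≤ 1 + u ^ (2 * N) := fun u => by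
    have := even_pow_nonneg N u
    linarith
  have hn := hD.norm
  have hi0 : Integrable (fun u => ‖D u‖ ^ 2) freqMeasure :=
    hE.mono' (hn.pow 2) (Eventually.of_forall fun u => by
      rw [Real.norm_of_nonneg (sq_nonneg _)]
      exact le_mul_of_one_le_left (sq_nonneg _) (hpoly1 u))
  have hi2 : Integrable (fun u => ((1 + u ^ 2) * ‖D u‖) ^ 2) freqMeasure := by
    refine (hE.const_mul 4).mono' (((Continuous.aestronglyMeasurable (by fun_prop)).mul hn).pow 2)
      (Eventually.of_forall fun u => ?_)
    rw [Real.norm_of_nonneg (sq_nonneg _), mul_pow, ← mul_assoc]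
    exact mul_le_mul_of_nonneg_right (hpoly u) (sq_nonneg _)
  obtain ⟨h1i, h1⟩ := integral_mul_sq_le hn
    (G := fun u => (1 + u ^ 2) * ‖D u‖) ((Continuous.aestronglyMeasurable (by fun_prop)).mul hn)
    hi0 hi2
  have h1i' : Integrable (fun u => (Real.sqrt (1 + u ^ 2) * ‖D u‖) ^ 2) freqMeasure := by
    refine h1i.congr (Eventually.of_forall fun u => ?_)
    simp only
    rw [mul_pow, Real.sq_sqrt (by positivity)]
    ring
  have hw : Integrable (fun u : ℝ => ((Real.sqrt (1 + u ^ 2))⁻¹) ^ 2) freqMeasure := by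
    rw [integrable_freqMeasure]
    refine integrable_inv_one_add_sq.congr (Eventually.of_forall fun u => ?_)
    simp only
    rw [inv_pow, Real.sq_sqrt (by positivity)]
  obtain ⟨h2i, h2⟩ := integral_mul_sq_le
    (F := fun u : ℝ => (Real.sqrt (1 + u ^ 2))⁻¹) (G := fun u => Real.sqrt (1 + u ^ 2) * ‖D u‖)
    (Measurable.aestronglyMeasurable (by fun_prop))
    ((Continuous.aestronglyMeasurable (by fun_prop)).mul hn) hw h1i'
  have e : ∀ u : ℝ, (Real.sqrt (1 + u ^ 2))⁻¹ * (Real.sqrt (1 + u ^ 2) * ‖D u‖) = ‖D u‖ :=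
    fun u => inv_mul_cancel_left₀ (by positivity) _
  have h2i' : Integrable (fun u => ‖D u‖) freqMeasure :=
    h2i.congr (Eventually.of_forall e)
  rw [integral_congr_ae (Eventually.of_forall e)] at h2
  have e2 : ∫ u, (Real.sqrt (1 + u ^ 2) * ‖D u‖) ^ 2 ∂freqMeasure =
      ∫ u, ‖D u‖ * ((1 + u ^ 2) * ‖D u‖) ∂freqMeasure := by
    congr 1 with u
    rw [mul_pow, Real.sq_sqrt (by positivity)]
    ring
  have e3 : ∫ u : ℝ, ((Real.sqrt (1 + u ^ 2))⁻¹) ^ 2 ∂freqMeasure =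
      ∫ u : ℝ, (1 + u ^ 2)⁻¹ ∂freqMeasure := by
    congr 1 with u
    rw [inv_pow, Real.sq_sqrt (by positivity)]
  rw [e2, e3] at h2
  have h3 : ∫ u, ((1 + u ^ 2) * ‖D u‖) ^ 2 ∂freqMeasure ≤
      4 * ∫ u, (1 + u ^ (2 * N)) * ‖D u‖ ^ 2 ∂freqMeasure := by
    rw [← integral_const_mul]
    refine integral_mono hi2 (hE.const_mul 4) fun u => ?_
    rw [mul_pow, ← mul_assoc]
    exact mul_le_mul_of_nonneg_right (hpoly u) (sq_nonneg _)
  refine ⟨(integrable_norm_iff hD).1 h2i', ?_⟩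
  have p0 : 0 ≤ ∫ u, ‖D u‖ ^ 2 ∂freqMeasure := integral_nonneg fun u => sq_nonneg _
  calc (∫ u, ‖D u‖ ∂freqMeasure) ^ 4 = ((∫ u, ‖D u‖ ∂freqMeasure) ^ 2) ^ 2 := by ring
    _ ≤ ((∫ u : ℝ, (1 + u ^ 2)⁻¹ ∂freqMeasure) *
        ∫ u, ‖D u‖ * ((1 + u ^ 2) * ‖D u‖) ∂freqMeasure) ^ 2 := by gcongr
    _ = (∫ u : ℝ, (1 + u ^ 2)⁻¹ ∂freqMeasure) ^ 2 *
        (∫ u, ‖D u‖ * ((1 + u ^ 2) * ‖D u‖) ∂freqMeasure) ^ 2 := by ring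
    _ ≤ (∫ u : ℝ, (1 + u ^ 2)⁻¹ ∂freqMeasure) ^ 2 * ((∫ u, ‖D u‖ ^ 2 ∂freqMeasure) *
        (4 * ∫ u, (1 + u ^ (2 * N)) * ‖D u‖ ^ 2 ∂freqMeasure)) := by
      gcongr
      exact h1.trans (by gcongr)
    _ = _ := by unfold sobolevConst; ring

/-- The function `f ∈ L²(a, b)`, extended by zero, has `N` derivatives in `L²`. -/
def FiniteEnergy (N : ℕ) (f : L2 a b) : Prop :=
  Integrable (fun u => (1 + u ^ (2 * N)) * ‖ft f u‖ ^ 2) freqMeasure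

/-- The squared Sobolev norm of order `N`. -/
def energy (N : ℕ) (f : L2 a b) : ℝ := ∫ u, (1 + u ^ (2 * N)) * ‖ft f u‖ ^ 2 ∂freqMeasure

/-- The value at `x` of the continuous representative of `f`. -/
def evalAt (x : ℝ) (f : L2 a b) : ℂ :=
  ∫ u, Complex.exp (Complex.I * (u * x)) * ft f u ∂freqMeasure

lemma FiniteEnergy.integrable_ft {N : ℕ} (hN : 2 ≤ N) {f : L2 a b} (hf : FiniteEnergy N f) :
    Integrable (ft f) freqMeasure :=
  (integral_norm_pow_four_le hN (continuous_ft f).aestronglyMeasurable hf).1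

lemma norm_sq_le_energy {N : ℕ} {f : L2 a b} (hf : FiniteEnergy N f) : ‖f‖ ^ 2 ≤ energy N f := by
  rw [← (plancherel f).2]
  refine integral_mono (plancherel f).1 hf fun u => ?_
  have := even_pow_nonneg N u
  exact le_mul_of_one_le_left (sq_nonneg _) (by linarith)

lemma norm_evalAt_sq_le {N : ℕ} (hN : 2 ≤ N) {f : L2 a b} (hf : FiniteEnergy N f) (x : ℝ) :
    ‖evalAt x f‖ ^ 2 ≤ Real.sqrt sobolevConst * energy N f := by
  have h1 : ‖evalAt x f‖ ≤ ∫ u, ‖ft f u‖ ∂freqMeasure := by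
    refine (norm_integral_le_integral_norm _).trans (le_of_eq ?_)
    congr 1 with u
    rw [norm_mul, norm_exp_I_mul, one_mul]
  have h2 := (integral_norm_pow_four_le hN (continuous_ft f).aestronglyMeasurable hf).2
  have h3 : (∫ u, ‖ft f u‖ ^ 2 ∂freqMeasure) ≤ energy N f := by
    rw [(plancherel f).2]; exact norm_sq_le_energy hf
  have h4 : 0 ≤ energy N f := (sq_nonneg _).trans (norm_sq_le_energy hf)
  refine le_of_sq_le_sq ?_ (by positivity)
  have hc := sobolevConst_nonneg
  calc (‖evalAt x f‖ ^ 2) ^ 2 = ‖evalAt x f‖ ^ 4 := by ring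
    _ ≤ (∫ u, ‖ft f u‖ ∂freqMeasure) ^ 4 := by gcongr
    _ ≤ _ := h2
    _ ≤ sobolevConst * (energy N f * energy N f) := by gcongr; exact le_rfl
    _ = (Real.sqrt sobolevConst * energy N f) ^ 2 := by rw [mul_pow, Real.sq_sqrt hc]; ring

/-! ### The discrete generators -/

/-- The symbol of `1 + h⁻¹(1 - T)`. -/
def genSymbol (N : ℕ) (h u : ℝ) : ℝ := 1 + h⁻¹ * (1 - heatSymbol N h u)

lemma continuous_genSymbol (N : ℕ) (h : ℝ) : Continuous (genSymbol N h) := by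
  unfold genSymbol; fun_prop

lemma one_le_genSymbol {N : ℕ} {h : ℝ} (hh : 0 < h) (u : ℝ) : 1 ≤ genSymbol N h u := by
  have := mul_nonneg (inv_pos.2 hh).le (sub_nonneg.2 (heatSymbol_le_one (N := N) hh.le u))
  unfold genSymbol
  linarith

lemma genSymbol_le {N : ℕ} {h : ℝ} (hh : 0 < h) (u : ℝ) : genSymbol N h u ≤ 1 + u ^ (2 * N) := by
  have h1 := Real.add_one_le_exp (-h * u ^ (2 * N))
  unfold genSymbol
  gcongr
  rw [inv_mul_le_iff₀ hh, heatSymbol]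
  linarith

lemma genSymbol_le_const {N : ℕ} {h : ℝ} (hh : 0 < h) (u : ℝ) : ‖genSymbol N h u‖ ≤ 1 + h⁻¹ := by
  rw [Real.norm_of_nonneg (zero_le_one.trans (one_le_genSymbol hh u)), genSymbol]
  have h1 := heatSymbol_pos N h u
  have h2 : h⁻¹ * (1 - heatSymbol N h u) ≤ h⁻¹ * 1 := by gcongr; linarith
  linarith

/-- From `1 + x ≤ exp x` with `x = h u^(2N)`. After one more smoothing step the discrete energy
controls the true energy, uniformly in the mesh. -/
lemma heatSymbol_sq_mul_le {N : ℕ} {h : ℝ} (hh : 0 < h) (u : ℝ) :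
    (1 + u ^ (2 * N)) * heatSymbol N h u ^ 2 ≤ genSymbol N h u := by
  have h1 := Real.add_one_le_exp (h * u ^ (2 * N))
  have h0 := even_pow_nonneg N u
  have h2 : heatSymbol N h u * Real.exp (h * u ^ (2 * N)) = 1 := by
    rw [heatSymbol, ← Real.exp_add]; simp
  have h3 := heatSymbol_pos N h u
  have h4 := heatSymbol_le_one (N := N) hh.le u
  have h5 : h * u ^ (2 * N) * heatSymbol N h u ^ 2 ≤ 1 - heatSymbol N h u := by
    have : h * u ^ (2 * N) * heatSymbol N h u ≤ 1 - heatSymbol N h u := by nlinarith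
    have h6 : 0 ≤ h * u ^ (2 * N) * heatSymbol N h u := by positivity
    nlinarith
  have h6 : heatSymbol N h u ^ 2 ≤ 1 := pow_le_one₀ h3.le h4
  have h7 : u ^ (2 * N) * heatSymbol N h u ^ 2 ≤ h⁻¹ * (1 - heatSymbol N h u) := by
    rw [le_inv_mul_iff₀ hh]; linarith
  unfold genSymbol
  linarith

lemma one_sub_heatSymbol_sq_le {N : ℕ} {h : ℝ} (hh : 0 < h) (u : ℝ) :
    (1 - heatSymbol N h u) ^ 2 ≤ h * (1 + u ^ (2 * N)) := by
  have h1 := Real.add_one_le_exp (-h * u ^ (2 * N))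
  have h3 := heatSymbol_pos N h u
  have h4 := heatSymbol_le_one (N := N) hh.le u
  have h5 : heatSymbol N h u = Real.exp (-h * u ^ (2 * N)) := rfl
  nlinarith

/-- With `q` the symbol at `h/2`, this is `1 - q² ≤ 2(1 - q)`. It is the source of monotonicity
along dyadic meshes. -/
lemma genSymbol_half {N : ℕ} {h : ℝ} (hh : 0 < h) (u : ℝ) :
    genSymbol N h u ≤ genSymbol N (h / 2) u := by
  have e : heatSymbol N h u = heatSymbol N (h / 2) u ^ 2 := by
    rw [heatSymbol, heatSymbol, ← Real.exp_nat_mul]; push_cast; ring_nf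
  unfold genSymbol
  rw [e, inv_div]
  have : (1 - heatSymbol N (h / 2) u ^ 2) ≤ 2 * (1 - heatSymbol N (h / 2) u) := by
    nlinarith [sq_nonneg (1 - heatSymbol N (h / 2) u)]
  have h2 : h⁻¹ * (1 - heatSymbol N (h / 2) u ^ 2) ≤
      h⁻¹ * (2 * (1 - heatSymbol N (h / 2) u)) := by gcongr
  calc _ ≤ _ := add_le_add_right h2 1
    _ = _ := by ring

lemma tendsto_genSymbol {N : ℕ} {h : ℕ → ℝ} (hh : ∀ n, 0 < h n) (h0 : Tendsto h atTop (𝓝 0))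
    (u : ℝ) : Tendsto (fun n => genSymbol N (h n) u) atTop (𝓝 (1 + u ^ (2 * N))) := by
  have hd : HasDerivAt (fun s : ℝ => heatSymbol N s u) (-(u ^ (2 * N))) 0 := by
    have := ((hasDerivAt_id (0 : ℝ)).neg.mul_const (u ^ (2 * N))).exp
    simpa [heatSymbol] using this
  have h1 := (hasDerivAt_iff_tendsto_slope_zero.1 hd).comp
    (tendsto_nhdsWithin_iff.2 ⟨h0, Eventually.of_forall fun n => (hh n).ne'⟩)
  have h2 := (h1.neg).const_add 1
  rw [neg_neg] at h2
  refine h2.congr fun n => ?_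
  simp [genSymbol, heatSymbol]
  ring

/-- The mesh `2^(-n)`. -/
def mesh (n : ℕ) : ℝ := 1 / 2 ^ n

lemma mesh_pos (n : ℕ) : 0 < mesh n := by unfold mesh; positivity

lemma tendsto_mesh : Tendsto mesh atTop (𝓝 0) := by
  have := tendsto_pow_atTop_nhds_zero_of_lt_one (r := (1 / 2 : ℝ)) (by norm_num) (by norm_num)
  refine this.congr fun n => ?_
  simp [mesh]

/-! ### The Dirichlet resolvent as a limit of discrete resolvents -/

section

variable {N : ℕ} (hN : 1 ≤ N)

lemma isUnitOp_stepOp {h : ℝ} (hh : 0 < h) : IsUnitOp (stepOp a b hN hh) :=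
  ⟨isSelfAdjoint_stepOp hN hh, inner_stepOp_self_nonneg hN hh, inner_stepOp_self_le hN hh⟩

lemma integrable_genSymbol {h : ℝ} (hh : 0 < h) (f : L2 a b) :
    Integrable (fun u => genSymbol N h u * ‖ft f u‖ ^ 2) freqMeasure :=
  integrable_mul_sq_ft f (continuous_genSymbol N h) (genSymbol_le_const hh)

lemma re_inner_genOp_stepOp {h : ℝ} (hh : 0 < h) (f : L2 a b) :
    (inner ℂ f (genOp (stepOp a b hN hh) h f)).re =
      ∫ u, genSymbol N h u * ‖ft f u‖ ^ 2 ∂freqMeasure := by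
  have i1 := integrable_mul_sq_ft f (continuous_heatSymbol N h) (norm_heatSymbol_le_one hh.le)
  have i0 := (plancherel f).1
  rw [IsUnitOp.re_inner_genOp, inner_stepOp_self, Complex.ofReal_re, ← (plancherel f).2,
    ← integral_sub i0 i1, ← integral_const_mul, ← integral_add i0 ((i0.sub' i1).const_mul _)]
  congr 1 with u
  unfold genSymbol
  ring

lemma genOp_mono (n m : ℕ) (hnm : n ≤ m) (f : L2 a b) :
    (inner ℂ f (genOp (stepOp a b hN (mesh_pos n)) (mesh n) f)).re ≤
      (inner ℂ f (genOp (stepOp a b hN (mesh_pos m)) (mesh m) f)).re := by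
  rw [re_inner_genOp_stepOp, re_inner_genOp_stepOp]
  refine integral_mono (integrable_genSymbol (mesh_pos n) f) (integrable_genSymbol (mesh_pos m) f)
    fun u => ?_
  refine mul_le_mul_of_nonneg_right ?_ (sq_nonneg _)
  refine monotone_nat_of_le_succ (f := fun n => genSymbol N (mesh n) u) (fun n => ?_) hnm
  have : mesh (n + 1) = mesh n / 2 := by unfold mesh; rw [pow_succ]; field_simp
  rw [this]
  exact genSymbol_half (mesh_pos n) u

/-- The resolvent `(1 + A)⁻¹` of `A = (-1)^N d^(2N)/dx^(2N)` with Dirichlet conditions. -/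
def dirichletResolvent (a b : ℝ) : L2 a b →L[ℂ] L2 a b :=
  Classical.choose (exists_strong_resolvent_limit
    (fun n => isUnitOp_stepOp (a := a) (b := b) hN (mesh_pos n)) mesh_pos (genOp_mono hN))

lemma dirichletResolvent_spec : IsUnitOp (dirichletResolvent hN a b) ∧
    (∀ f, Tendsto (fun n => resolvent (stepOp a b hN (mesh_pos n)) (mesh n) f) atTop
      (𝓝 (dirichletResolvent hN a b f))) ∧
    ∀ n f, (inner ℂ (dirichletResolvent hN a b f) (genOp (stepOp a b hN (mesh_pos n)) (mesh n)
      (dirichletResolvent hN a b f))).re ≤ (inner ℂ f (dirichletResolvent hN a b f)).re :=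
  Classical.choose_spec (exists_strong_resolvent_limit
    (fun n => isUnitOp_stepOp (a := a) (b := b) hN (mesh_pos n)) mesh_pos (genOp_mono hN))

lemma isUnitOp_dirichletResolvent : IsUnitOp (dirichletResolvent hN a b) :=
  (dirichletResolvent_spec hN).1

/-- Fatou's lemma: the discrete weights converge pointwise to `1 + u^(2N)`. -/
lemma finiteEnergy_of_bound {f : L2 a b} {C : ℝ}
    (h : ∀ n, (inner ℂ f (genOp (stepOp a b hN (mesh_pos n)) (mesh n) f)).re ≤ C) :
    FiniteEnergy N f ∧ energy N f ≤ C := by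
  have hpos : ∀ u, 0 ≤ (1 + u ^ (2 * N)) * ‖ft f u‖ ^ 2 := fun u => by
    have := even_pow_nonneg N u
    positivity
  have hC : 0 ≤ C := by
    refine le_trans ?_ (h 0)
    rw [re_inner_genOp_stepOp]
    exact integral_nonneg fun u =>
      mul_nonneg (zero_le_one.trans (one_le_genSymbol (mesh_pos 0) u)) (sq_nonneg _)
  have hft := continuous_ft f
  have hmeas : AEStronglyMeasurable (fun u => (1 + u ^ (2 * N)) * ‖ft f u‖ ^ 2) freqMeasure :=
    Continuous.aestronglyMeasurable (by fun_prop)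
  have key : ∫⁻ u, ENNReal.ofReal ((1 + u ^ (2 * N)) * ‖ft f u‖ ^ 2) ∂freqMeasure ≤
      ENNReal.ofReal C := by
    have h1 : ∀ u, ENNReal.ofReal ((1 + u ^ (2 * N)) * ‖ft f u‖ ^ 2) =
        liminf (fun n => ENNReal.ofReal (genSymbol N (mesh n) u * ‖ft f u‖ ^ 2)) atTop := by
      intro u
      refine (Tendsto.liminf_eq ?_).symm
      exact (ENNReal.continuous_ofReal.tendsto _).comp
        ((tendsto_genSymbol mesh_pos tendsto_mesh u).mul_const _)
    simp only [h1]
    refine (lintegral_liminf_le fun n => ?_).trans ?_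
    · have := continuous_genSymbol N (mesh n)
      exact (Continuous.measurable (by fun_prop)).ennreal_ofReal
    · refine liminf_le_of_le (by isBoundedDefault) fun c hc => ?_
      obtain ⟨n, hn⟩ := hc.exists
      refine hn.trans ?_
      rw [← ofReal_integral_eq_lintegral_ofReal (integrable_genSymbol (mesh_pos n) f)
        (Eventually.of_forall fun u => mul_nonneg
          (zero_le_one.trans (one_le_genSymbol (mesh_pos n) u)) (sq_nonneg _))]
      refine ENNReal.ofReal_le_ofReal ?_
      rw [← re_inner_genOp_stepOp hN]
      exact h n
  constructor
  · refine ⟨hmeas, ?_⟩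
    rw [hasFiniteIntegral_iff_ofReal (Eventually.of_forall hpos)]
    exact key.trans_lt ENNReal.ofReal_lt_top
  · rw [energy, integral_eq_lintegral_of_nonneg_ae (Eventually.of_forall hpos) hmeas]
    exact ENNReal.toReal_le_of_le_ofReal hC key

lemma finiteEnergy_dirichletResolvent (f : L2 a b) :
    FiniteEnergy N (dirichletResolvent hN a b f) ∧
      energy N (dirichletResolvent hN a b f) ≤ (inner ℂ f (dirichletResolvent hN a b f)).re :=
  finiteEnergy_of_bound hN fun n => (dirichletResolvent_spec hN).2.2 n f

end

/-- Convergence of point values under convergence in `L²` and bounded energy. -/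
lemma tendsto_smoothing_evalAt {N : ℕ} (hN : 2 ≤ N) {h : ℕ → ℝ} (hh : ∀ n, 0 < h n)
    (h0 : Tendsto h atTop (𝓝 0)) {g : ℕ → L2 a b} {f : L2 a b} (hg : Tendsto g atTop (𝓝 f))
    {C : ℝ} (hgC : ∀ᶠ n in atTop,
      ∫ u, genSymbol N (h n) u * ‖ft (g n) u‖ ^ 2 ∂freqMeasure ≤ C) (hf : FiniteEnergy N f)
    (x : ℝ) : Tendsto (fun n => smoothing N (h n) (g n) x) atTop (𝓝 (evalAt x f)) := by
  have hN1 : 1 ≤ N := by omega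
  -- The difference of the two point values is at most the `L¹` norm of `D n`. Its energy stays
  -- bounded and its `L²` norm tends to zero, so the Sobolev inequality sends the fourth power of
  -- the `L¹` norm to zero.
  set D : ℕ → ℝ → ℂ := fun n u => heatSymbol N (h n) u * ft (g n) u - ft f u with hD
  have hDc : ∀ n, Continuous (D n) := fun n => by
    have h1 := continuous_ft (g n)
    have h2 := continuous_ft f
    simp only [hD]
    fun_prop
  have hw : ∀ u : ℝ, 0 ≤ 1 + u ^ (2 * N) := fun u => by
    have := even_pow_nonneg N u
    linarith
  have hgs : ∀ n, Integrable (fun u => genSymbol N (h n) u * ‖ft (g n) u‖ ^ 2) freqMeasure :=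
    fun n => integrable_genSymbol (hh n) (g n)
  have hbd : ∀ n u, (1 + u ^ (2 * N)) * ‖D n u‖ ^ 2 ≤
      2 * (genSymbol N (h n) u * ‖ft (g n) u‖ ^ 2) +
        2 * ((1 + u ^ (2 * N)) * ‖ft f u‖ ^ 2) := by
    intro n u
    have h1 : ‖D n u‖ ^ 2 ≤ 2 * (heatSymbol N (h n) u ^ 2 * ‖ft (g n) u‖ ^ 2) +
        2 * ‖ft f u‖ ^ 2 := by
      have h2 := norm_sub_le (heatSymbol N (h n) u * ft (g n) u : ℂ) (ft f u)
      rw [norm_mul, Complex.norm_real, Real.norm_of_nonneg (heatSymbol_pos _ _ _).le] at h2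
      have h3 : ‖D n u‖ ^ 2 ≤ (heatSymbol N (h n) u * ‖ft (g n) u‖ + ‖ft f u‖) ^ 2 := by
        gcongr
      refine h3.trans ?_
      rw [← mul_pow]
      nlinarith [sq_nonneg (heatSymbol N (h n) u * ‖ft (g n) u‖ - ‖ft f u‖)]
    have h4 := mul_le_mul_of_nonneg_left h1 (hw u)
    have h5 := mul_le_mul_of_nonneg_right (heatSymbol_sq_mul_le (N := N) (hh n) u)
      (sq_nonneg ‖ft (g n) u‖)
    linarith
  have hDE : ∀ n, Integrable (fun u => (1 + u ^ (2 * N)) * ‖D n u‖ ^ 2) freqMeasure := fun n => by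
    have hc := hDc n
    refine (((hgs n).const_mul 2).fun_add (hf.const_mul 2)).mono'
      (Continuous.aestronglyMeasurable (by fun_prop)) (Eventually.of_forall fun u => ?_)
    rw [Real.norm_of_nonneg (mul_nonneg (hw u) (sq_nonneg _))]
    exact hbd n u
  have hE : ∀ᶠ n in atTop, ∫ u, (1 + u ^ (2 * N)) * ‖D n u‖ ^ 2 ∂freqMeasure ≤
      2 * C + 2 * energy N f := by
    filter_upwards [hgC] with n hn
    refine (integral_mono (hDE n) (((hgs n).const_mul 2).fun_add (hf.const_mul 2)) (hbd n)).trans ?_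
    rw [integral_add ((hgs n).const_mul 2) (hf.const_mul 2), integral_const_mul,
      integral_const_mul]
    unfold energy
    linarith
  have hL2 : Tendsto (fun n => ∫ u, ‖D n u‖ ^ 2 ∂freqMeasure) atTop (𝓝 0) := by
    -- Split `D n` into the smoothed transform of `g n - f`, small by convergence in `L²`, and `(1 -
    -- heatSymbol)` times the transform of `f`, which is small because `f` has finite energy.
    have hpt : ∀ n u, ‖D n u‖ ^ 2 ≤ 2 * ‖ft (g n - f) u‖ ^ 2 +
        2 * h n * ((1 + u ^ (2 * N)) * ‖ft f u‖ ^ 2) := by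
      intro n u
      have e : D n u = heatSymbol N (h n) u * ft (g n - f) u -
          ((1 - heatSymbol N (h n) u : ℝ) : ℂ) * ft f u := by
        rw [ft_sub]; push_cast; simp only [hD]; ring
      have h2 := norm_sub_le (heatSymbol N (h n) u * ft (g n - f) u : ℂ)
        (((1 - heatSymbol N (h n) u : ℝ) : ℂ) * ft f u)
      have h6 := heatSymbol_le_one (N := N) (hh n).le u
      have h7 := (heatSymbol_pos N (h n) u).le
      rw [← e, norm_mul, norm_mul, Complex.norm_real, Complex.norm_real, Real.norm_of_nonneg h7,
        Real.norm_of_nonneg (sub_nonneg.2 h6)] at h2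
      set X := ‖ft (g n - f) u‖
      set Y := ‖ft f u‖
      have hX : 0 ≤ X := norm_nonneg _
      have hY : 0 ≤ Y := norm_nonneg _
      have h8 : ‖D n u‖ ≤ X + (1 - heatSymbol N (h n) u) * Y := by
        refine h2.trans ?_
        gcongr
        exact mul_le_of_le_one_left hX h6
      have h9 : ‖D n u‖ ^ 2 ≤ (X + (1 - heatSymbol N (h n) u) * Y) ^ 2 := by gcongr
      have h10 := mul_le_mul_of_nonneg_right (one_sub_heatSymbol_sq_le (N := N) (hh n) u)
        (sq_nonneg Y)
      nlinarith [sq_nonneg (X - (1 - heatSymbol N (h n) u) * Y)]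
    refine squeeze_zero (g := fun n => 2 * ‖g n - f‖ ^ 2 + 2 * h n * energy N f)
      (fun n => integral_nonneg fun u => sq_nonneg _) (fun n => ?_) ?_
    · have i1 := (plancherel (g n - f)).1.const_mul 2
      have i2 := hf.const_mul (2 * h n)
      have hc := hDc n
      have i0 : Integrable (fun u => ‖D n u‖ ^ 2) freqMeasure :=
        (i1.fun_add i2).mono' (Continuous.aestronglyMeasurable (by fun_prop))
          (Eventually.of_forall fun u => by
            rw [Real.norm_of_nonneg (sq_nonneg _)]; exact hpt n u)
      refine (integral_mono i0 (i1.fun_add i2) (hpt n)).trans (le_of_eq ?_)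
      rw [integral_add i1 i2, integral_const_mul, integral_const_mul, (plancherel _).2]
      rfl
    · have t1 : Tendsto (fun n => 2 * ‖g n - f‖ ^ 2) atTop (𝓝 (2 * ‖f - f‖ ^ 2)) :=
        ((hg.sub_const f).norm.pow 2).const_mul 2
      have t2 : Tendsto (fun n => 2 * h n * energy N f) atTop (𝓝 (2 * 0 * energy N f)) :=
        (h0.const_mul 2).mul_const _
      simpa using t1.add t2
  have hL1 : Tendsto (fun n => ∫ u, ‖D n u‖ ∂freqMeasure) atTop (𝓝 0) := by
    have h4 : Tendsto (fun n => (∫ u, ‖D n u‖ ∂freqMeasure) ^ 4) atTop (𝓝 0) := by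
      refine squeeze_zero' (g := fun n => sobolevConst *
        ((∫ u, ‖D n u‖ ^ 2 ∂freqMeasure) * (2 * C + 2 * energy N f)))
        (Eventually.of_forall fun n => by positivity) ?_ ?_
      · filter_upwards [hE] with n hn
        refine (integral_norm_pow_four_le hN (hDc n).aestronglyMeasurable (hDE n)).2.trans ?_
        have := sobolevConst_nonneg
        have h5 : 0 ≤ ∫ u, ‖D n u‖ ^ 2 ∂freqMeasure := integral_nonneg fun u => sq_nonneg _
        gcongr
      · simpa using (hL2.mul_const (2 * C + 2 * energy N f)).const_mul sobolevConst
    have h5 := h4.rpow_const (p := (4 : ℝ)⁻¹) (Or.inr (by norm_num))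
    rw [Real.zero_rpow (by norm_num)] at h5
    refine h5.congr fun n => ?_
    have h6 : 0 ≤ ∫ u, ‖D n u‖ ∂freqMeasure := integral_nonneg fun u => norm_nonneg _
    have := Real.pow_rpow_inv_natCast h6 (n := 4) (by norm_num)
    simpa using this
  rw [tendsto_iff_norm_sub_tendsto_zero]
  refine squeeze_zero (fun n => norm_nonneg _) (fun n => ?_) hL1
  have i1 : Integrable (fun u : ℝ => Complex.exp (Complex.I * (u * x)) * heatSymbol N (h n) u *
      ft (g n) u) freqMeasure := by
    have c1 := continuous_ft (g n)
    refine ((integrable_heatSymbol hN1 (hh n)).norm.mul_const (boundConst a b * ‖g n‖)).mono'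
      (by fun_prop) (Eventually.of_forall fun u => ?_)
    rw [norm_mul, norm_mul, norm_exp_I_mul, one_mul]
    gcongr
    exact norm_ft_le _ u
  have i2 : Integrable (fun u : ℝ => Complex.exp (Complex.I * (u * x)) * ft f u) freqMeasure :=
    (hf.integrable_ft hN).bdd_mul (c := 1) (by fun_prop)
      (Eventually.of_forall fun u => (norm_exp_I_mul u x).le)
  rw [smoothing_eq hN1 (hh n), evalAt, ← integral_sub i1 i2]
  refine (norm_integral_le_integral_norm _).trans (le_of_eq ?_)
  refine integral_congr_ae (Eventually.of_forall fun u : ℝ => ?_)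
  have : Complex.exp (Complex.I * (u * x)) * heatSymbol N (h n) u * ft (g n) u -
      Complex.exp (Complex.I * (u * x)) * ft f u = Complex.exp (Complex.I * (u * x)) * D n u := by
    simp only [hD]; ring
  simp only [this, norm_mul, norm_exp_I_mul, one_mul]

end PseudoBM

namespace PseudoBM

open ComplexConjugate

variable {a b : ℝ} {N : ℕ}

/-! ### Point values of the semigroup and convergence of the survival functions -/

lemma one_le_of_two_le (hN : 2 ≤ N) : 1 ≤ N := one_le_two.trans hN

lemma integrable_exp_mul_ft (hN : 2 ≤ N) {f : L2 a b} (hf : FiniteEnergy N f) (x : ℝ) :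
    Integrable (fun u : ℝ => Complex.exp (Complex.I * (u * x)) * ft f u) freqMeasure :=
  (hf.integrable_ft hN).bdd_mul (c := 1) (by fun_prop)
    (Eventually.of_forall fun u => (norm_exp_I_mul u x).le)

lemma evalAt_add (hN : 2 ≤ N) {f g : L2 a b} (hf : FiniteEnergy N f) (hg : FiniteEnergy N g)
    (x : ℝ) : evalAt x (f + g) = evalAt x f + evalAt x g := by
  simp only [evalAt, ft_add, mul_add]
  exact integral_add (integrable_exp_mul_ft hN hf x) (integrable_exp_mul_ft hN hg x)

lemma evalAt_smul (c : ℂ) (f : L2 a b) (x : ℝ) : evalAt x (c • f) = c * evalAt x f := by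
  simp only [evalAt, ft_smul]
  rw [← integral_const_mul]
  congr 1 with u
  ring

/-- The constant function `1` on `(a, b)`. -/
def oneL2 (a b : ℝ) : L2 a b := toL2 a b fun _ => 1

section

variable (hN : 2 ≤ N)

/-- The functional `f ↦ ((1 + A)⁻¹ f)(x)`. -/
def evalResolvent (a b x : ℝ) : L2 a b →L[ℂ] ℂ :=
  LinearMap.mkContinuous
    { toFun := fun f => evalAt x (dirichletResolvent (one_le_of_two_le hN) a b f)
      map_add' := fun f g => by
        rw [map_add, evalAt_add hN (finiteEnergy_dirichletResolvent _ f).1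
          (finiteEnergy_dirichletResolvent _ g).1]
      map_smul' := fun c f => by rw [map_smul, evalAt_smul]; rfl }
    -- The squared value at `x` is at most `√sobolevConst` times the energy of `Rf`, and that energy
    -- is at most `⟨f, Rf⟩ ≤ ‖f‖²`.
    (Real.sqrt (Real.sqrt sobolevConst)) fun f => by
      have h1 := finiteEnergy_dirichletResolvent (one_le_of_two_le hN) f
      have h2 := norm_evalAt_sq_le hN h1.1 x
      have h3 := (isUnitOp_dirichletResolvent (a := a) (b := b) (one_le_of_two_le hN)).le_one f
      refine le_of_sq_le_sq ?_ (by positivity)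
      rw [mul_pow, Real.sq_sqrt (Real.sqrt_nonneg _)]
      exact h2.trans (mul_le_mul_of_nonneg_left (h1.2.trans h3) (Real.sqrt_nonneg _))

lemma evalResolvent_apply (x : ℝ) (f : L2 a b) :
    evalResolvent hN a b x f = evalAt x (dirichletResolvent (one_le_of_two_le hN) a b f) := rfl

/-- The semigroup `exp (-tA)` applied to `1`, evaluated at `x`. -/
def survivalLimit (a b t x : ℝ) : ℂ :=
  evalResolvent hN a b x
    (heatOp (dirichletResolvent (one_le_of_two_le hN) a b) 1 t (oneL2 a b))

/-- The index `1` of `heatOp` cancels against the resolvent inside `evalResolvent`. Evaluation at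
`x` is thus a bounded functional applied to a curve differentiable in norm, so time derivatives pass
through it. -/
lemma survivalLimit_eq {t : ℝ} (ht : 0 < t) (x : ℝ) : survivalLimit hN a b t x =
    evalAt x (heatOp (dirichletResolvent (one_le_of_two_le hN) a b) 0 t (oneL2 a b)) := by
  rw [survivalLimit, evalResolvent_apply,
    (isUnitOp_dirichletResolvent (one_le_of_two_le hN)).apply_heatOp_succ 0 ht]

lemma finiteEnergy_heatOp_zero {t : ℝ} (ht : 0 < t) (f : L2 a b) :
    FiniteEnergy N (heatOp (dirichletResolvent (one_le_of_two_le hN) a b) 0 t f) := by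
  rw [← (isUnitOp_dirichletResolvent (one_le_of_two_le hN)).apply_heatOp_succ 0 ht]
  exact (finiteEnergy_dirichletResolvent _ _).1

lemma energy_pow_stepOp_le {h : ℝ} (hh : 0 < h) (m : ℕ) (f : L2 a b) :
    ∫ u, genSymbol N h u *
        ‖ft ((stepOp a b (one_le_of_two_le hN) hh ^ m) f) u‖ ^ 2 ∂freqMeasure ≤
      ‖f‖ ^ 2 * (1 + 1 / (h * (m + 1))) := by
  rw [← re_inner_genOp_stepOp (one_le_of_two_le hN) hh]
  exact (isUnitOp_stepOp (one_le_of_two_le hN) hh).energy_pow_le hh m f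

lemma tendsto_floor_mul_mesh {t : ℝ} (ht : 0 ≤ t) :
    Tendsto (fun n : ℕ => (⌊2 ^ n * t⌋₊ : ℝ) * mesh n) atTop (𝓝 t) := by
  have h := (tendsto_nat_floor_mul_div_atTop ht).comp
    (tendsto_pow_atTop_atTop_of_one_lt (one_lt_two (α := ℝ)))
  refine h.congr fun n => ?_
  simp only [Function.comp_apply, mesh]
  rw [mul_comm t, mul_one_div]

lemma tendsto_survival {t : ℝ} (ht : 0 < t) (x : ℝ) :
    Tendsto (fun n => (survival N a b (1 / 2 ^ n) ⌊2 ^ n * t⌋₊ x : ℂ)) atTop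
      (𝓝 (survivalLimit hN a b t x)) := by
  have hN1 := one_le_of_two_le hN
  have hK := tendsto_floor_mul_mesh ht.le
  have hev : ∀ᶠ n : ℕ in atTop, t / 2 < (⌊2 ^ n * t⌋₊ : ℝ) * mesh n :=
    hK.eventually (lt_mem_nhds (half_lt_self ht))
  have hpos : ∀ᶠ n : ℕ in atTop, ⌊2 ^ n * t⌋₊ - 1 + 1 = ⌊2 ^ n * t⌋₊ := by
    filter_upwards [hev] with n hn
    refine Nat.sub_add_cancel (Nat.one_le_iff_ne_zero.2 fun h0 => ?_)
    rw [h0, Nat.cast_zero, zero_mul] at hn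
    linarith
  -- One step is held back: it is the smoothing that turns the `L²` iterate into a value at `x`.
  have hm : Tendsto (fun n : ℕ => ((⌊2 ^ n * t⌋₊ - 1 : ℕ) : ℝ) * mesh n) atTop (𝓝 t) := by
    have h1 := hK.sub tendsto_mesh
    rw [sub_zero] at h1
    refine h1.congr' ?_
    filter_upwards [hpos] with n hn
    have : (⌊2 ^ n * t⌋₊ : ℝ) = ((⌊2 ^ n * t⌋₊ - 1 : ℕ) : ℝ) + 1 := by exact_mod_cast hn.symm
    rw [this]
    ring
  have hconv := tendsto_pow_heatOp (fun n => isUnitOp_stepOp (a := a) (b := b) hN1 (mesh_pos n))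
    mesh_pos tendsto_mesh (isUnitOp_dirichletResolvent hN1) (dirichletResolvent_spec hN1).2.1 ht hm
    (oneL2 a b)
  rw [survivalLimit_eq hN ht]
  have hlim := tendsto_smoothing_evalAt hN mesh_pos tendsto_mesh hconv
    (C := ‖oneL2 a b‖ ^ 2 * (1 + 2 / t)) ?_ (finiteEnergy_heatOp_zero hN ht _) x
  · refine hlim.congr' ?_
    filter_upwards [hpos] with n hn
    rw [← hn]
    exact ((survival_eq_smoothing hN1 (mesh_pos n) _).2 x).symm
  · filter_upwards [hpos, hev] with n hn1 hn2
    refine (energy_pow_stepOp_le hN (mesh_pos n) _ _).trans ?_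
    have h3 : (((⌊2 ^ n * t⌋₊ - 1 : ℕ) : ℝ) + 1) = (⌊2 ^ n * t⌋₊ : ℝ) := by exact_mod_cast hn1
    rw [h3]
    have h4 : 1 / (mesh n * (⌊2 ^ n * t⌋₊ : ℝ)) ≤ 2 / t := by
      rw [mul_comm, ← one_div_div t 2]
      exact one_div_le_one_div_of_le (by positivity) hn2.le
    gcongr

lemma survivalLimit_im {t : ℝ} (ht : 0 < t) (x : ℝ) : (survivalLimit hN a b t x).im = 0 := by
  have h := (Complex.continuous_im.tendsto _).comp (tendsto_survival (a := a) (b := b) hN ht x)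
  refine tendsto_nhds_unique h ?_
  simp [Function.comp_def]

lemma tendsto_survival_re {t : ℝ} (ht : 0 < t) (x : ℝ) :
    Tendsto (fun n => survival N a b (1 / 2 ^ n) ⌊2 ^ n * t⌋₊ x) atTop
      (𝓝 (survivalLimit hN a b t x).re) := by
  simpa [Function.comp_def] using
    (Complex.continuous_re.tendsto _).comp (tendsto_survival (a := a) (b := b) hN ht x)

end

/-- A signed kernel gives no bound by `1`. Instead the Sobolev inequality is applied to the smoothed
iterate, whose `L²` norm is at most that of `1` and whose energy is controlled by the smoothing
effect of the powers. -/
lemma survival_pow_four_le (hN : 2 ≤ N) {h : ℝ} (hh : 0 < h) (k : ℕ) (x : ℝ) :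
    |survival N a b h (k + 1) x| ^ 4 ≤
      sobolevConst * ‖oneL2 a b‖ ^ 4 * (1 + 1 / (h * (k + 1))) := by
  have hN1 := one_le_of_two_le hN
  set g := (stepOp a b hN1 hh ^ k) (oneL2 a b) with hg
  set D : ℝ → ℂ := fun u => heatSymbol N h u * ft g u with hD
  have hgE := energy_pow_stepOp_le hN hh k (oneL2 a b)
  rw [← hg] at hgE
  have hc := continuous_ft g
  have hcs := continuous_heatSymbol N h
  have hDc : Continuous D := by simp only [hD]; fun_prop
  have hDn : ∀ u, ‖D u‖ ^ 2 = heatSymbol N h u ^ 2 * ‖ft g u‖ ^ 2 := fun u => by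
    simp only [hD]
    rw [norm_mul, Complex.norm_real, Real.norm_of_nonneg (heatSymbol_pos _ _ _).le, mul_pow]
  have hpt : ∀ u, (1 + u ^ (2 * N)) * ‖D u‖ ^ 2 ≤ genSymbol N h u * ‖ft g u‖ ^ 2 := fun u => by
    rw [hDn, ← mul_assoc]
    exact mul_le_mul_of_nonneg_right (heatSymbol_sq_mul_le hh u) (sq_nonneg _)
  have hi := integrable_genSymbol (N := N) hh g
  have hDi : Integrable (fun u => (1 + u ^ (2 * N)) * ‖D u‖ ^ 2) freqMeasure :=
    hi.mono' (Continuous.aestronglyMeasurable (by fun_prop)) (Eventually.of_forall fun u => by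
      have := even_pow_nonneg N u
      rw [Real.norm_of_nonneg (by positivity)]
      exact hpt u)
  obtain ⟨i1, i2⟩ := integral_norm_pow_four_le hN hDc.aestronglyMeasurable hDi
  have h1 : |survival N a b h (k + 1) x| ≤ ∫ u, ‖D u‖ ∂freqMeasure := by
    rw [← Real.norm_eq_abs, ← Complex.norm_real, (survival_eq_smoothing hN1 hh k).2 x, smoothing_eq hN1 hh]
    refine (norm_integral_le_integral_norm _).trans (le_of_eq ?_)
    refine integral_congr_ae (Eventually.of_forall fun u : ℝ => ?_)
    simp only [hD, mul_assoc]
    rw [norm_mul, norm_exp_I_mul, one_mul]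
    rfl
  have h2 : ∫ u, ‖D u‖ ^ 2 ∂freqMeasure ≤ ‖oneL2 a b‖ ^ 2 := by
    have h3 : ∫ u, ‖D u‖ ^ 2 ∂freqMeasure ≤ ‖g‖ ^ 2 := by
      rw [← (plancherel g).2]
      refine integral_mono_of_nonneg (Eventually.of_forall fun u => sq_nonneg _) (plancherel g).1
        (Eventually.of_forall fun u => ?_)
      simp only
      rw [hDn]
      exact mul_le_of_le_one_left (sq_nonneg _)
        (pow_le_one₀ (heatSymbol_pos _ _ _).le (heatSymbol_le_one hh.le u))
    have h4 := (isUnitOp_stepOp (a := a) (b := b) hN1 hh).norm_pow_apply_le k (oneL2 a b)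
    exact h3.trans (by gcongr)
  have h3 : ∫ u, (1 + u ^ (2 * N)) * ‖D u‖ ^ 2 ∂freqMeasure ≤
      ‖oneL2 a b‖ ^ 2 * (1 + 1 / (h * (k + 1))) := (integral_mono hDi hi hpt).trans hgE
  have h5 : 0 ≤ ∫ u, (1 + u ^ (2 * N)) * ‖D u‖ ^ 2 ∂freqMeasure := integral_nonneg fun u => by
    have := even_pow_nonneg N u
    positivity
  have hs := sobolevConst_nonneg
  calc |survival N a b h (k + 1) x| ^ 4 ≤ (∫ u, ‖D u‖ ∂freqMeasure) ^ 4 := by gcongr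
    _ ≤ _ := i2
    _ ≤ sobolevConst * (‖oneL2 a b‖ ^ 2 * (‖oneL2 a b‖ ^ 2 * (1 + 1 / (h * (k + 1))))) := by
      gcongr
    _ = _ := by ring

/-- A bound for the survival functions, uniform in the mesh. -/
lemma exists_survival_bound (a b : ℝ) (hN : 2 ≤ N) : ∃ C : ℝ, 0 ≤ C ∧ ∀ h : ℝ, 0 < h → ∀ (k : ℕ) (x t : ℝ), 0 < t →
    t ≤ h * (k + 1) → |survival N a b h k x| ≤ 1 + Real.sqrt (C * (1 + 2 / t)) := by
  refine ⟨sobolevConst * ‖oneL2 a b‖ ^ 4, mul_nonneg sobolevConst_nonneg (by positivity),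
    fun h hh k x t ht hth => ?_⟩
  rcases k with _ | k
  · simp only [survival, abs_one]
    linarith [Real.sqrt_nonneg (sobolevConst * ‖oneL2 a b‖ ^ 4 * (1 + 2 / t))]
  · have h1 := survival_pow_four_le (a := a) (b := b) hN hh k x
    -- The index has been shifted, so the hypothesis reads `t ≤ h(k + 2)`, and `k + 2 ≤ 2(k + 1)`.
    have h2 : 1 / (h * (k + 1)) ≤ 2 / t := by
      rw [div_le_div_iff₀ (by positivity) ht]
      push_cast at hth
      nlinarith [mul_nonneg hh.le (Nat.cast_nonneg (α := ℝ) k)]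
    have h3 : (|survival N a b h (k + 1) x| ^ 2) ^ 2 ≤
        sobolevConst * ‖oneL2 a b‖ ^ 4 * (1 + 2 / t) := by
      rw [← pow_mul]
      refine h1.trans ?_
      have := sobolevConst_nonneg
      gcongr
    have h4 := Real.le_sqrt_of_sq_le h3
    nlinarith [sq_nonneg (|survival N a b h (k + 1) x| - 1)]

end PseudoBM

namespace PseudoBM

open ComplexConjugate FourierTransform
open scoped ContDiff

variable {a b : ℝ} {N : ℕ}

/-! ### Smooth functions and integration by parts -/

lemma hasDerivAt_iteratedDeriv {v : ℝ → ℂ} (hv : ContDiff ℝ ∞ v) (j : ℕ) (y : ℝ) :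
    HasDerivAt (iteratedDeriv j v) (iteratedDeriv (j + 1) v y) y := by
  rw [iteratedDeriv_succ]
  exact ((hv.differentiable_iteratedDeriv j (by exact_mod_cast ENat.natCast_lt_top j)) y).hasDerivAt

lemma contDiff_iteratedDeriv {v : ℝ → ℂ} (hv : ContDiff ℝ ∞ v) (j : ℕ) :
    ContDiff ℝ ∞ (iteratedDeriv j v) := by
  rw [iteratedDeriv_eq_iterate]
  exact hv.iterate_deriv j

lemma continuous_iteratedDeriv {v : ℝ → ℂ} (hv : ContDiff ℝ ∞ v) (j : ℕ) :
    Continuous (iteratedDeriv j v) := (contDiff_iteratedDeriv hv j).continuous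

lemma iteratedDeriv_iteratedDeriv (v : ℝ → ℂ) (j k : ℕ) :
    iteratedDeriv j (iteratedDeriv k v) = iteratedDeriv (j + k) v := by
  simp only [iteratedDeriv_eq_iterate, Function.iterate_add_apply]

lemma ft_toL2 (hab : a ≤ b) {w : ℝ → ℂ} (hw : Continuous w) (u : ℝ) :
    ft (toL2 a b w) u = ∫ y in a..b, Complex.exp (-(Complex.I * (u * y))) * w y := by
  rw [ft, expL2, inner_toL2_toL2 (continuous_exp_I_mul u) hw, intervalIntegral.integral_of_le hab,
    integral_Ioc_eq_integral_Ioo]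
  simp only [conj_exp_I_mul]

lemma I_mul_ft (hab : a ≤ b) {w w' : ℝ → ℂ} (hw : ∀ y, HasDerivAt w (w' y) y)
    (hw' : Continuous w') (u : ℝ) :
    Complex.I * u * ft (toL2 a b w) u = ft (toL2 a b w') u -
      (Complex.exp (-(Complex.I * (u * b))) * w b - Complex.exp (-(Complex.I * (u * a))) * w a) := by
  have hc : Continuous w := continuous_iff_continuousAt.2 fun y => (hw y).continuousAt
  have hE : ∀ y : ℝ, HasDerivAt (fun y : ℝ => Complex.exp (-(Complex.I * (u * y))))
      (-(Complex.I * u) * Complex.exp (-(Complex.I * (u * y)))) y := fun y => by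
    have h1 : HasDerivAt (fun y : ℝ => -(Complex.I * (u * (y : ℂ)))) (-(Complex.I * u)) y := by
      have := (((hasDerivAt_id y).ofReal_comp.const_mul (u : ℂ)).const_mul Complex.I).fun_neg
      simpa using this
    have h2 := h1.cexp
    rwa [mul_comm] at h2
  have h := intervalIntegral.integral_eq_sub_of_hasDerivAt (a := a) (b := b)
    (fun y _ => (hE y).mul (hw y)) (Continuous.intervalIntegrable (by fun_prop) _ _)
  rw [intervalIntegral.integral_add (Continuous.intervalIntegrable (by fun_prop) _ _)
    (Continuous.intervalIntegrable (by fun_prop) _ _)] at h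
  simp only [mul_assoc (-(Complex.I * (u : ℂ)))] at h
  rw [intervalIntegral.integral_const_mul, ← ft_toL2 hab hc, ← ft_toL2 hab hw'] at h
  simp only [Pi.mul_apply] at h
  rw [← h]
  ring

lemma I_mul_pow_ft (hab : a ≤ b) {w : ℝ → ℂ} (hw : ContDiff ℝ ∞ w) (u : ℝ) (k : ℕ) :
    (Complex.I * u) ^ k * ft (toL2 a b w) u = ft (toL2 a b (iteratedDeriv k w)) u -
      ∑ j ∈ Finset.range k, (Complex.I * u) ^ (k - 1 - j) *
        (Complex.exp (-(Complex.I * (u * b))) * iteratedDeriv j w b -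
          Complex.exp (-(Complex.I * (u * a))) * iteratedDeriv j w a) := by
  induction k with
  | zero => simp
  | succ k ih =>
    have e : ∀ j ∈ Finset.range k, (Complex.I * u) ^ (k + 1 - 1 - j) *
        (Complex.exp (-(Complex.I * (u * b))) * iteratedDeriv j w b -
          Complex.exp (-(Complex.I * (u * a))) * iteratedDeriv j w a) =
        (Complex.I * u) * ((Complex.I * u) ^ (k - 1 - j) *
        (Complex.exp (-(Complex.I * (u * b))) * iteratedDeriv j w b -
          Complex.exp (-(Complex.I * (u * a))) * iteratedDeriv j w a)) := fun j hj => by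
      have h1 := Finset.mem_range.1 hj
      have h2 : k + 1 - 1 - j = (k - 1 - j) + 1 := by omega
      rw [h2, pow_succ']
      ring
    rw [Finset.sum_range_succ, Finset.sum_congr rfl e, ← Finset.mul_sum, pow_succ', mul_assoc, ih,
      mul_sub, I_mul_ft hab (hasDerivAt_iteratedDeriv hw k) (continuous_iteratedDeriv hw (k + 1))]
    simp
    ring

/-! ### Derivatives of functions with finite energy -/

/-- The `j`-th derivative at `y` of the continuous representative of `f`. -/
def evalDeriv (j : ℕ) (f : L2 a b) (y : ℝ) : ℂ :=
  ∫ u, (Complex.I * u) ^ j * Complex.exp (Complex.I * (u * y)) * ft f u ∂freqMeasure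

lemma evalDeriv_zero (f : L2 a b) (y : ℝ) : evalDeriv 0 f y = evalAt y f := by
  simp [evalDeriv, evalAt]

lemma pow_le_one_add_pow {x : ℝ} (hx : 0 ≤ x) {j k : ℕ} (h : j ≤ k) : x ^ j ≤ 1 + x ^ k := by
  rcases le_total x 1 with h1 | h1
  · linarith [pow_le_one₀ hx h1 (n := j), pow_nonneg hx k]
  · linarith [pow_le_pow_right₀ h1 h]

/-- For `X = |u|^j |f^|` one has `X ≤ (1 + u²)⁻¹ + (1 + u²)X²`, and the last term is dominated by
the energy density when `j + 1 ≤ N`. -/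
lemma FiniteEnergy.integrable_pow_mul_ft {f : L2 a b} (hf : FiniteEnergy N f) {j : ℕ}
    (hj : j + 1 ≤ N) : Integrable (fun u : ℝ => ‖(u : ℂ) ^ j * ft f u‖) freqMeasure := by
  have hft := continuous_ft f
  have hw : Integrable (fun u : ℝ => (1 + u ^ 2)⁻¹) freqMeasure :=
    integrable_freqMeasure.2 integrable_inv_one_add_sq
  refine (hw.add (hf.const_mul 4)).mono' (Continuous.aestronglyMeasurable (by fun_prop))
    (Eventually.of_forall fun u => ?_)
  rw [norm_norm]
  simp only [Pi.add_apply, norm_mul, norm_pow, Complex.norm_real, Real.norm_eq_abs]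
  set F := ‖ft f u‖
  have hF : 0 ≤ F := norm_nonneg _
  have hp : 0 < 1 + u ^ 2 := by positivity
  have h1 : (u ^ 2) ^ j ≤ 1 + u ^ (2 * N) := by
    rw [pow_mul]; exact pow_le_one_add_pow (sq_nonneg u) (by omega)
  have h2 : (u ^ 2) ^ (j + 1) ≤ 1 + u ^ (2 * N) := by
    rw [pow_mul]; exact pow_le_one_add_pow (sq_nonneg u) hj
  have h3 : (1 + u ^ 2) * (|u| ^ j * F) ^ 2 ≤ 4 * ((1 + u ^ (2 * N)) * F ^ 2) := by
    have : (|u| ^ j * F) ^ 2 = (u ^ 2) ^ j * F ^ 2 := by rw [mul_pow, ← pow_mul, mul_comm j,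
      pow_mul, sq_abs]
    rw [this]
    have h4 : (1 + u ^ 2) * (u ^ 2) ^ j ≤ 4 * (1 + u ^ (2 * N)) := by
      rw [pow_succ] at h2
      nlinarith [pow_nonneg (sq_nonneg u) j]
    calc _ = ((1 + u ^ 2) * (u ^ 2) ^ j) * F ^ 2 := by ring
      _ ≤ (4 * (1 + u ^ (2 * N))) * F ^ 2 := by gcongr
      _ = _ := by ring
  refine le_trans ?_ (add_le_add le_rfl h3)
  set X := |u| ^ j * F
  rw [inv_eq_one_div, div_add' _ _ _ hp.ne', le_div_iff₀ hp]
  nlinarith [sq_nonneg (X * (1 + u ^ 2) - 1)]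

lemma norm_evalDeriv_integrand (f : L2 a b) (j : ℕ) (u y : ℝ) :
    ‖(Complex.I * u) ^ j * Complex.exp (Complex.I * (u * y)) * ft f u‖ =
      ‖(u : ℂ) ^ j * ft f u‖ := by
  rw [norm_mul, norm_mul, norm_exp_I_mul, mul_pow, norm_mul, norm_pow, Complex.norm_I]
  simp

lemma FiniteEnergy.integrable_evalDeriv {f : L2 a b} (hf : FiniteEnergy N f) {j : ℕ}
    (hj : j + 1 ≤ N) (y : ℝ) : Integrable (fun u : ℝ =>
      (Complex.I * u) ^ j * Complex.exp (Complex.I * (u * y)) * ft f u) freqMeasure := by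
  have hft := continuous_ft f
  exact (hf.integrable_pow_mul_ft hj).mono' (Continuous.aestronglyMeasurable (by fun_prop))
    (Eventually.of_forall fun u => (norm_evalDeriv_integrand f j u y).le)

lemma FiniteEnergy.continuous_evalDeriv {f : L2 a b} (hf : FiniteEnergy N f) {j : ℕ}
    (hj : j + 1 ≤ N) : Continuous (evalDeriv j f) :=
  continuous_of_dominated (fun y => (hf.integrable_evalDeriv hj y).aestronglyMeasurable)
    (fun y => Eventually.of_forall fun u => (norm_evalDeriv_integrand f j u y).le)
    (hf.integrable_pow_mul_ft hj) (Eventually.of_forall fun u => by fun_prop)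

lemma FiniteEnergy.hasDerivAt_evalDeriv {f : L2 a b} (hf : FiniteEnergy N f) {j : ℕ}
    (hj : j + 2 ≤ N) (y : ℝ) : HasDerivAt (evalDeriv j f) (evalDeriv (j + 1) f y) y := by
  refine (hasDerivAt_integral_of_dominated_loc_of_deriv_le (s := Set.univ) Filter.univ_mem
    (Eventually.of_forall fun y => (hf.integrable_evalDeriv (by omega) y).aestronglyMeasurable)
    (hf.integrable_evalDeriv (by omega) y)
    (hf.integrable_evalDeriv (j := j + 1) (by omega) y).aestronglyMeasurable
    (Eventually.of_forall fun u y _ => (norm_evalDeriv_integrand f (j + 1) u y).le)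
    (hf.integrable_pow_mul_ft (j := j + 1) (by omega))
    (Eventually.of_forall fun u y _ => ?_)).2
  have h1 : HasDerivAt (fun y : ℝ => Complex.I * (u * (y : ℂ))) (Complex.I * u) y := by
    have := ((hasDerivAt_id y).ofReal_comp.const_mul (u : ℂ)).const_mul Complex.I
    simpa using this
  have h2 := (h1.cexp.const_mul ((Complex.I * u) ^ j)).mul_const (ft f u)
  convert! h2 using 1
  ring

/-- Fourier inversion for the extension of `f` by zero; it needs continuity of a representative only
at the point in question. -/
lemma evalAt_eq_of_continuousAt (hN : 2 ≤ N) {f : L2 a b} (hf : FiniteEnergy N f) {G : ℝ → ℂ}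
    (hG : G =ᵐ[volume] (Set.Ioo a b).indicator f) {y : ℝ} (hy : ContinuousAt G y) :
    evalAt y f = G y := by
  have hGi : Integrable G := ((integrable_indicator_iff measurableSet_Ioo).2 (integrable_L2 f)).congr
    hG.symm
  have hF : 𝓕 G = fun w => ft f (2 * Real.pi * w) := by
    ext w
    rw [Real.fourier_congr_ae hG, fourier_indicator]
  have hpi : (2 * Real.pi : ℝ) ≠ 0 := by positivity
  have hFi : Integrable (𝓕 G) := by
    rw [hF]
    exact (integrable_freqMeasure.1 (hf.integrable_ft hN)).comp_mul_left' hpi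
  rw [← hGi.fourierInv_fourier_eq hFi hy, Real.fourierInv_eq', hF, evalAt, integral_freqMeasure]
  have h := Measure.integral_comp_mul_left
    (fun u : ℝ => Complex.exp (Complex.I * (u * y)) * ft f u) (2 * Real.pi)
  rw [abs_of_pos (by positivity)] at h
  rw [← h]
  refine integral_congr_ae (Eventually.of_forall fun w => ?_)
  simp only [smul_eq_mul]
  congr 2
  simp
  ring

/-- Off `[a, b]` the extension by zero vanishes identically, hence so do its derivatives; continuity
carries this to the endpoints. This is how the Dirichlet conditions arise from the bare finiteness
of the energy. -/
lemma FiniteEnergy.evalDeriv_eq_zero (hN : 2 ≤ N) {f : L2 a b} (hf : FiniteEnergy N f) {j : ℕ}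
    (hj : j + 1 ≤ N) {y : ℝ} (hy : y ∉ Set.Ioo a b) : evalDeriv j f y = 0 := by
  have hopen : IsOpen (Set.Icc a b)ᶜ := isClosed_Icc.isOpen_compl
  have key : ∀ y ∈ (Set.Icc a b)ᶜ, evalDeriv j f y = 0 := by
    induction j with
    | zero =>
      intro y hy
      have h0 : ∀ᶠ z in 𝓝 y, (Set.Ioo a b).indicator f z = 0 := by
        filter_upwards [hopen.mem_nhds hy] with z hz
        exact Set.indicator_of_notMem (fun h => hz (Set.Ioo_subset_Icc_self h)) _
      have hc : ContinuousAt ((Set.Ioo a b).indicator f) y :=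
        (continuousAt_const (y := (0 : ℂ))).congr (h0.mono fun z hz => hz.symm)
      rw [evalDeriv_zero, evalAt_eq_of_continuousAt hN hf EventuallyEq.rfl hc]
      exact h0.self_of_nhds
    | succ j ih =>
      intro y hy
      have h0 : evalDeriv j f =ᶠ[𝓝 y] fun _ => (0 : ℂ) := by
        filter_upwards [hopen.mem_nhds hy] with z hz
        exact ih (by omega) z hz
      exact (hf.hasDerivAt_evalDeriv (by omega) y).unique
        ((hasDerivAt_const y (0 : ℂ)).congr_of_eventuallyEq h0)
  have hcl : IsClosed {y | evalDeriv j f y = 0} :=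
    isClosed_eq (hf.continuous_evalDeriv hj) continuous_const
  refine hcl.closure_subset_iff.2 key ?_
  rwa [closure_compl, interior_Icc]

lemma boundary_integrand (f : L2 a b) (j : ℕ) (u y : ℝ) :
    conj (ft f u) * ((Complex.I * u) ^ j * Complex.exp (-(Complex.I * (u * y)))) =
      (-1) ^ j * conj ((Complex.I * u) ^ j * Complex.exp (Complex.I * (u * y)) * ft f u) := by
  rw [map_mul, map_mul, conj_exp_I_mul, map_pow, map_mul, Complex.conj_I, Complex.conj_ofReal,
    neg_mul, neg_pow (Complex.I * (u : ℂ))]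
  have : ((-1 : ℂ)) ^ j * (-1) ^ j = 1 := by rw [← mul_pow]; simp
  linear_combination (-(conj (ft f u) * ((Complex.I * u) ^ j *
    Complex.exp (-(Complex.I * (u * y)))))) * this

lemma FiniteEnergy.integrable_boundary {f : L2 a b} (hf : FiniteEnergy N f) {j : ℕ}
    (hj : j + 1 ≤ N) (y : ℝ) : Integrable (fun u : ℝ => conj (ft f u) *
      ((Complex.I * u) ^ j * Complex.exp (-(Complex.I * (u * y))))) freqMeasure := by
  simp only [boundary_integrand]
  exact (Complex.conjCLE.toContinuousLinearMap.integrable_comp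
    (hf.integrable_evalDeriv hj y)).const_mul _

lemma FiniteEnergy.integral_boundary (hN : 2 ≤ N) {f : L2 a b} (hf : FiniteEnergy N f) {j : ℕ}
    (hj : j + 1 ≤ N) {y : ℝ} (hy : y ∉ Set.Ioo a b) : ∫ u : ℝ, conj (ft f u) *
      ((Complex.I * u) ^ j * Complex.exp (-(Complex.I * (u * y)))) ∂freqMeasure = 0 := by
  simp only [boundary_integrand]
  rw [integral_const_mul, integral_conj]
  have := hf.evalDeriv_eq_zero hN hj hy
  rw [evalDeriv] at this
  rw [this, map_zero, mul_zero]

/-- Functions of finite energy have a trace zero: integrating by parts `N` times against them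
produces no boundary terms. -/
lemma FiniteEnergy.integral_conj_ft_mul (hab : a ≤ b) (hN : 2 ≤ N) {f : L2 a b}
    (hf : FiniteEnergy N f) {w : ℝ → ℂ} (hw : ContDiff ℝ ∞ w) :
    ∫ u : ℝ, conj (ft f u) * ((Complex.I * u) ^ N * ft (toL2 a b w) u) ∂freqMeasure =
      inner ℂ f (toL2 a b (iteratedDeriv N w)) := by
  have hi : ∀ j ∈ Finset.range N, Integrable (fun u : ℝ =>
      conj (ft f u) * ((Complex.I * u) ^ (N - 1 - j) * Complex.exp (-(Complex.I * (u * b)))) *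
        iteratedDeriv j w b -
      conj (ft f u) * ((Complex.I * u) ^ (N - 1 - j) * Complex.exp (-(Complex.I * (u * a)))) *
        iteratedDeriv j w a) freqMeasure := fun j hj =>
    ((hf.integrable_boundary (by omega) b).mul_const _).sub'
      ((hf.integrable_boundary (by omega) a).mul_const _)
  have e : ∀ u : ℝ, conj (ft f u) * ((Complex.I * u) ^ N * ft (toL2 a b w) u) =
      conj (ft f u) * ft (toL2 a b (iteratedDeriv N w)) u - ∑ j ∈ Finset.range N,
      (conj (ft f u) * ((Complex.I * u) ^ (N - 1 - j) * Complex.exp (-(Complex.I * (u * b)))) *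
        iteratedDeriv j w b -
      conj (ft f u) * ((Complex.I * u) ^ (N - 1 - j) * Complex.exp (-(Complex.I * (u * a)))) *
        iteratedDeriv j w a) := fun u => by
    rw [I_mul_pow_ft hab hw, mul_sub, Finset.mul_sum]
    congr 1
    refine Finset.sum_congr rfl fun j _ => ?_
    ring
  simp only [e]
  rw [integral_sub (integrable_conj_ft_mul_ft _ _) (integrable_finsetSum _ hi), parseval,
    integral_finsetSum _ hi, Finset.sum_eq_zero, sub_zero]
  -- Each boundary term is a trace of `f` of order `N - 1 - j`, so only orders below `N` occur and
  -- all of them vanish.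
  intro j hj
  have hj' := Finset.mem_range.1 hj
  rw [integral_sub ((hf.integrable_boundary (by omega) b).mul_const _)
      ((hf.integrable_boundary (by omega) a).mul_const _),
    integral_mul_const, integral_mul_const, hf.integral_boundary hN (by omega) (by simp),
    hf.integral_boundary hN (by omega) (by simp)]
  simp

end PseudoBM

namespace PseudoBM

open ComplexConjugate
open scoped ContDiff

variable {a b : ℝ} {N : ℕ}

/-! ### Functions with Dirichlet boundary conditions -/

/-- Smooth functions which vanish to order `N` at `a` and `b`. -/
structure IsDirichlet (N : ℕ) (a b : ℝ) (v : ℝ → ℂ) : Prop where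
  contDiff : ContDiff ℝ ∞ v
  left : ∀ j < N, iteratedDeriv j v a = 0
  right : ∀ j < N, iteratedDeriv j v b = 0

/-- The differential operator `(-1)^N d^(2N)/dx^(2N)`. -/
def diffOp (N : ℕ) (v : ℝ → ℂ) (y : ℝ) : ℂ := (-1) ^ N * iteratedDeriv (2 * N) v y

lemma continuous_diffOp {v : ℝ → ℂ} (hv : ContDiff ℝ ∞ v) : Continuous (diffOp N v) :=
  (continuous_iteratedDeriv hv _).const_mul _

namespace IsDirichlet

variable {v : ℝ → ℂ}

lemma continuous (hv : IsDirichlet N a b v) : Continuous v := hv.contDiff.continuous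

lemma ft_iteratedDeriv (hv : IsDirichlet N a b v) (hab : a ≤ b) (u : ℝ) :
    ft (toL2 a b (iteratedDeriv N v)) u = (Complex.I * u) ^ N * ft (toL2 a b v) u := by
  rw [I_mul_pow_ft hab hv.contDiff, Finset.sum_eq_zero, sub_zero]
  intro j hj
  rw [hv.left j (Finset.mem_range.1 hj), hv.right j (Finset.mem_range.1 hj)]
  simp

lemma finiteEnergy (hv : IsDirichlet N a b v) (hab : a ≤ b) : FiniteEnergy N (toL2 a b v) := by
  refine ((plancherel (toL2 a b v)).1.add (plancherel (toL2 a b (iteratedDeriv N v))).1).congr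
    (Eventually.of_forall fun u => ?_)
  simp only [Pi.add_apply, hv.ft_iteratedDeriv hab, norm_mul, norm_pow, Complex.norm_I, one_mul,
    Complex.norm_real, Real.norm_eq_abs]
  rw [mul_pow, ← pow_mul, mul_comm N, pow_mul |u|, sq_abs, ← pow_mul]
  ring

lemma pow_mul_ft (hv : IsDirichlet N a b v) (hab : a ≤ b) (u : ℝ) :
    (u : ℂ) ^ (2 * N) * ft (toL2 a b v) u =
      (-1) ^ N * ((Complex.I * u) ^ N * ft (toL2 a b (iteratedDeriv N v)) u) := by
  rw [hv.ft_iteratedDeriv hab]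
  have h : (-1 : ℂ) ^ N * ((Complex.I * u) ^ N * (Complex.I * u) ^ N) = (u : ℂ) ^ (2 * N) := by
    rw [← mul_pow, ← mul_pow, pow_mul]
    congr 1
    linear_combination (-(u : ℂ) ^ 2) * Complex.I_sq
  rw [← h]
  ring

/-- Green's formula. The first `N` derivatives cross to the Fourier side because `v` vanishes to
order `N` at the ends, the other `N` because the traces of `f` vanish. -/
lemma inner_diffOp (hv : IsDirichlet N a b v) (hab : a ≤ b) (hN : 2 ≤ N) {f : L2 a b}
    (hf : FiniteEnergy N f) :
    ∫ u : ℝ, conj (ft f u) * ((u : ℂ) ^ (2 * N) * ft (toL2 a b v) u) ∂freqMeasure =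
      inner ℂ f (toL2 a b (diffOp N v)) := by
  simp only [hv.pow_mul_ft hab, mul_left_comm _ ((-1 : ℂ) ^ N)]
  rw [integral_const_mul, hf.integral_conj_ft_mul hab hN (contDiff_iteratedDeriv hv.contDiff N),
    iteratedDeriv_iteratedDeriv, ← two_mul, ← inner_smul_right,
    ← toL2_const_mul (continuous_iteratedDeriv hv.contDiff _)]
  rfl

lemma evalAt_eq (hv : IsDirichlet N a b v) (hab : a ≤ b) (hN : 2 ≤ N) {x : ℝ}
    (hx : x ∈ Set.Ioo a b) : evalAt x (toL2 a b v) = v x := by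
  have h1 : (Set.Ioo a b).indicator v =ᵐ[volume] (Set.Ioo a b).indicator (toL2 a b v) := by
    filter_upwards [(ae_restrict_iff' measurableSet_Ioo).1
      (coeFn_toL2 (a := a) (b := b) hv.continuous)] with y hy
    by_cases h : y ∈ Set.Ioo a b
    · rw [Set.indicator_of_mem h, Set.indicator_of_mem h, hy h]
    · rw [Set.indicator_of_notMem h, Set.indicator_of_notMem h]
  rw [evalAt_eq_of_continuousAt hN (hv.finiteEnergy hab) h1, Set.indicator_of_mem hx]
  refine hv.continuous.continuousAt.congr ?_
  filter_upwards [isOpen_Ioo.mem_nhds hx] with y hy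
  rw [Set.indicator_of_mem hy]

end IsDirichlet

lemma FiniteEnergy.integrable_cross {f g : L2 a b} (hf : FiniteEnergy N f)
    (hg : FiniteEnergy N g) :
    Integrable (fun u : ℝ => conj (ft f u) * ((u : ℂ) ^ (2 * N) * ft g u)) freqMeasure := by
  have h1 := continuous_ft f
  have h2 := continuous_ft g
  have h3 : Continuous fun u => conj (ft f u) := Complex.continuous_conj.comp h1
  refine (hf.add hg).mono' (Continuous.aestronglyMeasurable (by fun_prop))
    (Eventually.of_forall fun u => ?_)
  have h4 := even_pow_nonneg N u
  have h5 : ‖(u : ℂ) ^ (2 * N)‖ = u ^ (2 * N) := by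
    rw [← Complex.ofReal_pow, Complex.norm_real, Real.norm_of_nonneg h4]
  rw [norm_mul, norm_mul, h5, RCLike.norm_conj]
  simp only [Pi.add_apply]
  nlinarith [sq_nonneg (‖ft f u‖ - ‖ft g u‖), norm_nonneg (ft f u), norm_nonneg (ft g u),
    mul_nonneg h4 (sq_nonneg (‖ft f u‖ - ‖ft g u‖)), sq_nonneg ‖ft f u‖, sq_nonneg ‖ft g u‖,
    mul_nonneg h4 (sq_nonneg ‖ft f u‖), mul_nonneg h4 (sq_nonneg ‖ft g u‖)]

lemma energy_sub {f g : L2 a b} (hf : FiniteEnergy N f) (hg : FiniteEnergy N g) :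
    FiniteEnergy N (f - g) ∧ energy N (f - g) = energy N f + energy N g -
      2 * (inner ℂ f g + ∫ u : ℝ, conj (ft f u) * ((u : ℂ) ^ (2 * N) * ft g u) ∂freqMeasure).re := by
  have i1 := integrable_conj_ft_mul_ft f g
  have i2 := hf.integrable_cross hg
  have i3 : Integrable (fun u : ℝ => conj (ft f u) * ft g u +
    conj (ft f u) * ((u : ℂ) ^ (2 * N) * ft g u)) freqMeasure := i1.add i2
  have e : ∀ u : ℝ, (1 + u ^ (2 * N)) * ‖ft (f - g) u‖ ^ 2 =
      (1 + u ^ (2 * N)) * ‖ft f u‖ ^ 2 + (1 + u ^ (2 * N)) * ‖ft g u‖ ^ 2 -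
        2 * (conj (ft f u) * ft g u + conj (ft f u) * ((u : ℂ) ^ (2 * N) * ft g u)).re := fun u => by
    have e1 : conj (ft f u) * ft g u + conj (ft f u) * ((u : ℂ) ^ (2 * N) * ft g u) =
        ((1 + u ^ (2 * N) : ℝ) : ℂ) * (conj (ft f u) * ft g u) := by push_cast; ring
    rw [e1, Complex.re_ofReal_mul, ft_sub, ← Complex.normSq_eq_norm_sq, ← Complex.normSq_eq_norm_sq,
      ← Complex.normSq_eq_norm_sq, Complex.normSq_apply, Complex.normSq_apply, Complex.normSq_apply]
    simp
    ring
  have i4 : Integrable (fun u : ℝ => (1 + u ^ (2 * N)) * ‖ft f u‖ ^ 2 +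
      (1 + u ^ (2 * N)) * ‖ft g u‖ ^ 2) freqMeasure := hf.add hg
  have i5 : Integrable (fun u : ℝ => 2 * (conj (ft f u) * ft g u +
      conj (ft f u) * ((u : ℂ) ^ (2 * N) * ft g u)).re) freqMeasure := i3.re.const_mul 2
  have h1 : FiniteEnergy N (f - g) := by
    unfold FiniteEnergy
    simp only [e]
    exact i4.sub i5
  refine ⟨h1, ?_⟩
  have h2 : ∫ u : ℝ, (conj (ft f u) * ft g u +
      conj (ft f u) * ((u : ℂ) ^ (2 * N) * ft g u)).re ∂freqMeasure =
      (inner ℂ f g + ∫ u : ℝ, conj (ft f u) * ((u : ℂ) ^ (2 * N) * ft g u) ∂freqMeasure).re := by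
    rw [← parseval, ← integral_add i1 i2]
    exact integral_re i3
  rw [energy]
  simp only [e]
  rw [integral_sub i4 i5, integral_add hf hg, integral_const_mul, h2]
  rfl

lemma energy_self {f : L2 a b} (hf : FiniteEnergy N f) : energy N f =
    (inner ℂ f f + ∫ u : ℝ, conj (ft f u) * ((u : ℂ) ^ (2 * N) * ft f u) ∂freqMeasure).re := by
  have h := (energy_sub hf hf).2
  have h0 : energy N (f - f) = 0 := by simp [energy, ft]
  linarith

namespace IsDirichlet

variable {v : ℝ → ℂ}

lemma energy_eq (hv : IsDirichlet N a b v) (hab : a ≤ b) (hN : 2 ≤ N) :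
    energy N (toL2 a b v) =
      (inner ℂ (toL2 a b v) (toL2 a b v + toL2 a b (diffOp N v))).re := by
  rw [energy_self (hv.finiteEnergy hab), hv.inner_diffOp hab hN (hv.finiteEnergy hab),
    inner_add_right]

/-- The resolvent inverts the differential operator on functions with Dirichlet boundary
conditions. -/
lemma dirichletResolvent_apply (hv : IsDirichlet N a b v) (hab : a ≤ b) (hN : 2 ≤ N) :
    dirichletResolvent (one_le_of_two_le hN) a b (toL2 a b v + toL2 a b (diffOp N v)) =
      toL2 a b v := by
  have hN1 := one_le_of_two_le hN
  set V := toL2 a b v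
  set g := V + toL2 a b (diffOp N v) with hg
  set f := dirichletResolvent hN1 a b g with hf
  have hVE : FiniteEnergy N V := hv.finiteEnergy hab
  have hspec := dirichletResolvent_spec (a := a) (b := b) hN1
  have hfE := finiteEnergy_dirichletResolvent hN1 g
  -- From the discrete side: expand the form of `B ≥ 1` at `F - V`, where `BF = g` and the form of
  -- `B` at `V` is at most the true energy `⟨V, g⟩`; then let the mesh tend to zero.
  have h1 : ‖f - V‖ ^ 2 ≤ (inner ℂ f g).re - (inner ℂ g V).re := by
    have hlim := hspec.2.1 g
    refine le_of_tendsto_of_tendsto ((hlim.sub_const V).norm.pow 2)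
      (((Complex.continuous_re.tendsto _).comp (hlim.inner tendsto_const_nhds)).sub_const _)
      (Eventually.of_forall fun n => ?_)
    have hU := isUnitOp_stepOp (a := a) (b := b) hN1 (mesh_pos n)
    set T := stepOp a b hN1 (mesh_pos n)
    set F := resolvent T (mesh n) g
    have hBF : genOp T (mesh n) F = g := hU.genOp_resolvent (mesh_pos n) g
    have h2 := hU.norm_sq_le_genOp (mesh_pos n) (F - V)
    have h3 : (inner ℂ V (genOp T (mesh n) V)).re ≤ (inner ℂ V g).re := by
      rw [re_inner_genOp_stepOp, ← hv.energy_eq hab hN]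
      exact integral_mono (integrable_genSymbol (mesh_pos n) V) hVE fun u =>
        mul_le_mul_of_nonneg_right (genSymbol_le (mesh_pos n) u) (sq_nonneg _)
    have h4 : inner ℂ F (genOp T (mesh n) V) = inner ℂ g V := by
      rw [← hU.genOp_inner, hBF]
    rw [map_sub, hBF, inner_sub_left, inner_sub_right, inner_sub_right, h4] at h2
    simp only [Complex.sub_re] at h2
    have h5 := inner_re_comm g V
    simp only [Function.comp_apply]
    linarith
  -- From the limit side: the energy of `f - V` is expanded by Green's formula, using that the
  -- energy of `f` is at most `⟨g, f⟩`. The two bounds have opposite right-hand sides, so `f = V`.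
  have h2 : ‖f - V‖ ^ 2 ≤ (inner ℂ g V).re - (inner ℂ f g).re := by
    obtain ⟨e1, e2⟩ := energy_sub hfE.1 hVE
    have h3 := norm_sq_le_energy e1
    rw [hv.inner_diffOp hab hN hfE.1, ← inner_add_right] at e2
    have h4 := hv.energy_eq hab hN
    have h5 := inner_re_comm g V
    have h6 := inner_re_comm g f
    have h7 := hfE.2
    change energy N V = (inner ℂ V g).re at h4
    change energy N (f - V) = energy N f + energy N V - 2 * (inner ℂ f g).re at e2
    change energy N f ≤ (inner ℂ g f).re at h7
    linarith
  have h3 : ‖f - V‖ ^ 2 = 0 := le_antisymm (by linarith) (sq_nonneg _)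
  exact sub_eq_zero.1 (norm_eq_zero.1 (pow_eq_zero_iff two_ne_zero |>.1 h3))

/-- The operator with Dirichlet boundary conditions has no negative eigenvalue. -/
lemma eq_zero_of_eigen (hv : IsDirichlet N a b v) (hab : a ≤ b) (hN : 2 ≤ N) {lam : ℝ}
    (hlam : 0 < lam) (h : ∀ y ∈ Set.Ioo a b, diffOp N v y = -lam * v y) :
    ∀ y ∈ Set.Ioo a b, v y = 0 := by
  have e : toL2 a b (diffOp N v) = (-lam : ℂ) • toL2 a b v := by
    rw [← toL2_const_mul hv.continuous]
    exact toL2_congr (continuous_diffOp hv.contDiff) (hv.continuous.const_mul _) h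
  have h1 := hv.energy_eq hab hN
  have h2 := norm_sq_le_energy (hv.finiteEnergy hab)
  rw [h1, e, inner_add_right, inner_smul_right, Complex.add_re, inner_self_re, ← Complex.ofReal_neg,
    Complex.re_ofReal_mul, inner_self_re] at h2
  -- The energy of `v` is both at least `‖v‖²` and equal to `(1 - lam)‖v‖²`.
  have h3 : ‖toL2 a b v‖ ^ 2 = 0 := le_antisymm (by nlinarith [sq_nonneg ‖toL2 a b v‖])
    (sq_nonneg _)
  have h4 : toL2 a b v = 0 := norm_eq_zero.1 (pow_eq_zero_iff two_ne_zero |>.1 h3)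
  intro y hy
  rw [← hv.evalAt_eq hab hN hy, h4]
  simp [evalAt, ft]

/-- Test functions satisfy Dirichlet boundary conditions. -/
lemma of_tsupport_subset {v : ℝ → ℂ} (hv : ContDiff ℝ ∞ v) (h : tsupport v ⊆ Set.Ioo a b) :
    IsDirichlet N a b v := by
  have key : ∀ j : ℕ, ∀ y ∉ Set.Ioo a b, iteratedDeriv j v y = 0 := fun j y hy => by
    have h1 : v =ᶠ[𝓝 y] fun _ => 0 := by
      filter_upwards [(isClosed_tsupport v).isOpen_compl.mem_nhds fun hc => hy (h hc)] with z hz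
      exact image_eq_zero_of_notMem_tsupport hz
    rw [h1.iteratedDeriv_eq j]
    simp
  exact ⟨hv, fun j _ => key j a (by simp), fun j _ => key j b (by simp)⟩

end IsDirichlet

/-- Vectors orthogonal to the range lie in the kernel of the self-adjoint `R`. Test functions belong
to the range, so such a vector is orthogonal to all of them and vanishes. -/
lemma denseRange_dirichletResolvent (hab : a ≤ b) (hN : 2 ≤ N) :
    DenseRange (dirichletResolvent (one_le_of_two_le hN) a b) := by
  set R := dirichletResolvent (one_le_of_two_le hN) a b with hR
  have hU : IsUnitOp R := isUnitOp_dirichletResolvent (one_le_of_two_le hN)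
  have h1 : (LinearMap.range (R : L2 a b →ₗ[ℂ] L2 a b)).topologicalClosure = ⊤ := by
    rw [Submodule.topologicalClosure_eq_top_iff, Submodule.eq_bot_iff]
    intro f hf
    have hRf : R f = 0 := by
      refine ext_inner_left ℂ fun g => ?_
      rw [← hU.inner_apply, inner_zero_right]
      exact Submodule.inner_right_of_mem_orthogonal (LinearMap.mem_range_self _ g) hf
    have h0 : ∀ᵐ y, y ∈ Set.Ioo a b → f y = 0 := by
      refine isOpen_Ioo.ae_eq_zero_of_integral_contDiff_smul_eq_zero
        (integrable_L2 f).locallyIntegrableOn fun g hg _ hgs => ?_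
      have hsupp : tsupport (fun y => (g y : ℂ)) ⊆ Set.Ioo a b :=
        (closure_mono fun y hy => by
          simp only [Function.mem_support, ne_eq, Complex.ofReal_eq_zero] at hy ⊢
          exact hy).trans hgs
      have hv : IsDirichlet N a b fun y => (g y : ℂ) :=
        IsDirichlet.of_tsupport_subset (Complex.ofRealCLM.contDiff.comp hg) hsupp
      have h2 : inner ℂ (toL2 a b fun y => (g y : ℂ)) f = 0 := by
        rw [← hv.dirichletResolvent_apply hab hN, hU.inner_apply, hRf, inner_zero_right]
      rw [inner_toL2 hv.continuous] at h2
      rw [← h2, ← integral_indicator measurableSet_Ioo]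
      congr 1 with y
      by_cases hy : y ∈ Set.Ioo a b
      · rw [Set.indicator_of_mem hy, Complex.conj_ofReal, Complex.real_smul]
      · rw [Set.indicator_of_notMem hy,
          image_eq_zero_of_notMem_tsupport fun h => hy (hgs h), zero_smul]
    exact (Lp.eq_zero_iff_ae_eq_zero).2 ((ae_restrict_iff' measurableSet_Ioo).2 h0)
  exact Submodule.dense_iff_topologicalClosure_eq_top.2 h1

end PseudoBM

namespace PseudoBM

open ComplexConjugate
open scoped ContDiff

variable {a b : ℝ} {N : ℕ}

/-! ### Windowed Fourier transforms -/

/-- The Fourier transform of `f`, localized by the window `χ`. -/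
def windowFt (χ : ℝ → ℂ) (f : L2 a b) (u : ℝ) : ℂ :=
  inner ℂ (toL2 a b fun y => χ y * Complex.exp (Complex.I * (u * y))) f

lemma continuous_window {χ : ℝ → ℂ} (hχ : Continuous χ) (u : ℝ) :
    Continuous fun y : ℝ => χ y * Complex.exp (Complex.I * (u * y)) :=
  hχ.mul (continuous_exp_I_mul u)

lemma exists_bound_Ioo {χ : ℝ → ℂ} (hχ : Continuous χ) (a b : ℝ) :
    ∃ C : ℝ, 0 ≤ C ∧ ∀ y ∈ Set.Ioo a b, ‖χ y‖ ≤ C := by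
  obtain ⟨C, hC⟩ := isCompact_Icc.exists_bound_of_continuousOn (s := Set.Icc a b) hχ.continuousOn
  exact ⟨max C 0, le_max_right _ _, fun y hy =>
    (hC y (Set.Ioo_subset_Icc_self hy)).trans (le_max_left _ _)⟩

lemma exists_norm_windowFt_le {χ : ℝ → ℂ} (hχ : Continuous χ) (a b : ℝ) :
    ∃ C : ℝ, 0 ≤ C ∧ ∀ (f : L2 a b) (u : ℝ), ‖windowFt χ f u‖ ≤ C * ‖f‖ := by
  obtain ⟨C, hC, h⟩ := exists_bound_Ioo hχ a b
  refine ⟨boundConst a b * C, mul_nonneg boundConst_nonneg hC, fun f u => ?_⟩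
  refine (norm_inner_le_norm _ _).trans ?_
  gcongr
  refine norm_toL2_le (continuous_window hχ u) hC fun y hy => ?_
  rw [norm_mul, norm_exp_I_mul, mul_one]
  exact h y hy

lemma windowFt_eq {χ : ℝ → ℂ} (hχ : Continuous χ) (f : L2 a b) (u : ℝ) : windowFt χ f u =
    ∫ y in Set.Ioo a b, Complex.exp (-(Complex.I * (u * y))) * (conj (χ y) * f y) := by
  rw [windowFt, inner_toL2 (continuous_window hχ u)]
  refine integral_congr_ae (Eventually.of_forall fun y => ?_)
  simp only [map_mul, conj_exp_I_mul]
  ring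

lemma integrable_window {χ : ℝ → ℂ} (hχ : Continuous χ) (f : L2 a b) :
    IntegrableOn (fun y => conj (χ y) * f y) (Set.Ioo a b) := by
  obtain ⟨C, hC, h⟩ := exists_bound_Ioo hχ a b
  refine (integrable_L2 f).bdd_mul (c := C)
    (Complex.continuous_conj.comp hχ).aestronglyMeasurable ?_
  filter_upwards [ae_restrict_mem measurableSet_Ioo] with y hy
  rw [RCLike.norm_conj]
  exact h y hy

lemma continuous_windowFt {χ : ℝ → ℂ} (hχ : Continuous χ) (f : L2 a b) :
    Continuous (windowFt χ f) := by
  rw [funext (windowFt_eq hχ f)]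
  have h := integrable_window hχ f
  refine continuous_of_dominated (bound := fun y => ‖conj (χ y) * f y‖)
    (fun u => (Continuous.aestronglyMeasurable (by fun_prop)).mul h.aestronglyMeasurable)
    (fun u => Eventually.of_forall fun y => ?_) h.norm (Eventually.of_forall fun y => by fun_prop)
  rw [norm_mul, norm_exp_neg_I_mul, one_mul]

lemma kernelDeriv_sub (k : ℕ) (t x y : ℝ) : kernelDeriv N k t (x - y) =
    ∫ u : ℝ, Complex.exp (-(Complex.I * (u * y))) * ((Complex.I * u) ^ k *
      Complex.exp (Complex.I * (u * x)) * heatSymbol N t u) ∂freqMeasure := by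
  rw [kernelDeriv]
  congr 1 with u
  have : Complex.exp (Complex.I * (u * (x - y : ℝ))) =
      Complex.exp (Complex.I * (u * x)) * Complex.exp (-(Complex.I * (u * y))) := by
    rw [← Complex.exp_add]
    congr 1
    push_cast
    ring
  rw [this]
  ring

/-- Integrating a windowed Fourier transform against a heat multiplier. -/
lemma integral_heatSymbol_windowFt (hN : 1 ≤ N) {t : ℝ} (ht : 0 < t) {χ : ℝ → ℂ}
    (hχ : Continuous χ) (f : L2 a b) (k : ℕ) (x : ℝ) :
    ∫ u : ℝ, (Complex.I * u) ^ k * Complex.exp (Complex.I * (u * x)) * heatSymbol N t u *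
        windowFt χ f u ∂freqMeasure =
      ∫ y in Set.Ioo a b, kernelDeriv N k t (x - y) * (conj (χ y) * f y) := by
  simp only [windowFt_eq hχ, kernelDeriv_sub, ← integral_mul_const, ← integral_const_mul]
  rw [integral_integral_swap]
  · congr 1 with u
    congr 1 with z
    ring
  · have h1 := (integrable_kernelDeriv hN k ht x).mul_prod (integrable_window hχ f)
    have h2 := h1.bdd_mul (c := 1) (f := fun p : ℝ × ℝ =>
      Complex.exp (-(Complex.I * (p.1 * p.2)))) (by fun_prop)
      (Eventually.of_forall fun p => (norm_exp_neg_I_mul _ _).le)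
    refine h2.congr (Eventually.of_forall fun p => ?_)
    simp only [Function.uncurry]
    ring

/-- The window vanishes within distance `r` of `x`, so only the values of `K` off the diagonal
enter; the rest is Cauchy–Schwarz. -/
lemma norm_integral_window_le {χ : ℝ → ℂ} (hχ : Continuous χ) {K : ℝ → ℂ} (hK : Continuous K)
    {x r B C : ℝ} (hB : 0 ≤ B) (hC : 0 ≤ C) (hχC : ∀ y ∈ Set.Ioo a b, ‖χ y‖ ≤ C)
    (hχ0 : ∀ y, |x - y| < r → χ y = 0) (hKB : ∀ z, r ≤ |z| → ‖K z‖ ≤ B) (f : L2 a b) :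
    ‖∫ y in Set.Ioo a b, K (x - y) * (conj (χ y) * f y)‖ ≤ boundConst a b * (C * B) * ‖f‖ := by
  have hc : Continuous fun y => χ y * conj (K (x - y)) :=
    hχ.mul (Complex.continuous_conj.comp (hK.comp (continuous_const.sub continuous_id)))
  have e : ∫ y in Set.Ioo a b, K (x - y) * (conj (χ y) * f y) =
      inner ℂ (toL2 a b fun y => χ y * conj (K (x - y))) f := by
    rw [inner_toL2 hc]
    refine integral_congr_ae (Eventually.of_forall fun y => ?_)
    simp only [map_mul, Complex.conj_conj]
    ring
  rw [e]
  refine (norm_inner_le_norm _ _).trans ?_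
  gcongr
  refine norm_toL2_le hc (by positivity) fun y hy => ?_
  rw [norm_mul, RCLike.norm_conj]
  rcases lt_or_ge |x - y| r with h | h
  · rw [hχ0 y h, norm_zero, zero_mul]
    positivity
  · have := hχC y hy
    have := hKB _ h
    gcongr

lemma hasDerivAt_heatSymbol (N : ℕ) (t u : ℝ) :
    HasDerivAt (fun t => heatSymbol N t u) (-(u ^ (2 * N)) * heatSymbol N t u) t := by
  have := ((hasDerivAt_id t).fun_neg.mul_const (u ^ (2 * N))).exp
  simp only [id] at this
  convert! this using 1
  unfold heatSymbol
  ring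

lemma heatSymbol_antitone (N : ℕ) {s t : ℝ} (h : s ≤ t) (u : ℝ) :
    heatSymbol N t u ≤ heatSymbol N s u := by
  have := even_pow_nonneg N u
  unfold heatSymbol
  gcongr

lemma norm_kernelDeriv_integrand (k : ℕ) (t r u : ℝ) :
    ‖(Complex.I * u) ^ k * Complex.exp (Complex.I * (u * r)) * (heatSymbol N t u : ℂ)‖ =
      |u| ^ k * heatSymbol N t u := by
  rw [norm_mul, norm_mul, norm_exp_I_mul, norm_pow, norm_mul, Complex.norm_I, Complex.norm_real,
    Complex.norm_real, Real.norm_of_nonneg (heatSymbol_pos _ _ _).le, one_mul, mul_one,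
    Real.norm_eq_abs]

lemma integrable_abs_pow_mul_heatSymbol (hN : 1 ≤ N) (k : ℕ) {t : ℝ} (ht : 0 < t) :
    Integrable (fun u : ℝ => |u| ^ k * heatSymbol N t u) freqMeasure := by
  refine (integrable_kernelDeriv hN k ht 0).norm.congr (Eventually.of_forall fun u => ?_)
  exact norm_kernelDeriv_integrand k t 0 u

/-- The heat equation for the kernel. -/
lemma hasDerivAt_kernelDeriv_time (hN : 1 ≤ N) (k : ℕ) {t : ℝ} (ht : 0 < t) (r : ℝ) :
    HasDerivAt (fun t => kernelDeriv N k t r) (-(-1) ^ N * kernelDeriv N (k + 2 * N) t r) t := by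
  have h := (hasDerivAt_integral_of_dominated_loc_of_deriv_le (s := Set.Ioi (t / 2))
    (F := fun t (u : ℝ) => (Complex.I * u) ^ k * Complex.exp (Complex.I * (u * r)) *
      (heatSymbol N t u : ℂ))
    (F' := fun t (u : ℝ) => -(-1) ^ N * ((Complex.I * u) ^ (k + 2 * N) *
      Complex.exp (Complex.I * (u * r)) * (heatSymbol N t u : ℂ)))
    (μ := freqMeasure) (x₀ := t) (Ioi_mem_nhds (half_lt_self ht))
    ((lt_mem_nhds ht).mono fun s hs => (integrable_kernelDeriv hN k hs r).aestronglyMeasurable)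
    (integrable_kernelDeriv hN k ht r)
    ((integrable_kernelDeriv hN (k + 2 * N) ht r).const_mul _).aestronglyMeasurable
    (bound := fun u => |u| ^ (k + 2 * N) * heatSymbol N (t / 2) u)
    (Eventually.of_forall fun u s hs => ?_)
    (integrable_abs_pow_mul_heatSymbol hN _ (half_pos ht))
    (Eventually.of_forall fun u s hs => ?_)).2
  · rw [integral_const_mul] at h
    exact h
  · rw [norm_mul, norm_kernelDeriv_integrand]
    have : ‖(-(-1) ^ N : ℂ)‖ = 1 := by simp
    rw [this, one_mul]
    have := heatSymbol_antitone N (le_of_lt hs) u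
    gcongr
  · have h1 := ((hasDerivAt_heatSymbol N s u).ofReal_comp).const_mul
      ((Complex.I * u) ^ k * Complex.exp (Complex.I * (u * r)))
    convert! h1 using 1
    have h2 : (-1 : ℂ) ^ N * (Complex.I * u) ^ (2 * N) = (u : ℂ) ^ (2 * N) := by
      rw [pow_mul, ← mul_pow, pow_mul]
      congr 1
      linear_combination (-(u : ℂ) ^ 2) * Complex.I_sq
    push_cast
    rw [← h2, pow_add]
    ring

/-- Off the diagonal, the derivatives of the heat kernel are bounded and Lipschitz in time. -/
lemma exists_kernelDeriv_bound (hN : 1 ≤ N) (k : ℕ) {r : ℝ} (hr : 0 < r) :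
    ∃ C : ℝ, 0 ≤ C ∧ (∀ t : ℝ, 0 < t → ∀ z : ℝ, r ≤ |z| → ‖kernelDeriv N k t z‖ ≤ C) ∧
      ∀ s t : ℝ, 0 < s → 0 < t → ∀ z : ℝ, r ≤ |z| →
        ‖kernelDeriv N k s z - kernelDeriv N k t z‖ ≤ C * |s - t| := by
  have key : ∀ k : ℕ, ∃ C : ℝ, 0 ≤ C ∧
      ∀ t : ℝ, 0 < t → ∀ z : ℝ, r ≤ |z| → ‖kernelDeriv N k t z‖ ≤ C := fun k => by
    obtain ⟨C, hC, h⟩ := kernelDeriv_off_diagonal hN k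
    refine ⟨C / r ^ (k + 1), by positivity, fun t ht z hz => ?_⟩
    rw [le_div_iff₀ (by positivity), mul_comm]
    refine le_trans ?_ (h t ht z)
    gcongr
  obtain ⟨C1, hC1, h1⟩ := key k
  obtain ⟨C2, hC2, h2⟩ := key (k + 2 * N)
  refine ⟨max C1 C2, hC1.trans (le_max_left _ _), fun t ht z hz =>
    (h1 t ht z hz).trans (le_max_left _ _), fun s t hs ht z hz => ?_⟩
  -- By the heat equation the time derivative is, up to sign, the space derivative of order `k +
  -- 2N`, for which the same off-diagonal bound holds.
  have h3 := (convex_Ioi (0 : ℝ)).norm_image_sub_le_of_norm_hasDerivWithin_le (C := max C1 C2)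
    (fun τ hτ => (hasDerivAt_kernelDeriv_time hN k hτ z).hasDerivWithinAt)
    (fun τ hτ => by
      rw [norm_mul]
      have : ‖(-(-1) ^ N : ℂ)‖ = 1 := by simp
      rw [this, one_mul]
      exact (h2 τ hτ z hz).trans (le_max_right _ _)) ht hs
  exact h3

/-- Windowed heat kernels with the window supported off the diagonal. -/
lemma exists_window_bound (hN : 1 ≤ N) {χ : ℝ → ℂ} (hχ : Continuous χ) (k : ℕ) {x r : ℝ}
    (hr : 0 < r) (hχ0 : ∀ y, |x - y| < r → χ y = 0) (a b : ℝ) :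
    ∃ C : ℝ, 0 ≤ C ∧ (∀ t : ℝ, 0 < t → ∀ f : L2 a b,
      ‖∫ u : ℝ, (Complex.I * u) ^ k * Complex.exp (Complex.I * (u * x)) * heatSymbol N t u *
        windowFt χ f u ∂freqMeasure‖ ≤ C * ‖f‖) ∧
      ∀ s t : ℝ, 0 < s → 0 < t → ∀ f : L2 a b,
      ‖(∫ u : ℝ, (Complex.I * u) ^ k * Complex.exp (Complex.I * (u * x)) * heatSymbol N s u *
        windowFt χ f u ∂freqMeasure) - ∫ u : ℝ, (Complex.I * u) ^ k *
        Complex.exp (Complex.I * (u * x)) * heatSymbol N t u *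
        windowFt χ f u ∂freqMeasure‖ ≤ C * |s - t| * ‖f‖ := by
  obtain ⟨B, hB, h1, h2⟩ := exists_kernelDeriv_bound hN k hr
  obtain ⟨C, hC, h3⟩ := exists_bound_Ioo hχ a b
  refine ⟨boundConst a b * (C * B), mul_nonneg boundConst_nonneg (by positivity),
    fun t ht f => ?_, fun s t hs ht f => ?_⟩
  · rw [integral_heatSymbol_windowFt hN ht hχ]
    exact norm_integral_window_le hχ (continuous_kernelDeriv hN k ht) hB hC h3 hχ0 (h1 t ht) f
  · have hi : ∀ t : ℝ, 0 < t → IntegrableOn (fun y => kernelDeriv N k t (x - y) *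
        (conj (χ y) * f y)) (Set.Ioo a b) := fun t ht => by
      obtain ⟨D, _, hD⟩ := exists_bound_Ioo
        ((continuous_kernelDeriv hN k ht).comp (continuous_sub_left x)) a b
      refine (integrable_window hχ f).bdd_mul (c := D)
        ((continuous_kernelDeriv hN k ht).comp (continuous_sub_left x)).aestronglyMeasurable ?_
      filter_upwards [ae_restrict_mem measurableSet_Ioo] with y hy
      exact hD y hy
    rw [integral_heatSymbol_windowFt hN hs hχ, integral_heatSymbol_windowFt hN ht hχ,
      ← integral_sub (hi s hs) (hi t ht)]
    simp only [← sub_mul]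
    have := norm_integral_window_le (a := a) (b := b) hχ
      (K := fun z => kernelDeriv N k s z - kernelDeriv N k t z)
      ((continuous_kernelDeriv hN k hs).sub (continuous_kernelDeriv hN k ht))
      (mul_nonneg hB (abs_nonneg (s - t))) hC h3 hχ0 (h2 s t hs ht) f
    refine this.trans (le_of_eq ?_)
    ring

end PseudoBM

namespace PseudoBM

open ComplexConjugate
open scoped ContDiff

variable {a b : ℝ} {N : ℕ}

/-! ### Regularity in time of the semigroup in the interior -/

/-- A smooth cut-off function around `x`. -/
structure IsWindow (a b x r : ℝ) (ψ : ℝ → ℝ) : Prop where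
  contDiff : ContDiff ℝ ∞ ψ
  tsupport_subset : tsupport ψ ⊆ Set.Ioo a b
  radius_pos : 0 < r
  eq_one : ∀ y, |x - y| < r → ψ y = 1

lemma exists_isWindow {x : ℝ} (hx : x ∈ Set.Ioo a b) : ∃ r ψ, IsWindow a b x r ψ := by
  obtain ⟨ε, hε, h⟩ := Metric.isOpen_iff.1 isOpen_Ioo x hx
  let f : ContDiffBump x := ⟨ε / 4, ε / 2, by positivity, by linarith⟩
  refine ⟨ε / 4, f, f.contDiff, ?_, by positivity, fun y hy => ?_⟩
  · rw [f.tsupport_eq]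
    exact (Metric.closedBall_subset_ball (half_lt_self hε)).trans h
  · refine f.one_of_mem_closedBall ?_
    rw [Metric.mem_closedBall, Real.dist_eq, abs_sub_comm]
    exact hy.le

namespace IsWindow

variable {x r : ℝ} {ψ : ℝ → ℝ}

lemma contDiff_ofReal (hψ : IsWindow a b x r ψ) : ContDiff ℝ ∞ fun y => (ψ y : ℂ) :=
  Complex.ofRealCLM.contDiff.comp hψ.contDiff

lemma isDirichlet_mul (hψ : IsWindow a b x r ψ) {w : ℝ → ℂ} (hw : ContDiff ℝ ∞ w) :
    IsDirichlet N a b fun y => (ψ y : ℂ) * w y := by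
  refine IsDirichlet.of_tsupport_subset (hψ.contDiff_ofReal.mul hw) (subset_trans ?_
    hψ.tsupport_subset)
  refine closure_mono fun y hy => ?_
  simp only [Function.mem_support, ne_eq, mul_eq_zero, Complex.ofReal_eq_zero, not_or] at hy ⊢
  exact hy.1

end IsWindow

lemma contDiff_exp_I_mul (u : ℝ) :
    ContDiff ℝ ∞ fun y : ℝ => Complex.exp (Complex.I * (u * y)) := by
  have h : ContDiff ℝ ∞ fun y : ℝ => (y : ℂ) := Complex.ofRealCLM.contDiff
  exact (contDiff_const.mul (contDiff_const.mul h)).cexp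

lemma iteratedDeriv_exp_I_mul (n : ℕ) (u : ℝ) :
    iteratedDeriv n (fun y : ℝ => Complex.exp (Complex.I * (u * y))) =
      fun y : ℝ => (Complex.I * u) ^ n * Complex.exp (Complex.I * (u * y)) := by
  induction n with
  | zero => simp
  | succ n ih =>
    rw [iteratedDeriv_succ, ih]
    ext y
    have h1 : HasDerivAt (fun y : ℝ => Complex.I * (u * (y : ℂ))) (Complex.I * u) y := by
      have := ((hasDerivAt_id y).ofReal_comp.const_mul (u : ℂ)).const_mul Complex.I
      simpa using this
    rw [(h1.cexp.const_mul ((Complex.I * u) ^ n)).deriv]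
    ring

/-- The lower order coefficients of the commutator of the operator with multiplication by `ψ`. -/
def commCoeff (N : ℕ) (ψ : ℝ → ℝ) (i : ℕ) (y : ℝ) : ℂ :=
  (-1) ^ N * ((2 * N).choose i : ℂ) * iteratedDeriv (2 * N - i) (fun y => (ψ y : ℂ)) y

section Window

variable {x r : ℝ} {ψ : ℝ → ℝ}

lemma continuous_commCoeff (hψ : IsWindow a b x r ψ) (i : ℕ) : Continuous (commCoeff N ψ i) :=
  (continuous_iteratedDeriv hψ.contDiff_ofReal _).const_mul _

/-- For `i < 2N` at least one derivative falls on `ψ`, which is constant near `x`. Hence the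
commutator never meets the singularity of the heat kernel at `x`. -/
lemma commCoeff_eq_zero (hψ : IsWindow a b x r ψ) {i : ℕ} (hi : i < 2 * N) (y : ℝ)
    (hy : |x - y| < r) : commCoeff N ψ i y = 0 := by
  have h1 : (fun y => (ψ y : ℂ)) =ᶠ[𝓝 y] fun _ => (1 : ℂ) := by
    have ho : IsOpen {y | |x - y| < r} := isOpen_lt (by fun_prop) continuous_const
    filter_upwards [ho.mem_nhds hy] with z hz
    rw [hψ.eq_one z hz, Complex.ofReal_one]
  rw [commCoeff, h1.iteratedDeriv_eq, iteratedDeriv_const, if_neg (by omega), mul_zero]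

lemma diffOp_window (hψ : IsWindow a b x r ψ) (u y : ℝ) :
    diffOp N (fun y => (ψ y : ℂ) * Complex.exp (Complex.I * (u * y))) y =
      (u : ℂ) ^ (2 * N) * ((ψ y : ℂ) * Complex.exp (Complex.I * (u * y))) +
      ∑ i ∈ Finset.range (2 * N), (Complex.I * u) ^ i *
        (commCoeff N ψ i y * Complex.exp (Complex.I * (u * y))) := by
  have hcomm : (fun y : ℝ => (ψ y : ℂ) * Complex.exp (Complex.I * (u * y))) =
      fun y : ℝ => Complex.exp (Complex.I * (u * y)) * (ψ y : ℂ) := by ext; ring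
  rw [diffOp, hcomm, iteratedDeriv_fun_mul (contDiff_infty.1 (contDiff_exp_I_mul u) _).contDiffAt
    (contDiff_infty.1 hψ.contDiff_ofReal _).contDiffAt, Finset.sum_range_succ, mul_add,
    Finset.mul_sum, add_comm]
  congr 1
  · rw [iteratedDeriv_exp_I_mul]
    simp only [Nat.choose_self, Nat.cast_one, one_mul, tsub_self, iteratedDeriv_zero]
    have h2 : (-1 : ℂ) ^ N * (Complex.I * u) ^ (2 * N) = (u : ℂ) ^ (2 * N) := by
      rw [pow_mul, ← mul_pow, pow_mul]
      congr 1
      linear_combination (-(u : ℂ) ^ 2) * Complex.I_sq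
    rw [← h2]
    ring
  · refine Finset.sum_congr rfl fun i _ => ?_
    rw [iteratedDeriv_exp_I_mul, commCoeff]
    ring

/-- Leibniz' rule for the operator applied to `ψ exp (iuy)`, read as an identity between windowed
Fourier transforms. The signs come from conjugating `(iu)^i` in the first argument. -/
lemma inner_diffOp_window (hψ : IsWindow a b x r ψ) (u : ℝ) (f : L2 a b) :
    inner ℂ (toL2 a b (diffOp N fun y => (ψ y : ℂ) * Complex.exp (Complex.I * (u * y)))) f =
      (u : ℂ) ^ (2 * N) * windowFt (fun y => (ψ y : ℂ)) f u +
      ∑ i ∈ Finset.range (2 * N), (-1) ^ i * ((Complex.I * u) ^ i *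
        windowFt (commCoeff N ψ i) f u) := by
  have hc := continuous_window hψ.contDiff_ofReal.continuous u
  have hci := fun i => continuous_window (continuous_commCoeff (N := N) hψ i) u
  rw [funext (diffOp_window hψ u), toL2_add (hc.const_mul _)
    (continuous_finsetSum _ fun i _ => (hci i).const_mul _), toL2_const_mul hc,
    toL2_sum _ fun i => (hci i).const_mul _, inner_add_left, inner_smul_left, sum_inner]
  congr 1
  · rw [map_pow, Complex.conj_ofReal]
    rfl
  · refine Finset.sum_congr rfl fun i _ => ?_
    rw [toL2_const_mul (hci i), inner_smul_left, map_pow, map_mul, Complex.conj_I,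
      Complex.conj_ofReal, neg_mul, neg_pow, mul_assoc]
    rfl

end Window

/-- A windowed Fourier transform integrated against a heat multiplier. -/
def windowInt (N k : ℕ) (χ : ℝ → ℂ) (t x : ℝ) (f : L2 a b) : ℂ :=
  ∫ u : ℝ, (Complex.I * u) ^ k * Complex.exp (Complex.I * (u * x)) * heatSymbol N t u *
    windowFt χ f u ∂freqMeasure

lemma integrable_windowInt (hN : 1 ≤ N) (k : ℕ) {χ : ℝ → ℂ} (hχ : Continuous χ) {t : ℝ}
    (ht : 0 < t) (x : ℝ) (f : L2 a b) : Integrable (fun u : ℝ => (Complex.I * u) ^ k *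
      Complex.exp (Complex.I * (u * x)) * heatSymbol N t u * windowFt χ f u) freqMeasure := by
  obtain ⟨C, _, h⟩ := exists_norm_windowFt_le hχ a b
  exact (integrable_kernelDeriv hN k ht x).mul_bdd (c := C * ‖f‖)
    (continuous_windowFt hχ f).aestronglyMeasurable (Eventually.of_forall (h f))

lemma tendsto_smoothing_of_finiteEnergy (hN : 2 ≤ N) {h : ℕ → ℝ} (hh : ∀ n, 0 < h n)
    (h0 : Tendsto h atTop (𝓝 0)) {f : L2 a b} (hf : FiniteEnergy N f) (x : ℝ) :
    Tendsto (fun n => smoothing N (h n) f x) atTop (𝓝 (evalAt x f)) :=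
  tendsto_smoothing_evalAt hN hh h0 tendsto_const_nhds (C := energy N f)
    (Eventually.of_forall fun n => integral_mono (integrable_genSymbol (hh n) f) hf fun u =>
      mul_le_mul_of_nonneg_right (genSymbol_le (hh n) u) (sq_nonneg _)) hf x

lemma tendsto_windowInt_off (hN : 1 ≤ N) {χ : ℝ → ℂ} (hχ : Continuous χ) {x r : ℝ} (hr : 0 < r)
    (hχ0 : ∀ y, |x - y| < r → χ y = 0) (f : L2 a b) {h : ℕ → ℝ} (hh : ∀ n, 0 < h n)
    (h0 : Tendsto h atTop (𝓝 0)) :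
    Tendsto (fun n => windowInt N 0 χ (h n) x f) atTop (𝓝 0) := by
  obtain ⟨C, hC, hb⟩ := exists_bound_Ioo hχ a b
  rw [tendsto_zero_iff_norm_tendsto_zero, Metric.tendsto_atTop']
  intro ε hε
  set M := boundConst a b * C * ‖f‖ + 1 with hM
  have hM0 : 0 ≤ boundConst a b * C * ‖f‖ :=
    mul_nonneg (mul_nonneg boundConst_nonneg hC) (norm_nonneg _)
  have h1 := (tendsto_nhdsWithin_iff.2 ⟨h0, Eventually.of_forall hh⟩ :
    Tendsto h atTop (𝓝[>] 0)).eventually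
      (kernel_off_diagonal_tendsto hN hr (show 0 < ε / M by positivity))
  obtain ⟨n0, hn0⟩ := eventually_atTop.1 h1
  refine ⟨n0, fun n hn => ?_⟩
  rw [dist_zero_right, norm_norm, windowInt, integral_heatSymbol_windowFt hN (hh n) hχ]
  refine (norm_integral_window_le hχ (continuous_kernelDeriv hN 0 (hh n))
    (show 0 ≤ ε / M by positivity) hC hb hχ0 (hn0 n hn.le) f).trans_lt ?_
  have : boundConst a b * (C * (ε / M)) * ‖f‖ = (boundConst a b * C * ‖f‖) * ε / M := by ring
  rw [this, div_lt_iff₀ (by positivity), hM]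
  nlinarith

/-- The windowed smoothing of a function of finite energy. -/
lemma tendsto_windowInt_of_finiteEnergy (hN : 2 ≤ N) {x r : ℝ} {ψ : ℝ → ℝ}
    (hψ : IsWindow a b x r ψ) {f : L2 a b} (hf : FiniteEnergy N f) {h : ℕ → ℝ}
    (hh : ∀ n, 0 < h n) (h0 : Tendsto h atTop (𝓝 0)) :
    Tendsto (fun n => windowInt N 0 (fun y => (ψ y : ℂ)) (h n) x f) atTop (𝓝 (evalAt x f)) := by
  have hN1 := one_le_of_two_le hN
  have hc := hψ.contDiff_ofReal.continuous
  have hc' : Continuous fun y => 1 - (ψ y : ℂ) := continuous_const.sub hc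
  -- The complementary window `1 - ψ` vanishes near `x`, so its contribution at `x` disappears with
  -- the mesh.
  have h1 := tendsto_windowInt_off hN1 hc' hψ.radius_pos
    (fun y hy => by rw [hψ.eq_one y hy, Complex.ofReal_one, sub_self]) f hh h0
  have h2 := (tendsto_smoothing_of_finiteEnergy hN hh h0 hf x).sub h1
  rw [sub_zero] at h2
  refine h2.congr fun n => ?_
  have i1 := integrable_windowInt hN1 0 (continuous_const (y := (1 : ℂ))) (hh n) x f
  have i2 := integrable_windowInt hN1 0 hc' (hh n) x f
  have e1 : ∀ u, windowFt (fun _ => 1) f u = ft f u := fun u => by simp [windowFt, ft, expL2]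
  have e2 : smoothing N (h n) f x = windowInt N 0 (fun _ => 1) (h n) x f := by
    rw [smoothing_eq hN1 (hh n), windowInt]
    simp only [e1, pow_zero, one_mul]
  rw [e2, windowInt, windowInt, windowInt, ← integral_sub i1 i2]
  refine integral_congr_ae (Eventually.of_forall fun u => ?_)
  have e3 : windowFt (fun y => 1 - (ψ y : ℂ)) f u =
      windowFt (fun _ => 1) f u - windowFt (fun y => (ψ y : ℂ)) f u := by
    rw [windowFt, windowFt, windowFt, ← inner_sub_left]
    congr 1
    rw [eq_sub_iff_add_eq, ← toL2_add (continuous_window hc' u) (continuous_window hc u)]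
    congr 1
    ext y
    ring
  simp only [e3]
  ring

/-! ### The heat equation for `exp (-tA) 1 - 1` tested in the interior -/

section Evolution

variable (hN : 2 ≤ N)

/-- The function `exp (-tA) 1 - 1`. -/
def heatDefect (a b t : ℝ) : L2 a b :=
  heatOp (dirichletResolvent (one_le_of_two_le hN) a b) 0 t (oneL2 a b) - oneL2 a b

lemma norm_heatDefect_le {t : ℝ} (ht : 0 < t) : ‖heatDefect hN a b t‖ ≤ 2 * ‖oneL2 a b‖ := by
  have h1 := (isUnitOp_dirichletResolvent (a := a) (b := b)
    (one_le_of_two_le hN)).norm_heatOp_zero_le ht.le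
  have h2 := ContinuousLinearMap.le_of_opNorm_le _ h1 (oneL2 a b)
  refine (norm_sub_le _ _).trans ?_
  linarith

lemma tendsto_heatDefect (hab : a ≤ b) :
    Tendsto (heatDefect hN a b) (𝓝[>] 0) (𝓝 0) := by
  have h := (isUnitOp_dirichletResolvent (one_le_of_two_le hN)).tendsto_heatOp_zero
    (denseRange_dirichletResolvent hab hN) (oneL2 a b)
  have h1 := h.sub_const (oneL2 a b)
  rw [sub_self] at h1
  exact h1

/-- The integral of a derivative is a boundary term; it is obtained as integration by parts at
frequency `0`. Thus subtracting the constant `1` preserves the heat equation in the interior, while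
making the initial value zero. -/
lemma inner_diffOp_one (hab : a ≤ b) {v : ℝ → ℂ} (hv : ContDiff ℝ ∞ v)
    (ha : iteratedDeriv (2 * N - 1) v a = 0) (hb : iteratedDeriv (2 * N - 1) v b = 0)
    (hN1 : 1 ≤ N) : inner ℂ (toL2 a b (diffOp N v)) (oneL2 a b) = 0 := by
  have h1 := I_mul_ft hab (hasDerivAt_iteratedDeriv hv (2 * N - 1))
    (continuous_iteratedDeriv hv _) 0
  rw [Nat.sub_add_cancel (by omega), ha, hb] at h1
  simp only [Complex.ofReal_zero, mul_zero, zero_mul, sub_zero] at h1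
  have h2 : expL2 a b 0 = oneL2 a b := by simp [expL2, oneL2]
  have h3 : toL2 a b (diffOp N v) = (-1 : ℂ) ^ N • toL2 a b (iteratedDeriv (2 * N) v) :=
    toL2_const_mul (continuous_iteratedDeriv hv _) _
  rw [ft, h2] at h1
  rw [h3, inner_smul_left, ← inner_conj_symm, ← h1, map_zero, mul_zero]

/-- The heat equation tested against a test function. -/
lemma hasDerivAt_inner_heatDefect (hab : a ≤ b) {v : ℝ → ℂ} (hv : ContDiff ℝ ∞ v)
    (hsupp : tsupport v ⊆ Set.Ioo a b) {t : ℝ} (ht : 0 < t) :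
    HasDerivAt (fun t => inner ℂ (toL2 a b v) (heatDefect hN a b t))
      (-inner ℂ (toL2 a b (diffOp N v)) (heatDefect hN a b t)) t := by
  have hN1 := one_le_of_two_le hN
  have hU := isUnitOp_dirichletResolvent (a := a) (b := b) hN1
  set R := dirichletResolvent hN1 a b with hR
  have hD : ∀ M, IsDirichlet M a b v := fun M => IsDirichlet.of_tsupport_subset hv hsupp
  have h1 := ((hU.hasDerivAt_heatOp_apply 0 ht (oneL2 a b)).sub_const (oneL2 a b))
  have h2 := (innerSL ℂ (toL2 a b v)).restrictScalars ℝ |>.hasFDerivAt.comp_hasDerivAt t h1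
  have h3 : inner ℂ (toL2 a b v) (heatOp R 0 t (oneL2 a b) - heatOp R 1 t (oneL2 a b)) =
      -inner ℂ (toL2 a b (diffOp N v)) (heatDefect hN a b t) := by
    -- Write `v = R(v + Av)` and move `R` to the other side, where it cancels the factor `1 + A`.
    have h4 : inner ℂ (toL2 a b v) (heatOp R 1 t (oneL2 a b)) =
        inner ℂ (toL2 a b v + toL2 a b (diffOp N v)) (heatOp R 0 t (oneL2 a b)) := by
      conv_lhs => rw [← (hD N).dirichletResolvent_apply hab hN]
      rw [hU.inner_apply, hU.apply_heatOp_succ 0 ht]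
    rw [inner_sub_right, h4, inner_add_left, heatDefect, inner_sub_right,
      inner_diffOp_one hab hv ((hD (2 * N)).left _ (by omega)) ((hD (2 * N)).right _ (by omega)) hN1]
    ring
  rw [← h3]
  exact h2

end Evolution

end PseudoBM

namespace PseudoBM

open ComplexConjugate
open scoped ContDiff

variable {a b : ℝ} {N : ℕ}

/-! ### Duhamel's formula in a window and interior regularity up to time zero -/

lemma norm_image_sub_le_of_deriv {g g' : ℝ → ℂ} {C s t : ℝ} (hst : s ≤ t)
    (hg : ∀ r ∈ Set.Icc s t, HasDerivAt g (g' r) r) (hC : ∀ r ∈ Set.Icc s t, ‖g' r‖ ≤ C) :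
    ‖g t - g s‖ ≤ C * (t - s) := by
  have := (convex_Icc s t).norm_image_sub_le_of_norm_hasDerivWithin_le
    (fun r hr => (hg r hr).hasDerivWithinAt) hC (Set.left_mem_Icc.2 hst) (Set.right_mem_Icc.2 hst)
  rwa [Real.norm_of_nonneg (sub_nonneg.2 hst)] at this

lemma norm_le_of_deriv_of_tendsto_zero {g g' : ℝ → ℂ} {C t : ℝ} (hC0 : 0 ≤ C) (ht : 0 < t)
    (hg : ∀ r ∈ Set.Ioc 0 t, HasDerivAt g (g' r) r) (hC : ∀ r ∈ Set.Ioc 0 t, ‖g' r‖ ≤ C)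
    (h0 : Tendsto g (𝓝[>] 0) (𝓝 0)) : ‖g t‖ ≤ C * t := by
  have h1 : Tendsto (fun s => ‖g t - g s‖) (𝓝[>] 0) (𝓝 ‖g t - 0‖) := (h0.const_sub (g t)).norm
  rw [sub_zero] at h1
  refine le_of_tendsto h1 ?_
  filter_upwards [Ioc_mem_nhdsGT ht] with s hs
  refine (norm_image_sub_le_of_deriv hs.2 (fun r hr => hg r ⟨hs.1.trans_le hr.1, hr.2⟩)
    fun r hr => hC r ⟨hs.1.trans_le hr.1, hr.2⟩).trans ?_
  gcongr
  linarith [hs.1]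

variable {x r : ℝ} {ψ : ℝ → ℝ} (hN : 2 ≤ N)

/-- The heat equation tested with `ψ exp (iuy)`, one ordinary differential equation for each
frequency. -/
lemma hasDerivAt_windowFt (hab : a ≤ b) (hψ : IsWindow a b x r ψ) {t : ℝ} (ht : 0 < t) (u : ℝ) :
    HasDerivAt (fun t => windowFt (fun y => (ψ y : ℂ)) (heatDefect hN a b t) u)
      (-((u : ℂ) ^ (2 * N) * windowFt (fun y => (ψ y : ℂ)) (heatDefect hN a b t) u +
        ∑ i ∈ Finset.range (2 * N), (-1) ^ i * ((Complex.I * u) ^ i *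
          windowFt (commCoeff N ψ i) (heatDefect hN a b t) u))) t := by
  have hsupp : tsupport (fun y => (ψ y : ℂ) * Complex.exp (Complex.I * (u * y))) ⊆
      Set.Ioo a b := by
    refine subset_trans (closure_mono fun y hy => ?_) hψ.tsupport_subset
    simp only [Function.mem_support, ne_eq, mul_eq_zero, Complex.ofReal_eq_zero, not_or] at hy ⊢
    exact hy.1
  have h := hasDerivAt_inner_heatDefect hN hab
    (hψ.contDiff_ofReal.mul (contDiff_exp_I_mul u)) hsupp ht
  rw [inner_diffOp_window hψ] at h
  exact h

/-- The time derivative of the windowed heat integral. -/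
def heatDrift (a b : ℝ) (ψ : ℝ → ℝ) (x τ s : ℝ) : ℂ :=
  ∑ i ∈ Finset.range (2 * N), (-1) ^ i *
    windowInt N i (commCoeff N ψ i) (τ - s) x (heatDefect hN a b s)

/-- Duhamel's principle: the backward factor `exp (-(τ - s)u^(2N))` cancels the leading term
`u^(2N)` of the evolution of the windowed transform, and only the commutator terms survive. -/
lemma hasDerivAt_windowInt (hab : a ≤ b) (hψ : IsWindow a b x r ψ) {s τ : ℝ} (hs : 0 < s)
    (hsτ : s < τ) :
    HasDerivAt (fun s => windowInt N 0 (fun y => (ψ y : ℂ)) (τ - s) x (heatDefect hN a b s))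
      (-heatDrift hN a b ψ x τ s) s := by
  have hN1 := one_le_of_two_le hN
  have hc := hψ.contDiff_ofReal.continuous
  have hci := fun i => continuous_commCoeff (N := N) hψ i
  choose C hC0 hC using fun i => exists_norm_windowFt_le (hci i) a b
  have hi : ∀ s < τ, ∀ i, Integrable (fun u : ℝ => (-1) ^ i * ((Complex.I * u) ^ i *
      Complex.exp (Complex.I * (u * x)) * heatSymbol N (τ - s) u *
      windowFt (commCoeff N ψ i) (heatDefect hN a b s) u)) freqMeasure := fun s hs i =>
    (integrable_windowInt hN1 i (hci i) (sub_pos.2 hs) x _).const_mul _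
  have h := (hasDerivAt_integral_of_dominated_loc_of_deriv_le
    -- On this interval times stay positive and `τ - s' ≥ (τ - s)/2`, so the symbol at `(τ - s)/2`
    -- provides the integrable majorant.
    (s := Set.Ioo (s / 2) ((s + τ) / 2))
    (F := fun s (u : ℝ) => (Complex.I * u) ^ 0 * Complex.exp (Complex.I * (u * x)) *
      heatSymbol N (τ - s) u * windowFt (fun y => (ψ y : ℂ)) (heatDefect hN a b s) u)
    (F' := fun s (u : ℝ) => -∑ i ∈ Finset.range (2 * N), (-1) ^ i * ((Complex.I * u) ^ i *
      Complex.exp (Complex.I * (u * x)) * heatSymbol N (τ - s) u *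
      windowFt (commCoeff N ψ i) (heatDefect hN a b s) u))
    (μ := freqMeasure) (x₀ := s)
    (bound := fun u => ∑ i ∈ Finset.range (2 * N), |u| ^ i * heatSymbol N ((τ - s) / 2) u *
      (C i * (2 * ‖oneL2 a b‖)))
    (Ioo_mem_nhds (half_lt_self hs) (by linarith))
    ((gt_mem_nhds hsτ).mono fun s' hs' =>
      (integrable_windowInt hN1 0 hc (sub_pos.2 hs') x _).aestronglyMeasurable)
    (integrable_windowInt hN1 0 hc (sub_pos.2 hsτ) x _)
    (integrable_finsetSum _ fun i _ => hi s hsτ i).neg.aestronglyMeasurable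
    (Eventually.of_forall fun u s' hs' => ?_)
    (integrable_finsetSum _ fun i _ => (integrable_abs_pow_mul_heatSymbol hN1 i
      (half_pos (sub_pos.2 hsτ))).mul_const _)
    (Eventually.of_forall fun u s' hs' => ?_)).2
  · rw [integral_neg, integral_finsetSum _ fun i _ => hi s hsτ i] at h
    simp only [integral_const_mul] at h
    exact h
  · rw [norm_neg]
    refine (norm_sum_le _ _).trans (Finset.sum_le_sum fun i _ => ?_)
    rw [norm_mul, norm_mul, norm_kernelDeriv_integrand]
    have h1 : ‖((-1 : ℂ)) ^ i‖ = 1 := by simp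
    have h2 := heatSymbol_antitone N (show (τ - s) / 2 ≤ τ - s' by linarith [hs'.2]) u
    have h3 := hC i (heatDefect hN a b s') u
    have h4 := norm_heatDefect_le (a := a) (b := b) hN (show 0 < s' by linarith [hs'.1])
    have h5 := heatSymbol_pos N ((τ - s) / 2) u
    rw [h1, one_mul]
    refine mul_le_mul (by gcongr) (h3.trans (mul_le_mul_of_nonneg_left h4 (hC0 i)))
      (norm_nonneg _) (by positivity)
  · have hs'0 : 0 < s' := by linarith [hs'.1]
    have h1 := ((hasDerivAt_heatSymbol N (τ - s') u).comp s' ((hasDerivAt_id s').const_sub τ)).ofReal_comp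
    have h2 := hasDerivAt_windowFt hN hab hψ hs'0 u
    have h3 := (h1.const_mul ((Complex.I * u) ^ 0 * Complex.exp (Complex.I * (u * x)))).mul h2
    convert! h3 using 1
    simp only [pow_zero, one_mul]
    rw [neg_eq_iff_eq_neg, Finset.sum_congr rfl fun i _ => show (-1) ^ i * ((Complex.I * u) ^ i *
      Complex.exp (Complex.I * (u * x)) * heatSymbol N (τ - s') u *
      windowFt (commCoeff N ψ i) (heatDefect hN a b s') u) = (Complex.exp (Complex.I * (u * x)) *
      heatSymbol N (τ - s') u) * ((-1) ^ i * ((Complex.I * u) ^ i *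
          windowFt (commCoeff N ψ i) (heatDefect hN a b s') u)) by ring, ← Finset.mul_sum]
    simp only [Function.comp_apply]
    push_cast
    ring

/-- The coefficient windows vanish near `x`, so the off-diagonal bounds apply, with constants that
do not degenerate as `s` tends to `τ` or to `0`. -/
lemma exists_heatDrift_bound (hψ : IsWindow a b x r ψ) : ∃ C : ℝ, 0 ≤ C ∧
    (∀ s τ : ℝ, 0 < s → s < τ → ‖heatDrift hN a b ψ x τ s‖ ≤ C) ∧
    ∀ s τ τ' : ℝ, 0 < s → s < τ → s < τ' →
      ‖heatDrift hN a b ψ x τ s - heatDrift hN a b ψ x τ' s‖ ≤ C * |τ - τ'| := by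
  have hN1 := one_le_of_two_le hN
  choose C hC0 hC1 hC2 using fun i : Finset.range (2 * N) => exists_window_bound hN1
    (continuous_commCoeff (N := N) hψ i) i hψ.radius_pos
    (commCoeff_eq_zero hψ (Finset.mem_range.1 i.2)) a b
  refine ⟨(∑ i, C i) * (2 * ‖oneL2 a b‖), mul_nonneg (Finset.sum_nonneg fun i _ => hC0 i)
    (by positivity), fun s τ hs hsτ => ?_, fun s τ τ' hs hτ hτ' => ?_⟩
  · have hz := norm_heatDefect_le (a := a) (b := b) hN hs
    rw [heatDrift, ← Finset.sum_coe_sort, Finset.sum_mul]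
    refine (norm_sum_le _ _).trans (Finset.sum_le_sum fun i _ => ?_)
    have h1 : ‖((-1 : ℂ)) ^ (i : ℕ)‖ = 1 := by simp
    rw [norm_mul, h1, one_mul]
    exact (hC1 i _ (sub_pos.2 hsτ) _).trans (mul_le_mul_of_nonneg_left hz (hC0 i))
  · have hz := norm_heatDefect_le (a := a) (b := b) hN hs
    rw [heatDrift, heatDrift, ← Finset.sum_sub_distrib, ← Finset.sum_coe_sort, Finset.sum_mul,
      Finset.sum_mul]
    refine (norm_sum_le _ _).trans (Finset.sum_le_sum fun i _ => ?_)
    have h1 : ‖((-1 : ℂ)) ^ (i : ℕ)‖ = 1 := by simp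
    rw [← mul_sub, norm_mul, h1, one_mul]
    refine (hC2 i _ _ (sub_pos.2 hτ) (sub_pos.2 hτ') _).trans ?_
    rw [sub_sub_sub_cancel_right]
    have := hC0 i
    calc _ ≤ C i * |τ - τ'| * (2 * ‖oneL2 a b‖) := by gcongr
      _ = _ := by ring

lemma tendsto_windowInt_zero (hab : a ≤ b) (hψ : IsWindow a b x r ψ) {τ : ℝ} (hτ : 0 < τ) :
    Tendsto (fun s => windowInt N 0 (fun y => (ψ y : ℂ)) (τ - s) x (heatDefect hN a b s))
      (𝓝[>] 0) (𝓝 0) := by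
  have hN1 := one_le_of_two_le hN
  obtain ⟨C, hC0, hC⟩ := exists_norm_windowFt_le hψ.contDiff_ofReal.continuous a b
  have hz := (tendsto_heatDefect hN hab).norm
  rw [norm_zero] at hz
  have h1 := hz.const_mul ((∫ u, |u| ^ 0 * heatSymbol N (τ / 2) u ∂freqMeasure) * C)
  rw [mul_zero] at h1
  refine squeeze_zero_norm' ?_ h1
  filter_upwards [Ioc_mem_nhdsGT (half_pos hτ)] with s hs
  rw [mul_assoc, ← integral_mul_const]
  refine norm_integral_le_of_norm_le ((integrable_abs_pow_mul_heatSymbol hN1 0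
    (half_pos hτ)).mul_const _) (Eventually.of_forall fun u => ?_)
  rw [norm_mul, norm_kernelDeriv_integrand]
  have h2 := heatSymbol_antitone N (show τ / 2 ≤ τ - s by linarith [hs.2]) u
  have h3 := heatSymbol_pos N (τ / 2) u
  exact mul_le_mul (by gcongr) (hC _ u) (norm_nonneg _) (by positivity)

/-- The semigroup part has finite energy. The constant `1` does not, but its windowed transform is
the transform of `ψ`, a Dirichlet function with value `1` at `x`. -/
lemma tendsto_windowInt_survivalLimit (hab : a < b) (hψ : IsWindow a b x r ψ)
    (hx : x ∈ Set.Ioo a b) {t : ℝ} (ht : 0 < t) {h : ℕ → ℝ} (hh : ∀ n, 0 < h n)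
    (h0 : Tendsto h atTop (𝓝 0)) :
    Tendsto (fun n => windowInt N 0 (fun y => (ψ y : ℂ)) (h n) x (heatDefect hN a b t)) atTop
      (𝓝 (survivalLimit hN a b t x - 1)) := by
  have hN1 := one_le_of_two_le hN
  have hc := hψ.contDiff_ofReal.continuous
  have h1 := tendsto_windowInt_of_finiteEnergy hN hψ (finiteEnergy_heatOp_zero hN ht (oneL2 a b))
    hh h0
  rw [← survivalLimit_eq hN ht] at h1
  have hD : IsDirichlet N a b fun y => (ψ y : ℂ) := by
    simpa using hψ.isDirichlet_mul (N := N) (contDiff_const (c := (1 : ℂ)))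
  have h2 := tendsto_smoothing_of_finiteEnergy hN hh h0 (hD.finiteEnergy hab.le) x
  rw [hD.evalAt_eq hab.le hN hx, hψ.eq_one x (by simpa using hψ.radius_pos),
    Complex.ofReal_one] at h2
  refine (h1.sub h2).congr fun n => ?_
  have e1 : ∀ u, ft (toL2 a b fun y => (ψ y : ℂ)) u =
      windowFt (fun y => (ψ y : ℂ)) (oneL2 a b) u := fun u => by
    rw [ft, expL2, windowFt, oneL2, inner_toL2_toL2 (continuous_exp_I_mul u) hc,
      inner_toL2_toL2 (continuous_window hc u) continuous_const]
    refine integral_congr_ae (Eventually.of_forall fun y => ?_)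
    simp only [map_mul, Complex.conj_ofReal]
    ring
  have i1 := integrable_windowInt hN1 0 hc (hh n) x
    (heatOp (dirichletResolvent hN1 a b) 0 t (oneL2 a b))
  have i2 := integrable_windowInt hN1 0 hc (hh n) x (oneL2 a b)
  rw [smoothing_eq hN1 (hh n), windowInt, windowInt]
  have e2 : ∫ u : ℝ, Complex.exp (Complex.I * (u * x)) * heatSymbol N (h n) u *
      ft (toL2 a b fun y => (ψ y : ℂ)) u ∂freqMeasure = ∫ u : ℝ, (Complex.I * u) ^ 0 *
      Complex.exp (Complex.I * (u * x)) * heatSymbol N (h n) u *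
      windowFt (fun y => (ψ y : ℂ)) (oneL2 a b) u ∂freqMeasure := by
    simp only [e1, pow_zero, one_mul]
  rw [e2, ← integral_sub i1 i2]
  refine integral_congr_ae (Eventually.of_forall fun u => ?_)
  have e3 : windowFt (fun y => (ψ y : ℂ)) (heatDefect hN a b t) u =
    windowFt (fun y => (ψ y : ℂ)) (heatOp (dirichletResolvent hN1 a b) 0 t (oneL2 a b)) u -
      windowFt (fun y => (ψ y : ℂ)) (oneL2 a b) u := inner_sub_right _ _ _
  simp only [e3]
  ring

/-- Interior regularity of the survival function up to time zero. -/
lemma exists_survivalLimit_lipschitz (hab : a < b) (hx : x ∈ Set.Ioo a b) : ∃ C : ℝ, 0 ≤ C ∧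
    ∀ t : ℝ, 0 < t → ‖survivalLimit hN a b t x - 1‖ ≤ C * t ∧ ∀ t' : ℝ, t ≤ t' →
      ‖survivalLimit hN a b t' x - survivalLimit hN a b t x‖ ≤ C * (1 + t) * (t' - t) := by
  obtain ⟨r, ψ, hψ⟩ := exists_isWindow hx
  obtain ⟨C, hC0, hC1, hC2⟩ := exists_heatDrift_bound hN hψ
  -- `Φ τ s` vanishes as `s → 0` and tends to `S(t) - 1` when `s = t` and `τ` decreases to `t`; its
  -- `s`-derivative is bounded by `C`.
  set Φ : ℝ → ℝ → ℂ := fun τ s =>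
    windowInt N 0 (fun y => (ψ y : ℂ)) (τ - s) x (heatDefect hN a b s) with hΦ
  have hd : ∀ τ s, 0 < s → s < τ → HasDerivAt (Φ τ) (-heatDrift hN a b ψ x τ s) s :=
    fun τ s hs hsτ => hasDerivAt_windowInt hN hab.le hψ hs hsτ
  have h0 : ∀ τ, 0 < τ → Tendsto (Φ τ) (𝓝[>] 0) (𝓝 0) := fun τ hτ =>
    tendsto_windowInt_zero hN hab.le hψ hτ
  have hlim : ∀ t, 0 < t → Tendsto (fun n => Φ (t + mesh n) t) atTop
      (𝓝 (survivalLimit hN a b t x - 1)) := fun t ht => by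
    have := tendsto_windowInt_survivalLimit hN hab hψ hx ht mesh_pos tendsto_mesh
    simpa [hΦ] using this
  refine ⟨C, hC0, fun t ht => ⟨?_, fun t' htt' => ?_⟩⟩
  · refine le_of_tendsto (hlim t ht).norm (Eventually.of_forall fun n => ?_)
    have hm := mesh_pos n
    exact norm_le_of_deriv_of_tendsto_zero hC0 ht
      (fun s hs => hd _ s hs.1 (by linarith [hs.2]))
      (fun s hs => by rw [norm_neg]; exact hC1 s _ hs.1 (by linarith [hs.2])) (h0 _ (by linarith))
  · have h1 := ((hlim t' (ht.trans_le htt')).sub (hlim t ht)).norm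
    rw [sub_sub_sub_cancel_right] at h1
    refine le_of_tendsto h1 (Eventually.of_forall fun n => ?_)
    have hm := mesh_pos n
    -- With `τ` fixed, only the drift between `t` and `t'` contributes.
    have h2 : ‖Φ (t' + mesh n) t' - Φ (t' + mesh n) t‖ ≤ C * (t' - t) :=
      norm_image_sub_le_of_deriv htt'
        (fun s hs => hd _ s (ht.trans_le hs.1) (by linarith [hs.2]))
        (fun s hs => by rw [norm_neg]; exact hC1 s _ (ht.trans_le hs.1) (by linarith [hs.2]))
    -- The change of `τ` is integrated over the whole of `(0, t]`: the difference starts at zero and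
    -- its derivative is controlled by the Lipschitz bound of the drift in `τ`.
    have h3 : ‖Φ (t' + mesh n) t - Φ (t + mesh n) t‖ ≤ C * |t' - t| * t :=
      norm_le_of_deriv_of_tendsto_zero (g := fun s => Φ (t' + mesh n) s - Φ (t + mesh n) s)
        (mul_nonneg hC0 (abs_nonneg _)) ht
        (fun s hs => (hd _ s hs.1 (by linarith [hs.2])).sub (hd _ s hs.1 (by linarith [hs.2])))
        (fun s hs => by
          rw [neg_sub_neg, norm_sub_rev]
          have := hC2 s (t' + mesh n) (t + mesh n) hs.1 (by linarith [hs.2]) (by linarith [hs.2])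
          rwa [add_sub_add_right_eq_sub] at this)
        (by simpa using (h0 (t' + mesh n) (by linarith)).sub (h0 (t + mesh n) (by linarith)))
    rw [abs_of_nonneg (sub_nonneg.2 htt')] at h3
    have h4 := norm_sub_le_norm_sub_add_norm_sub (Φ (t' + mesh n) t') (Φ (t' + mesh n) t)
      (Φ (t + mesh n) t)
    calc _ ≤ _ := h4
      _ ≤ _ := add_le_add h2 h3
      _ = _ := by ring

end PseudoBM

namespace PseudoBM

open scoped ContDiff

variable {N : ℕ}

/-! ### The determinants -/

/-- The characteristic exponents `lam^(1/(2N)) θ_ℓ`. -/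
def charExp (N : ℕ) (lam : ℝ) (j : Fin (2 * N)) : ℂ :=
  ((lam ^ (1 / (2 * (N : ℝ))) : ℝ) : ℂ) * theta N j

lemma expScaled_eq (lam : ℝ) (j : Fin (2 * N)) (x : ℝ) :
    expScaled N lam (theta N j * x) = Complex.exp (charExp N lam j * x) := by
  rw [expScaled, charExp, mul_assoc]

lemma theta_eq (hN : 1 ≤ N) (j : Fin (2 * N)) : theta N j =
    Complex.exp (Complex.I * ((N + 1) / (2 * N)) * Real.pi) *
      Complex.exp (2 * Real.pi * Complex.I / (2 * N : ℕ)) ^ (j : ℕ) := by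
  have h : (N : ℂ) ≠ 0 := by exact_mod_cast (by omega : N ≠ 0)
  rw [theta, ← Complex.exp_nat_mul, ← Complex.exp_add]
  congr 1
  push_cast
  field_simp
  ring

lemma theta_injective (hN : 1 ≤ N) : Function.Injective (theta N) := by
  intro i j h
  rw [theta_eq hN, theta_eq hN] at h
  have h1 := mul_left_cancel₀ (Complex.exp_ne_zero _) h
  exact Fin.ext ((Complex.isPrimitiveRoot_exp (2 * N) (by omega)).pow_inj i.2 j.2 h1)

lemma theta_pow (hN : 1 ≤ N) (j : Fin (2 * N)) : theta N j ^ (2 * N) = -(-1) ^ N := by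
  have h : (N : ℂ) ≠ 0 := by exact_mod_cast (by omega : N ≠ 0)
  rw [theta_eq hN, mul_pow, ← pow_mul, mul_comm (j : ℕ), pow_mul _ (2 * N) (j : ℕ),
    (Complex.isPrimitiveRoot_exp (2 * N) (by omega)).pow_eq_one, one_pow, mul_one,
    ← Complex.exp_nat_mul]
  have e : ((2 * N : ℕ) : ℂ) * (Complex.I * ((N + 1) / (2 * N)) * Real.pi) =
      ((N + 1 : ℕ) : ℂ) * (Real.pi * Complex.I) := by
    push_cast
    field_simp
  rw [e, Complex.exp_nat_mul, Complex.exp_pi_mul_I, pow_succ, mul_neg_one]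

lemma root_pow (hN : 1 ≤ N) {lam : ℝ} (hlam : 0 < lam) :
    ((lam ^ (1 / (2 * (N : ℝ))) : ℝ) : ℂ) ^ (2 * N) = lam := by
  rw [← Complex.ofReal_pow, ← Real.rpow_natCast, ← Real.rpow_mul hlam.le]
  have h : (N : ℝ) ≠ 0 := by exact_mod_cast (by omega : N ≠ 0)
  push_cast
  rw [one_div_mul_cancel (by positivity), Real.rpow_one]

lemma root_ne_zero {lam : ℝ} (hlam : 0 < lam) : ((lam ^ (1 / (2 * (N : ℝ))) : ℝ) : ℂ) ≠ 0 := by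
  exact_mod_cast (Real.rpow_pos_of_pos hlam _).ne'

lemma charExp_injective (hN : 1 ≤ N) {lam : ℝ} (hlam : 0 < lam) :
    Function.Injective (charExp N lam) := fun _ _ h =>
  theta_injective hN (mul_left_cancel₀ (root_ne_zero hlam) h)

lemma charExp_pow (hN : 1 ≤ N) {lam : ℝ} (hlam : 0 < lam) (j : Fin (2 * N)) :
    charExp N lam j ^ (2 * N) = -(-1) ^ N * lam := by
  rw [charExp, mul_pow, root_pow hN hlam, theta_pow hN, mul_comm]

/-- The linear combination of the exponential solutions with coefficients `c`. -/
def expSum (N : ℕ) (lam : ℝ) (c : Fin (2 * N) → ℂ) (y : ℝ) : ℂ :=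
  ∑ j, c j * Complex.exp (charExp N lam j * y)

lemma contDiff_expSum (lam : ℝ) (c : Fin (2 * N) → ℂ) : ContDiff ℝ ∞ (expSum N lam c) := by
  have h : ContDiff ℝ ∞ fun y : ℝ => (y : ℂ) := Complex.ofRealCLM.contDiff
  exact ContDiff.sum fun j _ => contDiff_const.mul (contDiff_const.mul h).cexp

lemma iteratedDeriv_expSum (lam : ℝ) (c : Fin (2 * N) → ℂ) (k : ℕ) :
    iteratedDeriv k (expSum N lam c) = expSum N lam fun j => c j * charExp N lam j ^ k := by
  induction k with
  | zero => simp
  | succ k ih =>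
    rw [iteratedDeriv_succ, ih]
    ext y
    have h1 : ∀ j, HasDerivAt (fun y : ℝ => charExp N lam j * (y : ℂ)) (charExp N lam j) y :=
      fun j => by
        have := (hasDerivAt_id y).ofReal_comp.const_mul (charExp N lam j)
        simpa using this
    have h2 := HasDerivAt.fun_sum (u := Finset.univ) fun j _ =>
      ((h1 j).cexp.const_mul (c j * charExp N lam j ^ k))
    refine h2.deriv.trans (Finset.sum_congr rfl fun j _ => ?_)
    ring

lemma diffOp_expSum (hN : 1 ≤ N) {lam : ℝ} (hlam : 0 < lam) (c : Fin (2 * N) → ℂ) (y : ℝ) :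
    diffOp N (expSum N lam c) y = -lam * expSum N lam c y := by
  rw [diffOp, iteratedDeriv_expSum, expSum, expSum, Finset.mul_sum, Finset.mul_sum]
  refine Finset.sum_congr rfl fun j _ => ?_
  have h : ((-1 : ℂ)) ^ N * (-1) ^ N = 1 := by rw [← mul_pow]; simp
  rw [charExp_pow hN hlam]
  linear_combination (-(lam * c j * Complex.exp (charExp N lam j * y))) * h

lemma iteratedDeriv_expSum_left (a b : ℝ) (lam : ℝ) (c : Fin (2 * N) → ℂ) (k : ℕ) (hk : k < N) :
    iteratedDeriv k (expSum N lam c) a = ((lam ^ (1 / (2 * (N : ℝ))) : ℝ) : ℂ) ^ k *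
      (deltaMatrix N a b lam).mulVec c ⟨k, by omega⟩ := by
  rw [iteratedDeriv_expSum, expSum, Matrix.mulVec, dotProduct, Finset.mul_sum]
  refine Finset.sum_congr rfl fun j _ => ?_
  simp only [deltaMatrix, Matrix.of_apply, if_pos hk, expScaled_eq]
  rw [charExp, mul_pow]
  ring

lemma iteratedDeriv_expSum_right (a b : ℝ) (lam : ℝ) (c : Fin (2 * N) → ℂ) (k : ℕ) (hk : k < N) :
    iteratedDeriv k (expSum N lam c) b = ((lam ^ (1 / (2 * (N : ℝ))) : ℝ) : ℂ) ^ k *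
      (deltaMatrix N a b lam).mulVec c ⟨N + k, by omega⟩ := by
  rw [iteratedDeriv_expSum, expSum, Matrix.mulVec, dotProduct, Finset.mul_sum]
  refine Finset.sum_congr rfl fun j _ => ?_
  simp only [deltaMatrix, Matrix.of_apply, if_neg (show ¬ N + k < N by omega), expScaled_eq,
    add_tsub_cancel_left]
  rw [charExp, mul_pow]
  ring

/-- All derivatives vanish at the midpoint; since the exponents are distinct, the Vandermonde system
gives zero coefficients. -/
lemma expSum_eq_zero (hN : 1 ≤ N) {a b lam : ℝ} (hab : a < b) (hlam : 0 < lam)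
    {c : Fin (2 * N) → ℂ} (h : ∀ y ∈ Set.Ioo a b, expSum N lam c y = 0) : c = 0 := by
  set y := (a + b) / 2 with hy
  have hyI : y ∈ Set.Ioo a b := ⟨by linarith, by linarith⟩
  have h1 : expSum N lam c =ᶠ[𝓝 y] fun _ => 0 := by
    filter_upwards [isOpen_Ioo.mem_nhds hyI] with z hz
    exact h z hz
  have h2 : (fun j => c j * Complex.exp (charExp N lam j * y)) = 0 := by
    refine Matrix.eq_zero_of_forall_pow_sum_mul_pow_eq_zero (charExp_injective hN hlam) fun k => ?_
    have h3 := h1.iteratedDeriv_eq k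
    rw [iteratedDeriv_expSum] at h3
    simp only [iteratedDeriv_fun_const_zero] at h3
    rw [← h3, expSum]
    refine Finset.sum_congr rfl fun j _ => ?_
    ring
  ext j
  exact (mul_eq_zero.1 (congrFun h2 j)).resolve_right (Complex.exp_ne_zero _)

/-- The determinant `Δ(lam)` does not vanish. -/
theorem Delta_ne_zero (hN : 2 ≤ N) {a b lam : ℝ} (hab : a < b) (hlam : 0 < lam) :
    Delta N a b lam ≠ 0 := by
  have hN1 := one_le_of_two_le hN
  intro h0
  obtain ⟨c, hc, hM⟩ := Matrix.exists_mulVec_eq_zero_iff.2 h0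
  -- The rows of the matrix are the boundary derivatives of orders below `N` up to powers of
  -- `lam^(1/(2N))`, so a null vector yields a Dirichlet eigenfunction with eigenvalue `-lam`.
  have hD : IsDirichlet N a b (expSum N lam c) :=
    ⟨contDiff_expSum lam c,
      fun k hk => by rw [iteratedDeriv_expSum_left a b lam c k hk, hM]; simp,
      fun k hk => by rw [iteratedDeriv_expSum_right a b lam c k hk, hM]; simp⟩
  exact hc (expSum_eq_zero hN1 hab hlam
    (hD.eq_zero_of_eigen hab.le hN hlam fun y _ => diffOp_expSum hN1 hlam c y))

/-- The quotient `(Δ₀⁺ + Δ₀⁻) / Δ`. -/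
def exitTransform (N : ℕ) (a b lam x : ℝ) : ℂ :=
  (DeltaPlus N a b 0 lam x + DeltaMinus N a b 0 lam x) / Delta N a b lam

lemma det_deltaMatrixRow (a b lam x : ℝ) (r : Fin (2 * N)) :
    (deltaMatrixRow N a b lam x r).det = ∑ j, (deltaMatrix N a b lam).adjugate j r *
      Complex.exp (charExp N lam j * x) := by
  have h : deltaMatrixRow N a b lam x r = (deltaMatrix N a b lam).updateRow r
      fun j => Complex.exp (charExp N lam j * x) := by
    ext i j
    by_cases hi : i = r
    · subst hi
      simp [deltaMatrixRow, expScaled_eq]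
    · have : (i : ℕ) ≠ r := fun h => hi (Fin.ext h)
      simp [deltaMatrixRow, hi, this]
  rw [h, ← Matrix.cramer_transpose_apply, Matrix.cramer_eq_adjugate_mulVec,
    ← Matrix.adjugate_transpose]
  rfl

/-- The function `(Δ₀⁺ + Δ₀⁻) / Δ` solves the boundary value problem. -/
lemma exists_exitTransform_eq (hN : 2 ≤ N) {a b lam : ℝ} (hab : a < b) (hlam : 0 < lam) :
    ∃ c : Fin (2 * N) → ℂ, exitTransform N a b lam = expSum N lam c ∧
      (deltaMatrix N a b lam).mulVec c =
        fun i : Fin (2 * N) => if (i : ℕ) = 0 ∨ (i : ℕ) = N then 1 else 0 := by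
  have hΔ := Delta_ne_zero hN hab hlam
  set M := deltaMatrix N a b lam with hM
  set i0 : Fin (2 * N) := ⟨0, by omega⟩
  set iN : Fin (2 * N) := ⟨N + 0, by omega⟩
  -- Cramer's rule for the right-hand side with ones in the zeroth-order rows at `a` and at `b`:
  -- expanding a determinant along its replaced row produces adjugate entries.
  refine ⟨fun j => (M.adjugate j i0 + M.adjugate j iN) / Delta N a b lam, ?_, ?_⟩
  · ext y
    have h1 := det_deltaMatrixRow a b lam y i0
    have h2 := det_deltaMatrixRow a b lam y iN
    rw [exitTransform, DeltaPlus, DeltaMinus]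
    change ((deltaMatrixRow N a b lam y iN).det + (deltaMatrixRow N a b lam y i0).det) / _ = _
    rw [h1, h2, expSum, ← Finset.sum_add_distrib, Finset.sum_div]
    refine Finset.sum_congr rfl fun j _ => ?_
    ring
  · ext i
    have h3 : ∀ r, ∑ j, M i j * M.adjugate j r = if i = r then Delta N a b lam else 0 := fun r => by
      have := congrFun (congrFun (Matrix.mul_adjugate M) i) r
      rw [Matrix.mul_apply] at this
      rw [this, Matrix.smul_apply, Matrix.one_apply, smul_eq_mul, mul_ite, mul_one, mul_zero]
      rfl
    have h4 : M.mulVec (fun j => (M.adjugate j i0 + M.adjugate j iN) / Delta N a b lam) i =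
        ((∑ j, M i j * M.adjugate j i0) + ∑ j, M i j * M.adjugate j iN) / Delta N a b lam := by
      rw [Matrix.mulVec, dotProduct, ← Finset.sum_add_distrib, Finset.sum_div]
      refine Finset.sum_congr rfl fun j _ => ?_
      ring
    rw [h4, h3, h3]
    have e0 : i = i0 ↔ (i : ℕ) = 0 := Fin.ext_iff
    have eN : i = iN ↔ (i : ℕ) = N := Fin.ext_iff
    simp only [e0, eN]
    by_cases c0 : (i : ℕ) = 0
    · have : ¬ (i : ℕ) = N := by omega
      simp [c0, hΔ, show (0 : ℕ) ≠ N by omega]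
    · by_cases c1 : (i : ℕ) = N
      · simp [c1, hΔ, show N ≠ 0 by omega]
      · simp [c0, c1]

lemma contDiff_exitTransform (hN : 2 ≤ N) {a b lam : ℝ} (hab : a < b) (hlam : 0 < lam) :
    ContDiff ℝ ∞ (exitTransform N a b lam) := by
  obtain ⟨c, hc, -⟩ := exists_exitTransform_eq hN hab hlam
  rw [hc]
  exact contDiff_expSum lam c

/-- The Laplace transform of the survival function. -/
def survivalTransform (N : ℕ) (a b lam x : ℝ) : ℂ :=
  (lam : ℂ)⁻¹ * (1 - exitTransform N a b lam x)

lemma iteratedDeriv_survivalTransform (hN : 2 ≤ N) {a b lam : ℝ} (hab : a < b) (hlam : 0 < lam)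
    (k : ℕ) (y : ℝ) : iteratedDeriv k (survivalTransform N a b lam) y =
      (lam : ℂ)⁻¹ * ((if k = 0 then 1 else 0) - iteratedDeriv k (exitTransform N a b lam) y) := by
  have h := contDiff_infty.1 (contDiff_exitTransform hN hab hlam) k
  have e : survivalTransform N a b lam =
      fun y => (lam : ℂ)⁻¹ * ((fun _ : ℝ => (1 : ℂ)) - exitTransform N a b lam) y := rfl
  rw [e, iteratedDeriv_const_mul_field, iteratedDeriv_sub contDiffAt_const h.contDiffAt,
    iteratedDeriv_const]

/-- The boundary data of the quotient are those of the constant `1` up to order `N - 1`, so the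
difference vanishes to order `N`. -/
lemma isDirichlet_survivalTransform (hN : 2 ≤ N) {a b lam : ℝ} (hab : a < b) (hlam : 0 < lam) :
    IsDirichlet N a b (survivalTransform N a b lam) := by
  obtain ⟨c, hc, hM⟩ := exists_exitTransform_eq hN hab hlam
  refine ⟨contDiff_const.mul (contDiff_const.sub (contDiff_exitTransform hN hab hlam)),
    fun k hk => ?_, fun k hk => ?_⟩
  · rw [iteratedDeriv_survivalTransform hN hab hlam, hc,
      iteratedDeriv_expSum_left a b lam c k hk, hM]
    rcases eq_or_ne k 0 with rfl | h0
    · simp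
    · simp [h0, hk.ne]
  · rw [iteratedDeriv_survivalTransform hN hab hlam, hc,
      iteratedDeriv_expSum_right a b lam c k hk, hM]
    rcases eq_or_ne k 0 with rfl | h0
    · simp
    · simp [h0, show N ≠ 0 by omega]

lemma diffOp_survivalTransform (hN : 2 ≤ N) {a b lam : ℝ} (hab : a < b) (hlam : 0 < lam) (y : ℝ) :
    diffOp N (survivalTransform N a b lam) y = exitTransform N a b lam y := by
  obtain ⟨c, hc, -⟩ := exists_exitTransform_eq hN hab hlam
  have h := diffOp_expSum (one_le_of_two_le hN) hlam c y
  rw [← hc, diffOp] at h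
  have hl : (lam : ℂ) ≠ 0 := by exact_mod_cast hlam.ne'
  rw [diffOp, iteratedDeriv_survivalTransform hN hab hlam, if_neg (by omega), zero_sub]
  field_simp
  linear_combination -h

end PseudoBM

namespace PseudoBM

open scoped ContDiff

/-! ### Uniqueness of Laplace transforms -/

/-- A monomial `exp (-t)^i` against the weight `exp (-t)` is the transform at the integer point `i +
1`. -/
lemma integral_polynomial_exp_eq_zero {h : ℝ → ℝ}
    (hi : ∀ lam : ℝ, 0 < lam → IntegrableOn (fun t => h t * Real.exp (-lam * t)) (Set.Ioi 0))
    (h0 : ∀ lam : ℝ, 0 < lam → ∫ t in Set.Ioi (0 : ℝ), h t * Real.exp (-lam * t) = 0)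
    (p : Polynomial ℝ) :
    IntegrableOn (fun t => h t * Real.exp (-1 * t) * p.eval (Real.exp (-t))) (Set.Ioi 0) ∧
      ∫ t in Set.Ioi (0 : ℝ), h t * Real.exp (-1 * t) * p.eval (Real.exp (-t)) = 0 := by
  have e : ∀ t, h t * Real.exp (-1 * t) * p.eval (Real.exp (-t)) =
      ∑ i ∈ Finset.range (p.natDegree + 1),
        p.coeff i * (h t * Real.exp (-((i : ℝ) + 1) * t)) := fun t => by
    rw [Polynomial.eval_eq_sum_range, Finset.mul_sum]
    refine Finset.sum_congr rfl fun i _ => ?_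
    have : Real.exp (-((i : ℝ) + 1) * t) = Real.exp (-1 * t) * Real.exp (-t) ^ i := by
      rw [← Real.exp_nat_mul, ← Real.exp_add]
      ring_nf
    rw [this]
    ring
  have hi' : ∀ i ∈ Finset.range (p.natDegree + 1), Integrable
      (fun t => p.coeff i * (h t * Real.exp (-((i : ℝ) + 1) * t)))
      (volume.restrict (Set.Ioi 0)) := fun i _ => (hi _ (by positivity)).const_mul _
  simp only [e]
  refine ⟨integrable_finsetSum _ hi', ?_⟩
  rw [integral_finsetSum _ hi']
  refine Finset.sum_eq_zero fun i _ => ?_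
  rw [integral_const_mul, h0 _ (by positivity), mul_zero]

/-- Weierstrass approximation in `s = exp (-t) ∈ [0, 1]`, the weight `h t exp (-t)` being
integrable. -/
lemma integral_comp_exp_eq_zero {h : ℝ → ℝ}
    (hi : ∀ lam : ℝ, 0 < lam → IntegrableOn (fun t => h t * Real.exp (-lam * t)) (Set.Ioi 0))
    (h0 : ∀ lam : ℝ, 0 < lam → ∫ t in Set.Ioi (0 : ℝ), h t * Real.exp (-lam * t) = 0)
    {φ g : ℝ → ℝ} (hφ : ContinuousOn φ (Set.Icc 0 1)) (hg : Continuous g)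
    (hgφ : ∀ t, 0 < t → φ (Real.exp (-t)) = g t) :
    ∫ t in Set.Ioi (0 : ℝ), h t * Real.exp (-1 * t) * g t = 0 := by
  set F : ℝ → ℝ := fun t => h t * Real.exp (-1 * t) with hF
  have hFi : IntegrableOn F (Set.Ioi 0) := hi 1 one_pos
  have hmem : ∀ t ∈ Set.Ioi (0 : ℝ), Real.exp (-t) ∈ Set.Icc (0 : ℝ) 1 := fun t ht =>
    ⟨(Real.exp_pos _).le, Real.exp_le_one_iff.2 (neg_nonpos.2 (le_of_lt ht))⟩
  set A := ∫ t in Set.Ioi (0 : ℝ), ‖F t‖ with hA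
  have hA0 : 0 ≤ A := integral_nonneg fun t => norm_nonneg _
  rw [← norm_le_zero_iff]
  refine le_of_forall_pos_le_add fun ε hε => ?_
  rw [zero_add]
  obtain ⟨p, hp⟩ := exists_polynomial_near_of_continuousOn 0 1 φ hφ (ε / (A + 1)) (by positivity)
  obtain ⟨i1, e1⟩ := integral_polynomial_exp_eq_zero hi h0 p
  have hb : ∀ t ∈ Set.Ioi (0 : ℝ), ‖F t * (g t - p.eval (Real.exp (-t)))‖ ≤
      ‖F t‖ * (ε / (A + 1)) := fun t ht => by
    rw [norm_mul]
    gcongr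
    rw [← hgφ t ht, norm_sub_rev]
    exact (hp _ (hmem t ht)).le
  have i3 : IntegrableOn (fun t => F t * (g t - p.eval (Real.exp (-t)))) (Set.Ioi 0) := by
    refine (hFi.norm.mul_const (ε / (A + 1))).mono' (hFi.aestronglyMeasurable.mul
      (Continuous.aestronglyMeasurable (by fun_prop))) ?_
    filter_upwards [ae_restrict_mem measurableSet_Ioi] with t ht
    exact hb t ht
  have e2 : ∫ t in Set.Ioi (0 : ℝ), F t * g t =
      ∫ t in Set.Ioi (0 : ℝ), F t * (g t - p.eval (Real.exp (-t))) := by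
    have : ∫ t in Set.Ioi (0 : ℝ), F t * g t =
      (∫ t in Set.Ioi (0 : ℝ), F t * (g t - p.eval (Real.exp (-t)))) +
        ∫ t in Set.Ioi (0 : ℝ), F t * p.eval (Real.exp (-t)) := by
      rw [← integral_add i3 i1]
      congr 1 with t
      ring
    rw [this]
    exact add_eq_left.2 e1
  rw [e2]
  calc _ ≤ ∫ t in Set.Ioi (0 : ℝ), ‖F t‖ * (ε / (A + 1)) := by
        refine norm_integral_le_of_norm_le (hFi.norm.mul_const _) ?_
        filter_upwards [ae_restrict_mem measurableSet_Ioi] with t ht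
        exact hb t ht
    _ = A * ε / (A + 1) := by rw [integral_mul_const]; ring
    _ ≤ ε := by
      rw [div_le_iff₀ (by positivity)]
      nlinarith

/-- A function with vanishing Laplace transform vanishes almost everywhere. -/
lemma ae_eq_zero_of_laplace_eq_zero {h : ℝ → ℝ}
    (hi : ∀ lam : ℝ, 0 < lam → IntegrableOn (fun t => h t * Real.exp (-lam * t)) (Set.Ioi 0))
    (h0 : ∀ lam : ℝ, 0 < lam → ∫ t in Set.Ioi (0 : ℝ), h t * Real.exp (-lam * t) = 0) :
    ∀ᵐ t ∂(volume.restrict (Set.Ioi (0 : ℝ))), h t = 0 := by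
  have key : ∀ᵐ t, t ∈ Set.Ioi (0 : ℝ) → h t * Real.exp (-1 * t) = 0 := by
    refine isOpen_Ioi.ae_eq_zero_of_integral_contDiff_smul_eq_zero
      (hi 1 one_pos).locallyIntegrableOn fun g hg hgc hgs => ?_
    have hg0 : ∀ t ≤ 0, g t = 0 := fun t ht =>
      image_eq_zero_of_notMem_tsupport fun hc => (hgs hc).not_ge ht
    obtain ⟨M, hM⟩ := hgc.isCompact.bddAbove
    have hgM : ∀ t, M < t → g t = 0 := fun t ht =>
      image_eq_zero_of_notMem_tsupport fun hc => (hM hc).not_gt ht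
    -- Compact support kills the function for small `s > 0`. At `s = 0` the convention `Real.log 0 =
    -- 0` gives `g 0`, which is also zero because the support lies in the open half-line.
    have hφ : ContinuousOn (fun s => g (-Real.log s)) (Set.Icc 0 1) := fun s hs => by
      rcases hs.1.eq_or_lt with h1 | h1
      · have h2 : (fun s => g (-Real.log s)) =ᶠ[𝓝[Set.Icc 0 1] s] fun _ => 0 := by
          rw [← h1]
          filter_upwards [self_mem_nhdsWithin,
            mem_nhdsWithin_of_mem_nhds (gt_mem_nhds (Real.exp_pos (-M)))] with z hz hzM
          rcases hz.1.eq_or_lt with hz0 | hz0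
          · rw [← hz0, Real.log_zero, neg_zero]
            exact hg0 0 le_rfl
          · refine hgM _ ?_
            have := (Real.log_lt_iff_lt_exp hz0).2 hzM
            linarith
        exact continuousWithinAt_const.congr_of_eventuallyEq h2 (h2.self_of_nhdsWithin hs)
      · exact (hg.continuous.continuousAt.comp
          (Real.continuousAt_log h1.ne').neg).continuousWithinAt
    have h1 := integral_comp_exp_eq_zero hi h0 hφ hg.continuous
      fun t _ => by rw [Real.log_exp, neg_neg]
    rw [← h1, ← integral_indicator measurableSet_Ioi]
    congr 1 with t
    by_cases ht : t ∈ Set.Ioi (0 : ℝ)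
    · rw [Set.indicator_of_mem ht, smul_eq_mul, mul_comm]
    · rw [Set.indicator_of_notMem ht, hg0 t (not_lt.1 ht), zero_smul]
  refine (ae_restrict_iff' measurableSet_Ioi).2 (key.mono fun t h1 ht => ?_)
  exact (mul_eq_zero.1 (h1 ht)).resolve_right (Real.exp_pos _).ne'

/-- Uniqueness of Laplace transforms. -/
theorem HasLaplaceTransform.ae_eq {f g : ℝ → ℝ} {F : ℝ → ℂ} (hf : HasLaplaceTransform f F)
    (hg : HasLaplaceTransform g F) : ∀ᵐ t ∂(volume.restrict (Set.Ioi (0 : ℝ))), g t = f t := by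
  have e : ∀ lam t : ℝ, (g t - f t) * Real.exp (-lam * t) =
      g t * Real.exp (-lam * t) - f t * Real.exp (-lam * t) := fun lam t => sub_mul _ _ _
  refine (ae_eq_zero_of_laplace_eq_zero (h := fun t => g t - f t) (fun lam hlam => ?_)
    fun lam hlam => ?_).mono fun t ht => sub_eq_zero.1 ht
  · simp only [e]
    exact (hg lam hlam).1.sub (hf lam hlam).1
  · simp only [e]
    rw [integral_sub (hg lam hlam).1 (hf lam hlam).1, sub_eq_zero]
    exact_mod_cast (hg lam hlam).2.trans (hf lam hlam).2.symm

end PseudoBM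

namespace PseudoBM

/-! ### Laplace transforms of functions of linear growth -/

lemma integrableOn_linear_mul_exp {lam : ℝ} (hlam : 0 < lam) (K : ℝ) :
    IntegrableOn (fun t : ℝ => Real.exp (-lam * t) * (K * (1 + t))) (Set.Ioi 0) := by
  have h0 := integrableOn_exp_mul_Ioi (neg_lt_zero.2 hlam) 0
  have h1 : IntegrableOn (fun t : ℝ => t ^ (1 : ℝ) * Real.exp (-lam * t ^ (1 : ℝ)))
      (Set.Ioi 0) := integrableOn_rpow_mul_exp_neg_mul_rpow (by norm_num) one_pos hlam
  simp only [Real.rpow_one] at h1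
  exact ((Integrable.fun_add h0 h1).const_mul K).congr
    (Eventually.of_forall fun t => by simp only; ring)

lemma integrableOn_exp_smul {E : Type*} [NormedAddCommGroup E] [NormedSpace ℝ E] {f : ℝ → E}
    (hf : ContinuousOn f (Set.Ioi 0)) {K : ℝ}
    (hK : ∀ t : ℝ, 0 < t → ‖f t‖ ≤ K * (1 + t)) {lam : ℝ} (hlam : 0 < lam) :
    IntegrableOn (fun t : ℝ => Real.exp (-lam * t) • f t) (Set.Ioi 0) := by
  refine (integrableOn_linear_mul_exp hlam K).mono' ?_ ?_
  · exact (ContinuousOn.smul (by fun_prop) hf).aestronglyMeasurable measurableSet_Ioi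
  · refine (ae_restrict_iff' measurableSet_Ioi).2 (Eventually.of_forall fun t ht => ?_)
    rw [norm_smul, Real.norm_eq_abs, Real.abs_exp]
    exact mul_le_mul_of_nonneg_left (hK t ht) (Real.exp_pos _).le

lemma tendsto_exp_smul_atTop {E : Type*} [NormedAddCommGroup E] [NormedSpace ℝ E] {f : ℝ → E}
    {K : ℝ} (hK : ∀ t : ℝ, 0 < t → ‖f t‖ ≤ K * (1 + t)) {lam : ℝ} (hlam : 0 < lam) :
    Tendsto (fun t : ℝ => Real.exp (-lam * t) • f t) atTop (𝓝 0) := by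
  have h0 : Tendsto (fun t : ℝ => Real.exp (-lam * t)) atTop (𝓝 0) :=
    Real.tendsto_exp_atBot.comp (tendsto_id.const_mul_atTop_of_neg (neg_lt_zero.2 hlam))
  have h1 : Tendsto (fun t : ℝ => t ^ (1 : ℝ) * Real.exp (-lam * t)) atTop (𝓝 0) :=
    tendsto_rpow_mul_exp_neg_mul_atTop_nhds_zero 1 lam hlam
  simp only [Real.rpow_one] at h1
  have h2 : Tendsto (fun t : ℝ => Real.exp (-lam * t) * (K * (1 + t))) atTop (𝓝 0) := by
    have := (h0.add h1).const_mul K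
    rw [add_zero, mul_zero] at this
    exact this.congr fun t => by ring
  refine squeeze_zero_norm' ?_ h2
  filter_upwards [eventually_gt_atTop 0] with t ht
  rw [norm_smul, Real.norm_eq_abs, Real.abs_exp]
  exact mul_le_mul_of_nonneg_left (hK t ht) (Real.exp_pos _).le

/-- The Laplace transform of a derivative. -/
lemma integral_exp_smul_deriv {f f' : ℝ → ℂ} {c : ℂ} {K K' : ℝ}
    (hf : ∀ t : ℝ, 0 < t → HasDerivAt f (f' t) t) (hf' : ContinuousOn f' (Set.Ioi 0))
    (h0 : Tendsto f (𝓝[>] 0) (𝓝 c)) (hK : ∀ t : ℝ, 0 < t → ‖f t‖ ≤ K * (1 + t))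
    (hK' : ∀ t : ℝ, 0 < t → ‖f' t‖ ≤ K' * (1 + t)) {lam : ℝ} (hlam : 0 < lam) :
    ∫ t in Set.Ioi (0 : ℝ), Real.exp (-lam * t) • f' t =
      lam • (∫ t in Set.Ioi (0 : ℝ), Real.exp (-lam * t) • f t) - c := by
  have hfc : ContinuousOn f (Set.Ioi 0) := fun t ht => (hf t ht).continuousAt.continuousWithinAt
  have i1 := integrableOn_exp_smul hfc hK hlam
  have i2 := integrableOn_exp_smul hf' hK' hlam
  -- The value at `0` is overwritten by the limit `c`, so that the fundamental theorem of calculus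
  -- applies on the closed half-line.
  set F : ℝ → ℂ := Function.update (fun t => Real.exp (-lam * t) • f t) 0 c with hF
  have e1 : ∀ t : ℝ, 0 < t → F t = Real.exp (-lam * t) • f t := fun t ht =>
    Function.update_of_ne ht.ne' _ _
  have hd : ∀ t ∈ Set.Ioi (0 : ℝ), HasDerivAt F
      (Real.exp (-lam * t) • f' t - lam • Real.exp (-lam * t) • f t) t := fun t ht => by
    have h1 : HasDerivAt (fun t : ℝ => Real.exp (-lam * t)) (Real.exp (-lam * t) * -lam) t := by
      simpa using ((hasDerivAt_id t).const_mul (-lam)).exp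
    have h2 := h1.fun_smul (hf t ht)
    refine (h2.congr_of_eventuallyEq ?_).congr_deriv ?_
    · filter_upwards [lt_mem_nhds (Set.mem_Ioi.1 ht)] with s hs using e1 s hs
    · rw [smul_smul, sub_eq_add_neg, ← neg_smul]
      congr 2
      ring
  have hc : ContinuousWithinAt F (Set.Ici 0) 0 := by
    rw [← continuousWithinAt_Ioi_iff_Ici, ContinuousWithinAt, hF, Function.update_self]
    have h1 : Tendsto (fun t : ℝ => Real.exp (-lam * t)) (𝓝[>] 0) (𝓝 1) := by
      have : ContinuousAt (fun t : ℝ => Real.exp (-lam * t)) 0 := by fun_prop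
      simpa using this.tendsto.mono_left nhdsWithin_le_nhds
    have h2 := h1.smul h0
    rw [one_smul] at h2
    refine h2.congr' ?_
    filter_upwards [self_mem_nhdsWithin] with s hs using (e1 s hs).symm
  have ht : Tendsto F atTop (𝓝 0) := (tendsto_exp_smul_atTop hK hlam).congr' (by
    filter_upwards [eventually_gt_atTop 0] with s hs using (e1 s hs).symm)
  have := integral_Ioi_of_hasDerivAt_of_tendsto hc hd (i2.sub (i1.smul lam)) ht
  have i3 : IntegrableOn (fun t : ℝ => lam • Real.exp (-lam * t) • f t) (Set.Ioi 0) := i1.smul lam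
  rw [integral_sub i2 i3, hF, Function.update_self, integral_smul] at this
  linear_combination this

/-! ### The survival function -/

section
variable {a b x : ℝ} {N : ℕ} (hN : 2 ≤ N)

/-- The time derivative of the survival function. -/
def survivalDeriv (a b t x : ℝ) : ℂ :=
  evalResolvent hN a b x (heatOp (dirichletResolvent (one_le_of_two_le hN) a b) 1 t (oneL2 a b) -
    heatOp (dirichletResolvent (one_le_of_two_le hN) a b) 2 t (oneL2 a b))

lemma hasDerivAt_evalResolvent_heatOp (k : ℕ) {t : ℝ} (ht : 0 < t) (f : L2 a b) (x : ℝ) :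
    HasDerivAt (fun t => evalResolvent hN a b x
        (heatOp (dirichletResolvent (one_le_of_two_le hN) a b) k t f))
      (evalResolvent hN a b x (heatOp (dirichletResolvent (one_le_of_two_le hN) a b) k t f -
        heatOp (dirichletResolvent (one_le_of_two_le hN) a b) (k + 1) t f)) t := by
  have h := (isUnitOp_dirichletResolvent (a := a) (b := b)
    (one_le_of_two_le hN)).hasDerivAt_heatOp_apply k ht f
  exact ((evalResolvent hN a b x).restrictScalars ℝ).hasFDerivAt.comp_hasDerivAt t h

lemma hasDerivAt_survivalLimit {t : ℝ} (ht : 0 < t) (x : ℝ) :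
    HasDerivAt (fun t => survivalLimit hN a b t x) (survivalDeriv hN a b t x) t :=
  hasDerivAt_evalResolvent_heatOp hN 1 ht (oneL2 a b) x

lemma continuousOn_survivalLimit (x : ℝ) :
    ContinuousOn (fun t => survivalLimit hN a b t x) (Set.Ioi 0) := fun _ ht =>
  (hasDerivAt_survivalLimit hN ht x).continuousAt.continuousWithinAt

lemma continuousOn_survivalDeriv (x : ℝ) :
    ContinuousOn (fun t => survivalDeriv hN a b t x) (Set.Ioi 0) := fun t ht => by
  have h1 := (hasDerivAt_evalResolvent_heatOp hN 1 ht (oneL2 a b) x).continuousAt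
  have h2 := (hasDerivAt_evalResolvent_heatOp hN 2 ht (oneL2 a b) x).continuousAt
  simp only [survivalDeriv, map_sub]
  exact (h1.sub h2).continuousWithinAt

lemma survivalDeriv_im {t : ℝ} (ht : 0 < t) (x : ℝ) : (survivalDeriv hN a b t x).im = 0 := by
  have h := Complex.imCLM.hasFDerivAt.comp_hasDerivAt t (hasDerivAt_survivalLimit hN (a := a)
    (b := b) ht x)
  have h2 : HasDerivAt (fun _ : ℝ => (0 : ℝ)) 0 t := hasDerivAt_const _ _
  refine h.unique (h2.congr_of_eventuallyEq ?_)
  filter_upwards [lt_mem_nhds ht] with s hs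
  exact survivalLimit_im hN hs x

/-- Linear bounds for the survival function and its derivative. -/
lemma exists_survival_linear_bound (hab : a < b) (hx : x ∈ Set.Ioo a b) : ∃ K : ℝ, 0 ≤ K ∧
    ∀ t : ℝ, 0 < t → ‖survivalLimit hN a b t x - 1‖ ≤ K * t ∧
      ‖survivalLimit hN a b t x‖ ≤ (1 + K) * (1 + t) ∧
      ‖survivalDeriv hN a b t x‖ ≤ K * (1 + t) := by
  obtain ⟨C, hC, h⟩ := exists_survivalLimit_lipschitz hN hab hx
  refine ⟨C, hC, fun t ht => ⟨(h t ht).1, ?_, ?_⟩⟩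
  · have h1 := norm_le_norm_add_norm_sub' (survivalLimit hN a b t x) 1
    rw [norm_one] at h1
    nlinarith [(h t ht).1]
  · refine (hasDerivAt_survivalLimit hN ht x).le_of_lip' (by positivity) ?_
    filter_upwards [lt_mem_nhds ht] with s hs
    rcases le_total t s with hts | hst
    · rw [Real.norm_of_nonneg (sub_nonneg.2 hts)]
      exact (h t ht).2 s hts
    · rw [norm_sub_rev, norm_sub_rev s, Real.norm_of_nonneg (sub_nonneg.2 hst)]
      exact ((h s hs).2 t hst).trans (by gcongr)

lemma tendsto_survivalLimit_zero (hab : a < b) (hx : x ∈ Set.Ioo a b) :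
    Tendsto (fun t => survivalLimit hN a b t x) (𝓝[>] 0) (𝓝 1) := by
  obtain ⟨K, -, h⟩ := exists_survival_linear_bound hN hab hx
  rw [tendsto_iff_norm_sub_tendsto_zero]
  have h0 : Tendsto (fun t : ℝ => K * t) (𝓝[>] 0) (𝓝 0) := by
    have : ContinuousAt (fun t : ℝ => K * t) 0 := by fun_prop
    simpa using this.tendsto.mono_left nhdsWithin_le_nhds
  refine squeeze_zero' (Eventually.of_forall fun t => norm_nonneg _) ?_ h0
  filter_upwards [self_mem_nhdsWithin] with t ht using (h t ht).1

/-- The equation `(lam + A)w = 1`, rewritten for `1 + A`, the operator inverted by the resolvent. -/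
lemma toL2_survivalTransform_add (hN : 2 ≤ N) (hab : a < b) {lam : ℝ} (hlam : 0 < lam) :
    toL2 a b (survivalTransform N a b lam) + toL2 a b (diffOp N (survivalTransform N a b lam)) =
      oneL2 a b + (1 - (lam : ℂ)) • toL2 a b (survivalTransform N a b lam) := by
  have hv := isDirichlet_survivalTransform hN hab hlam
  have hc := hv.continuous
  have hd : diffOp N (survivalTransform N a b lam) =
      fun y => 1 + -(lam : ℂ) * survivalTransform N a b lam y := funext fun y => by
    have : (lam : ℂ) ≠ 0 := by exact_mod_cast hlam.ne'
    rw [diffOp_survivalTransform hN hab hlam, survivalTransform]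
    field_simp
    ring
  rw [hd, toL2_add continuous_const (by fun_prop), toL2_const_mul hc, ← oneL2]
  module

/-- The Laplace transform of the survival function. -/
lemma integral_exp_smul_survivalLimit (hab : a < b) (hx : x ∈ Set.Ioo a b) {lam : ℝ}
    (hlam : 0 < lam) :
    ∫ t in Set.Ioi (0 : ℝ), Real.exp (-lam * t) • survivalLimit hN a b t x =
      survivalTransform N a b lam x := by
  set R := dirichletResolvent (one_le_of_two_le hN) a b with hRdef
  have hR := isUnitOp_dirichletResolvent (a := a) (b := b) (one_le_of_two_le hN)
  have hv := isDirichlet_survivalTransform hN hab hlam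
  set v := toL2 a b (survivalTransform N a b lam) with hvdef
  set φ := oneL2 a b + (1 - (lam : ℂ)) • v with hφ
  have hRφ : R φ = v := by
    rw [hφ, ← toL2_survivalTransform_add hN hab hlam]
    exact hv.dirichletResolvent_apply hab.le hN
  set ℓ := evalResolvent hN a b x with hℓ
  -- Since `Rφ = w`, this is `(exp (-tA) w)(x)`. From `Aw = 1 - lam w` one gets `f' = lam f - S` and
  -- `f(0+) = w(x)`; in the Laplace transform of this equation the terms with `f` cancel and leave
  -- the transform of `S`.
  set f : ℝ → ℂ := fun t => ℓ (heatOp R 0 t φ) with hf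
  obtain ⟨K, hK0, hK⟩ := exists_survival_linear_bound hN hab hx
  have hd : ∀ t : ℝ, 0 < t → HasDerivAt f (lam • f t - survivalLimit hN a b t x) t := fun t ht => by
    refine (hasDerivAt_evalResolvent_heatOp hN 0 ht φ x).congr_deriv ?_
    have e1 : heatOp R 0 t φ = heatOp R 1 t v := by
      rw [← hR.apply_heatOp_succ 0 ht, ← hR.heatOp_apply_comm, hRφ]
    have e2 : heatOp R (0 + 1) t φ = heatOp R 1 t (oneL2 a b) + (1 - (lam : ℂ)) • heatOp R 0 t φ := by
      rw [e1, hφ, map_add, map_smul]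
    rw [← hRdef, e2, hf, survivalLimit, ← hRdef, ← hℓ]
    simp only [map_sub, map_add, map_smul, smul_eq_mul, Complex.real_smul]
    ring
  have hfc : ContinuousOn f (Set.Ioi 0) := fun t ht => (hd t ht).continuousAt.continuousWithinAt
  have hfb : ∀ t : ℝ, 0 < t → ‖f t‖ ≤ ‖ℓ‖ * ‖φ‖ * (1 + t) := fun t ht => by
    have h1 : ‖heatOp R 0 t φ‖ ≤ ‖φ‖ := by
      refine ((heatOp R 0 t).le_opNorm φ).trans ?_
      exact mul_le_of_le_one_left (norm_nonneg _) (hR.norm_heatOp_zero_le ht.le)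
    calc ‖f t‖ ≤ ‖ℓ‖ * ‖heatOp R 0 t φ‖ := ℓ.le_opNorm _
      _ ≤ ‖ℓ‖ * ‖φ‖ * 1 := by rw [mul_one]; gcongr
      _ ≤ _ := by gcongr; linarith
  have h0 : Tendsto f (𝓝[>] 0) (𝓝 (survivalTransform N a b lam x)) := by
    have h1 := (ℓ.continuous.tendsto _).comp
      (hR.tendsto_heatOp_zero (denseRange_dirichletResolvent hab.le hN) φ)
    have h2 : ℓ φ = survivalTransform N a b lam x := by
      rw [hℓ, evalResolvent_apply, ← hRdef, hRφ, hvdef, hv.evalAt_eq hab.le hN hx]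
    rwa [h2] at h1
  have hSc := continuousOn_survivalLimit hN (a := a) (b := b) x
  have hSb := fun t ht => (hK t ht).2.1
  have key := integral_exp_smul_deriv hd ((hfc.const_smul lam).sub hSc) h0 hfb
    (K' := lam * (‖ℓ‖ * ‖φ‖) + (1 + K)) (fun t ht => by
      refine (norm_sub_le _ _).trans ?_
      rw [norm_smul, Real.norm_of_nonneg hlam.le, add_mul, mul_assoc]
      gcongr
      exacts [hfb t ht, hSb t ht]) hlam
  have i1 := integrableOn_exp_smul hfc hfb hlam
  have i2 := integrableOn_exp_smul hSc hSb hlam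
  have e : ∫ t in Set.Ioi (0 : ℝ), Real.exp (-lam * t) • (lam • f t - survivalLimit hN a b t x) =
      lam • (∫ t in Set.Ioi (0 : ℝ), Real.exp (-lam * t) • f t) -
        ∫ t in Set.Ioi (0 : ℝ), Real.exp (-lam * t) • survivalLimit hN a b t x := by
    have i3 : IntegrableOn (fun t : ℝ => lam • Real.exp (-lam * t) • f t) (Set.Ioi 0) :=
      i1.smul lam
    rw [← integral_smul, ← integral_sub i3 i2]
    refine integral_congr_ae (Eventually.of_forall fun t => ?_)
    simp only
    rw [smul_sub, smul_comm]
  rw [e] at key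
  exact sub_right_injective key

/-- The Laplace transform of the derivative of the survival function. -/
lemma integral_exp_smul_survivalDeriv (hab : a < b) (hx : x ∈ Set.Ioo a b) {lam : ℝ}
    (hlam : 0 < lam) :
    ∫ t in Set.Ioi (0 : ℝ), Real.exp (-lam * t) • survivalDeriv hN a b t x =
      -exitTransform N a b lam x := by
  obtain ⟨K, hK0, hK⟩ := exists_survival_linear_bound hN hab hx
  rw [integral_exp_smul_deriv (fun t ht => hasDerivAt_survivalLimit hN ht x)
    (continuousOn_survivalDeriv hN x) (tendsto_survivalLimit_zero hN hab hx)
    (fun t ht => (hK t ht).2.1) (fun t ht => (hK t ht).2.2) hlam,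
    integral_exp_smul_survivalLimit hN hab hx hlam, survivalTransform, Complex.real_smul,
    mul_inv_cancel_left₀ (by exact_mod_cast hlam.ne')]
  ring

end

end PseudoBM

namespace PseudoBM

/-! ### The Laplace transform of the sampled exit time -/

lemma intervalIntegral_exp_neg_mul {lam : ℝ} (hlam : 0 < lam) (c d : ℝ) :
    ∫ t in c..d, Real.exp (-lam * t) = lam⁻¹ * (Real.exp (-lam * c) - Real.exp (-lam * d)) := by
  rw [intervalIntegral.integral_comp_mul_left _ (neg_ne_zero.2 hlam.ne'), integral_exp, smul_eq_mul,
    inv_neg]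
  ring

lemma iUnion_Ico_div {m : ℝ} (hm : 0 < m) :
    ⋃ k : ℕ, Set.Ico ((k : ℝ) / m) ((k + 1) / m) = Set.Ici 0 := by
  ext t
  simp only [Set.mem_iUnion, Set.mem_Ico, Set.mem_Ici, div_le_iff₀ hm, lt_div_iff₀ hm]
  refine ⟨fun ⟨k, h1, _⟩ => ?_, fun ht => ⟨⌊t * m⌋₊, Nat.floor_le (by positivity),
    Nat.lt_floor_add_one _⟩⟩
  exact le_of_mul_le_mul_right (by rw [zero_mul]; exact (Nat.cast_nonneg k).trans h1) hm

lemma floor_eq_of_mem_Ico_div {m t : ℝ} (hm : 0 < m) {k : ℕ}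
    (ht : t ∈ Set.Ico ((k : ℝ) / m) ((k + 1) / m)) : ⌊m * t⌋₊ = k := by
  rw [Set.mem_Ico, div_le_iff₀ hm, lt_div_iff₀ hm, mul_comm] at ht
  exact (Nat.floor_eq_iff ((Nat.cast_nonneg k).trans ht.1)).2 ht

lemma measurable_exp_mul_floor (lam m : ℝ) (s : ℕ → ℝ) :
    Measurable fun t : ℝ => Real.exp (-lam * t) * s ⌊m * t⌋₊ := by
  have h1 : Measurable fun t : ℝ => ⌊m * t⌋₊ := Nat.measurable_floor.comp (measurable_const_mul m)
  exact (by fun_prop : Measurable fun t : ℝ => Real.exp (-lam * t)).mul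
    ((measurable_of_countable s).comp h1)

lemma integrableOn_exp_mul_floor {lam m M : ℝ} (hlam : 0 < lam) {s : ℕ → ℝ}
    (hs : ∀ k, |s k| ≤ M) :
    IntegrableOn (fun t : ℝ => Real.exp (-lam * t) * s ⌊m * t⌋₊) (Set.Ioi 0) := by
  refine ((integrableOn_exp_mul_Ioi (neg_lt_zero.2 hlam) 0).mul_const M).mono'
    (measurable_exp_mul_floor lam m s).aestronglyMeasurable (Eventually.of_forall fun t => ?_)
  rw [norm_mul, Real.norm_eq_abs, Real.abs_exp]
  exact mul_le_mul_of_nonneg_left (hs _) (Real.exp_pos _).le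

/-- The Laplace transform of a step function. -/
lemma hasSum_integral_exp_mul_floor {lam m M : ℝ} (hlam : 0 < lam) (hm : 0 < m) {s : ℕ → ℝ}
    (hs : ∀ k, |s k| ≤ M) :
    HasSum (fun k : ℕ => lam⁻¹ * (Real.exp (-lam * (k / m)) - Real.exp (-lam * ((k + 1) / m))) * s k)
      (∫ t in Set.Ioi (0 : ℝ), Real.exp (-lam * t) * s ⌊m * t⌋₊) := by
  have hi := integrableOn_exp_mul_floor (m := m) hlam hs
  rw [← integrableOn_Ici_iff_integrableOn_Ioi, ← iUnion_Ico_div hm] at hi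
  rw [← integral_Ici_eq_integral_Ioi, ← iUnion_Ico_div hm]
  have hd : Pairwise (Function.onFun Disjoint
      fun k : ℕ => Set.Ico ((k : ℝ) / m) ((k + 1) / m)) := fun i j hij =>
    Set.disjoint_left.2 fun t hi hj =>
      hij ((floor_eq_of_mem_Ico_div hm hi).symm.trans (floor_eq_of_mem_Ico_div hm hj))
  convert! hasSum_integral_iUnion (fun k => measurableSet_Ico) hd hi using 1
  funext k
  rw [setIntegral_congr_fun measurableSet_Ico (g := fun t : ℝ => Real.exp (-lam * t) * s k)
    fun t ht => by simp only [floor_eq_of_mem_Ico_div hm ht], integral_mul_const,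
    integral_Ico_eq_integral_Ioc, ← intervalIntegral.integral_of_le (by gcongr; linarith),
    intervalIntegral_exp_neg_mul hlam]

section
variable {a b x : ℝ} {N : ℕ}

lemma exists_survival_mesh_bound (hN : 2 ≤ N) (a b x : ℝ) (n : ℕ) :
    ∃ M : ℝ, ∀ k, |survival N a b (1 / 2 ^ n) k x| ≤ M := by
  obtain ⟨C, -, h⟩ := exists_survival_bound a b hN
  have h2 : (0 : ℝ) < 1 / 2 ^ n := by positivity
  exact ⟨_, fun k => h _ h2 k x _ h2 (le_mul_of_one_le_right h2.le (by
    linarith [(Nat.cast_nonneg k : (0 : ℝ) ≤ k)]))⟩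

lemma exitLaplaceTerm_zero (hx : x ∈ Set.Ioo a b) (n : ℕ) (lam : ℝ) :
    exitLaplaceTerm N a b n x lam 0 = 0 := by
  rw [exitLaplaceTerm, exitProb_zero, if_pos hx, mul_zero]

/-- Abel summation: with `r = exp (-lam/2^n)` the series of `r^(k+1)(s_k - s_(k+1))` equals `1 - (1
- r) ∑ r^k s_k`, and `(1 - r)r^k` is `lam` times the integral of `exp (-lam t)` over the `k`-th
dyadic cell. -/
lemma hasSum_exitLaplaceTerm (hN : 2 ≤ N) (hx : x ∈ Set.Ioo a b) {lam : ℝ} (hlam : 0 < lam)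
    (n : ℕ) : HasSum (exitLaplaceTerm N a b n x lam)
      (1 - lam * ∫ t in Set.Ioi (0 : ℝ),
        Real.exp (-lam * t) * survival N a b (1 / 2 ^ n) ⌊2 ^ n * t⌋₊ x) := by
  obtain ⟨M, hM⟩ := exists_survival_mesh_bound hN a b x n
  have h2 : (0 : ℝ) < 2 ^ n := by positivity
  set s : ℕ → ℝ := fun k => survival N a b (1 / 2 ^ n) k x with hs
  set r : ℝ := Real.exp (-lam * (1 / 2 ^ n)) with hr
  have hr1 : r < 1 := by
    have : 0 < lam * (1 / 2 ^ n) := by positivity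
    exact (Real.exp_lt_exp.2 (by linarith)).trans_eq Real.exp_zero
  have hr0 : 0 < r := Real.exp_pos _
  have er : ∀ k : ℕ, Real.exp (-lam * ((k : ℝ) / 2 ^ n)) = r ^ k := fun k => by
    rw [hr, ← Real.exp_nat_mul]
    ring_nf
  have hsum : Summable fun k => r ^ k * s k := by
    refine Summable.of_norm_bounded ((summable_geometric_of_lt_one hr0.le hr1).mul_right M)
      fun k => ?_
    rw [norm_mul, norm_pow, Real.norm_of_nonneg hr0.le]
    exact mul_le_mul_of_nonneg_left (hM k) (by positivity)
  obtain ⟨A, hA⟩ := hsum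
  have hI : lam * ∫ t in Set.Ioi (0 : ℝ), Real.exp (-lam * t) * s ⌊2 ^ n * t⌋₊ = (1 - r) * A := by
    have h3 := (hasSum_integral_exp_mul_floor hlam h2 hM).mul_left lam
    refine h3.unique ((hA.mul_left (1 - r)).congr_fun fun k => ?_)
    have := er (k + 1)
    rw [Nat.cast_succ] at this
    rw [er, this, pow_succ]
    field_simp
    rfl
  have h4 : HasSum (fun k => r ^ (k + 1) * s (k + 1)) (A - 1) := by
    have := (hasSum_nat_add_iff' 1).2 hA
    simpa [hs, survival] using this
  rw [hI, ← hasSum_nat_add_iff' 1]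
  simp only [Finset.sum_range_one, exitLaplaceTerm_zero hx]
  convert! (hA.mul_left r).sub h4 using 1
  · funext k
    rw [exitLaplaceTerm, er, exitProb_eq_survival_sub (one_le_of_two_le hN) n hx]
    ring
  · ring

lemma integrableOn_survival_majorant {lam : ℝ} (hlam : 0 < lam) (C : ℝ) :
    IntegrableOn (fun t : ℝ => Real.exp (-lam * t) *
      (1 + Real.sqrt C * (1 + 2 * t ^ (-(1 / 2) : ℝ)))) (Set.Ioi 0) := by
  have h0 := (integrableOn_exp_mul_Ioi (neg_lt_zero.2 hlam) 0).mul_const (1 + Real.sqrt C)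
  have h1 : IntegrableOn (fun t : ℝ => t ^ (-(1 / 2) : ℝ) * Real.exp (-lam * t ^ (1 : ℝ)))
      (Set.Ioi 0) := integrableOn_rpow_mul_exp_neg_mul_rpow (by norm_num) one_pos hlam
  simp only [Real.rpow_one] at h1
  exact (Integrable.fun_add h0 (h1.mul_const (2 * Real.sqrt C))).congr
    (Eventually.of_forall fun t => by simp only; ring)

lemma sqrt_one_add_two_div_le {C t : ℝ} (hC : 0 ≤ C) (ht : 0 < t) :
    Real.sqrt (C * (1 + 2 / t)) ≤ Real.sqrt C * (1 + 2 * t ^ (-(1 / 2) : ℝ)) := by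
  rw [Real.sqrt_mul hC]
  refine mul_le_mul_of_nonneg_left ?_ (Real.sqrt_nonneg _)
  have h1 : 0 < t ^ (-(1 / 2) : ℝ) := Real.rpow_pos_of_pos ht _
  have h2 : (t ^ (-(1 / 2) : ℝ)) ^ 2 = 1 / t := by
    rw [← Real.rpow_natCast, ← Real.rpow_mul ht.le]
    norm_num [Real.rpow_neg_one]
  refine Real.sqrt_le_iff.2 ⟨by positivity, ?_⟩
  have h3 : 2 / t = 2 * (1 / t) := by ring
  rw [h3, ← h2]
  nlinarith

/-- Dominated convergence; the bound for the survival functions is uniform in the mesh and grows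
only like `t^(-1/2)` as `t → 0`. It applies because `t ≤ 2^(-n)(⌊2^n t⌋ + 1)`. -/
lemma tendsto_integral_survival (hN : 2 ≤ N) (a b x : ℝ) {lam : ℝ} (hlam : 0 < lam) :
    Tendsto (fun n : ℕ => ∫ t in Set.Ioi (0 : ℝ),
        Real.exp (-lam * t) * survival N a b (1 / 2 ^ n) ⌊2 ^ n * t⌋₊ x) atTop
      (𝓝 (∫ t in Set.Ioi (0 : ℝ), Real.exp (-lam * t) * (survivalLimit hN a b t x).re)) := by
  obtain ⟨C, hC, h⟩ := exists_survival_bound a b hN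
  refine tendsto_integral_of_dominated_convergence _
    (fun n => (measurable_exp_mul_floor lam (2 ^ n)
      fun k => survival N a b (1 / 2 ^ n) k x).aestronglyMeasurable)
    (integrableOn_survival_majorant hlam C) (fun n => ?_) ?_
  · refine (ae_restrict_iff' measurableSet_Ioi).2 (Eventually.of_forall fun t ht => ?_)
    rw [norm_mul, Real.norm_eq_abs, Real.abs_exp]
    refine mul_le_mul_of_nonneg_left ?_ (Real.exp_pos _).le
    refine (h (1 / 2 ^ n) (by positivity) _ x t ht ?_).trans
      (add_le_add_right (sqrt_one_add_two_div_le hC ht) 1)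
    rw [one_div, inv_mul_eq_div, le_div_iff₀ (by positivity), mul_comm]
    exact (Nat.lt_floor_add_one _).le
  · refine (ae_restrict_iff' measurableSet_Ioi).2 (Eventually.of_forall fun t ht => ?_)
    exact (tendsto_survival_re hN ht x).const_mul _

/-! ### Density and distribution function of the exit time -/

/-- The density of the exit time. -/
def exitDensity (hN : 2 ≤ N) (a b t x : ℝ) : ℝ := -(survivalDeriv hN a b t x).re

/-- The distribution function of the exit time. -/
def exitDistribution (hN : 2 ≤ N) (a b t x : ℝ) : ℝ :=
  -- The value at `t = 0` is set by hand: `heatFun 1 0` is unbounded near `r = 0`, so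
  -- `survivalLimit` carries no information there.
  if 0 < t then 1 - (survivalLimit hN a b t x).re else 0

lemma tendsto_exitCdf (hN : 2 ≤ N) (hx : x ∈ Set.Ioo a b) {t : ℝ} (ht : 0 ≤ t) :
    Tendsto (fun n : ℕ => exitCdf N a b n x t) atTop (𝓝 (exitDistribution hN a b t x)) := by
  simp only [fun n => exitCdf_eq (one_le_of_two_le hN) n hx t, exitDistribution]
  rcases ht.eq_or_lt with rfl | ht
  · simp [survival]
  · rw [if_pos ht]
    exact (tendsto_survival_re hN ht x).const_sub 1

lemma continuousOn_exitDensity (hN : 2 ≤ N) (a b x : ℝ) :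
    ContinuousOn (fun t => exitDensity hN a b t x) (Set.Ioi 0) :=
  (Complex.continuous_re.comp_continuousOn (continuousOn_survivalDeriv hN x)).neg

lemma hasDerivAt_exitDistribution (hN : 2 ≤ N) (a b x : ℝ) {t : ℝ} (ht : 0 < t) :
    HasDerivAt (fun t => exitDistribution hN a b t x) (exitDensity hN a b t x) t := by
  have h := Complex.reCLM.hasFDerivAt.comp_hasDerivAt t
    (hasDerivAt_survivalLimit hN (a := a) (b := b) ht x)
  refine (h.const_sub 1).congr_of_eventuallyEq ?_
  filter_upwards [lt_mem_nhds ht] with s hs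
  exact if_pos hs

lemma exists_exitDensity_bound (hN : 2 ≤ N) (hab : a < b) (hx : x ∈ Set.Ioo a b) :
    ∃ K : ℝ, ∀ t : ℝ, 0 < t → ‖exitDensity hN a b t x‖ ≤ K * (1 + t) := by
  obtain ⟨K, -, h⟩ := exists_survival_linear_bound hN hab hx
  refine ⟨K, fun t ht => le_trans ?_ (h t ht).2.2⟩
  rw [exitDensity, norm_neg]
  exact Complex.abs_re_le_norm _

lemma intervalIntegrable_exitDensity (hN : 2 ≤ N) (hab : a < b) (hx : x ∈ Set.Ioo a b) {t : ℝ}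
    (ht : 0 ≤ t) : IntervalIntegrable (fun s => exitDensity hN a b s x) volume 0 t := by
  obtain ⟨K, h⟩ := exists_exitDensity_bound hN hab hx
  rw [intervalIntegrable_iff_integrableOn_Ioc_of_le ht]
  have hi : IntegrableOn (fun s : ℝ => K * (1 + s)) (Set.Ioc 0 t) :=
    (by fun_prop : Continuous fun s : ℝ => K * (1 + s)).integrableOn_Ioc
  refine hi.mono' (((continuousOn_exitDensity hN a b x).mono
    fun s hs => hs.1).aestronglyMeasurable measurableSet_Ioc) ?_
  exact (ae_restrict_iff' measurableSet_Ioc).2 (Eventually.of_forall fun s hs => h s hs.1)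

/-- The fundamental theorem of calculus on `(0, t)`. It relies on interior regularity at both
points: the linear bound makes the density integrable near `0`, and the survival function tends to
`1`. -/
lemma exitDistribution_eq_integral (hN : 2 ≤ N) (hab : a < b) (hx : x ∈ Set.Ioo a b) {t : ℝ}
    (ht : 0 ≤ t) : exitDistribution hN a b t x = ∫ s in (0 : ℝ)..t, exitDensity hN a b s x := by
  rcases ht.eq_or_lt with rfl | ht
  · simp [exitDistribution]
  have h0 : Tendsto (fun s => exitDistribution hN a b s x) (𝓝[>] 0) (𝓝 0) := by
    have h1 := ((Complex.continuous_re.tendsto _).comp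
      (tendsto_survivalLimit_zero hN hab hx)).const_sub 1
    rw [Complex.one_re, sub_self] at h1
    refine h1.congr' ?_
    filter_upwards [self_mem_nhdsWithin] with s hs using (if_pos hs).symm
  have h1 : Tendsto (fun s => exitDistribution hN a b s x) (𝓝[<] t)
      (𝓝 (exitDistribution hN a b t x)) :=
    (hasDerivAt_exitDistribution hN a b x ht).continuousAt.tendsto.mono_left nhdsWithin_le_nhds
  rw [intervalIntegral.integral_eq_sub_of_hasDerivAt_of_tendsto ht
    (fun s hs => hasDerivAt_exitDistribution hN a b x hs.1)
    (intervalIntegrable_exitDensity hN hab hx ht.le) h0 h1, sub_zero]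

lemma hasLaplaceTransform_exitDensity (hN : 2 ≤ N) (hab : a < b) (hx : x ∈ Set.Ioo a b) :
    HasLaplaceTransform (fun t => exitDensity hN a b t x)
      (fun lam => exitTransform N a b lam x) := by
  obtain ⟨K, h⟩ := exists_exitDensity_bound hN hab hx
  refine fun lam hlam => ⟨?_, ?_⟩
  · exact (integrableOn_exp_smul (continuousOn_exitDensity hN a b x) h hlam).congr
      (Eventually.of_forall fun t => mul_comm _ _)
  · simp only
    rw [← integral_complex_ofReal, ← neg_neg (exitTransform N a b lam x),
      ← integral_exp_smul_survivalDeriv hN hab hx hlam, ← integral_neg]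
    refine setIntegral_congr_fun measurableSet_Ioi fun t ht => ?_
    have h2 : ((survivalDeriv hN a b t x).re : ℂ) = survivalDeriv hN a b t x :=
      Complex.ext rfl (by simp [survivalDeriv_im hN ht])
    simp only [exitDensity, Complex.real_smul]
    push_cast
    rw [h2]
    ring

lemma integral_exp_mul_survivalLimit_re (hN : 2 ≤ N) (hab : a < b) (hx : x ∈ Set.Ioo a b) {lam : ℝ}
    (hlam : 0 < lam) :
    ((∫ t in Set.Ioi (0 : ℝ), Real.exp (-lam * t) * (survivalLimit hN a b t x).re : ℝ) : ℂ) =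
      survivalTransform N a b lam x := by
  rw [← integral_complex_ofReal, ← integral_exp_smul_survivalLimit hN hab hx hlam]
  refine setIntegral_congr_fun measurableSet_Ioi fun t ht => ?_
  have h2 : ((survivalLimit hN a b t x).re : ℂ) = survivalLimit hN a b t x :=
    Complex.ext rfl (by simp [survivalLimit_im hN ht])
  simp only [Complex.real_smul, Complex.ofReal_mul]
  rw [h2]

lemma hasLaplaceTransform_exitDistribution (hN : 2 ≤ N) (hab : a < b) (hx : x ∈ Set.Ioo a b) :
    HasLaplaceTransform (fun t => exitDistribution hN a b t x)
      (fun lam => 1 / (lam : ℂ) * exitTransform N a b lam x) := by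
  obtain ⟨K, hK0, h⟩ := exists_survival_linear_bound hN hab hx
  intro lam hlam
  have i1 := integrableOn_exp_mul_Ioi (neg_lt_zero.2 hlam) 0
  have i2 : IntegrableOn (fun t => Real.exp (-lam * t) * (survivalLimit hN a b t x).re)
      (Set.Ioi 0) :=
    integrableOn_exp_smul (Complex.continuous_re.comp_continuousOn (continuousOn_survivalLimit hN x))
      (fun t ht => (Complex.abs_re_le_norm _).trans (h t ht).2.1) hlam
  have e : Set.EqOn (fun t => exitDistribution hN a b t x * Real.exp (-lam * t))
      (fun t => Real.exp (-lam * t) - Real.exp (-lam * t) * (survivalLimit hN a b t x).re)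
      (Set.Ioi 0) := fun t ht => by
    simp only [exitDistribution, if_pos (Set.mem_Ioi.1 ht)]
    ring
  refine ⟨(integrableOn_congr_fun e measurableSet_Ioi).2 (i1.sub' i2), ?_⟩
  have hl : (lam : ℂ) ≠ 0 := by exact_mod_cast hlam.ne'
  rw [setIntegral_congr_fun measurableSet_Ioi e, integral_sub i1 i2, Complex.ofReal_sub,
    integral_exp_mul_survivalLimit_re hN hab hx hlam, integral_exp_mul_Ioi (neg_lt_zero.2 hlam),
    survivalTransform, mul_zero, Real.exp_zero]
  push_cast
  field_simp
  ring

lemma tendsto_exitLaplace (hN : 2 ≤ N) (hab : a < b) (hx : x ∈ Set.Ioo a b) {lam : ℝ}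
    (hlam : 0 < lam) :
    Tendsto (fun n : ℕ => exitLaplace N a b n x lam) atTop
      (𝓝 (∫ t in Set.Ioi (0 : ℝ), exitDensity hN a b t x * Real.exp (-lam * t))) := by
  -- Both sides are brought to the form `1 - lam` times the transform of a survival function, so no
  -- convergence of densities is needed.
  have e : ∫ t in Set.Ioi (0 : ℝ), exitDensity hN a b t x * Real.exp (-lam * t) =
      1 - lam * ∫ t in Set.Ioi (0 : ℝ), Real.exp (-lam * t) * (survivalLimit hN a b t x).re := by
    apply Complex.ofReal_injective
    have hl : (lam : ℂ) ≠ 0 := by exact_mod_cast hlam.ne'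
    rw [((hasLaplaceTransform_exitDensity hN hab hx) lam hlam).2, Complex.ofReal_sub,
      Complex.ofReal_mul, integral_exp_mul_survivalLimit_re hN hab hx hlam, survivalTransform,
      mul_inv_cancel_left₀ hl, Complex.ofReal_one, sub_sub_cancel]
  rw [e]
  refine (((tendsto_integral_survival hN a b x hlam).const_mul lam).const_sub 1).congr fun n => ?_
  exact (hasSum_exitLaplaceTerm hN hx hlam n).tsum_eq.symm

end

end PseudoBM

end

/-! ### The main theorem -/

theorem mainTheorem3 (N : ℕ) (hN : 2 ≤ N) (a b : ℝ) (hab : a < b) :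
    (∀ lam : ℝ, 0 < lam → PseudoBM.Delta N a b lam ≠ 0) ∧
    (∀ (x : ℝ) (n k : ℕ),
      Integrable (PseudoBM.chainDensity N x (PseudoBM.dyadicTimes n k))) ∧
    ∃ I J : ℝ → ℝ → ℝ, ∀ x ∈ Set.Ioo a b,
      -- the limits defining the pseudo-distribution of the exit time: `I` is its density
      -- and `J` its distribution function
      (∀ t : ℝ, 0 ≤ t →
        Tendsto (fun n : ℕ => PseudoBM.exitCdf N a b n x t) atTop (𝓝 (J t x))) ∧
      ContinuousOn (fun t => I t x) (Set.Ioi 0) ∧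
      (∀ t : ℝ, 0 ≤ t →
        IntervalIntegrable (fun s => I s x) volume 0 t ∧ J t x = ∫ s in (0 : ℝ)..t, I s x) ∧
      (∀ lam : ℝ, 0 < lam →
        (∀ n : ℕ, Summable (PseudoBM.exitLaplaceTerm N a b n x lam)) ∧
        Tendsto (fun n : ℕ => PseudoBM.exitLaplace N a b n x lam) atTop
          (𝓝 (∫ t in Set.Ioi (0 : ℝ), I t x * Real.exp (-lam * t)))) ∧
      -- the Laplace transforms of `I` and `J`
      PseudoBM.HasLaplaceTransform (fun t => I t x) (fun lam =>
        (PseudoBM.DeltaPlus N a b 0 lam x + PseudoBM.DeltaMinus N a b 0 lam x)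
          / PseudoBM.Delta N a b lam) ∧
      PseudoBM.HasLaplaceTransform (fun t => J t x) (fun lam =>
        (1 / (lam : ℂ)) *
          ((PseudoBM.DeltaPlus N a b 0 lam x + PseudoBM.DeltaMinus N a b 0 lam x)
            / PseudoBM.Delta N a b lam)) ∧
      -- these transforms characterize `I` and `J`
      (∀ g : ℝ → ℝ,
        PseudoBM.HasLaplaceTransform g (fun lam =>
          (PseudoBM.DeltaPlus N a b 0 lam x + PseudoBM.DeltaMinus N a b 0 lam x)
            / PseudoBM.Delta N a b lam) →
        ∀ᵐ t ∂(volume.restrict (Set.Ioi (0 : ℝ))), g t = I t x) ∧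
      (∀ g : ℝ → ℝ,
        PseudoBM.HasLaplaceTransform g (fun lam =>
          (1 / (lam : ℂ)) *
            ((PseudoBM.DeltaPlus N a b 0 lam x + PseudoBM.DeltaMinus N a b 0 lam x)
              / PseudoBM.Delta N a b lam)) →
        ∀ᵐ t ∂(volume.restrict (Set.Ioi (0 : ℝ))), g t = J t x) := by
  refine ⟨fun lam hlam => PseudoBM.Delta_ne_zero hN hab hlam,
    fun x n k => PseudoBM.integrable_chainDensity (PseudoBM.one_le_of_two_le hN) x n k,
    PseudoBM.exitDensity hN a b, PseudoBM.exitDistribution hN a b, fun x hx => ?_⟩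
  have hI := PseudoBM.hasLaplaceTransform_exitDensity hN hab hx
  have hJ := PseudoBM.hasLaplaceTransform_exitDistribution hN hab hx
  exact ⟨fun t ht => PseudoBM.tendsto_exitCdf hN hx ht,
    PseudoBM.continuousOn_exitDensity hN a b x,
    fun t ht => ⟨PseudoBM.intervalIntegrable_exitDensity hN hab hx ht,
      PseudoBM.exitDistribution_eq_integral hN hab hx ht⟩,
    fun lam hlam => ⟨fun n => (PseudoBM.hasSum_exitLaplaceTerm hN hx hlam n).summable,
      PseudoBM.tendsto_exitLaplace hN hab hx hlam⟩,
    hI, hJ, fun g hg => hI.ae_eq hg, fun g hg => hJ.ae_eq hg⟩
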